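/- Let $S$ be a closed connected oriented smooth surface (for instance of genus $\geq 2$), let $\pi\colon C\to S$ be its tangent circle bundle, i.e. the bundle $(TS\setminus S)/\mathbb{R}_{>0}$ of rays in the tangent planes, and let $\lambda$ denote the canonical 1-form of a cotangent bundle. Put $$M_1=(C\times\mathbb{R})\times\mathbb{R}^2,\qquad M_2=T^*C .$$ (1) $M_1$ and $M_2$ are diffeomorphic. (2) Let $g$ be a Riemannian metric on $S$, which identifies $C\times\mathbb{R}$ with $T^*S\setminus S$ by $(c,t)\mapsto g(e^t u_c,\cdot)$, where $u_c$ is the unit vector in the ray $c$. Let $\tau$ be a smooth 2-form on $S$ and let $\omega=d\theta$ be an exact symplectic form on $C\times\mathbb{R}$ which, on $C\times(a,b)$ for some $a<b$, coincides with the twisted cotangent form $d\lambda+\pi^*\tau$ of $T^*S\setminus S$. (When $S$ has genus $\geq 2$ this includes McDuff's symplectic structure of Liouville type on $C\times\mathbb{R}\cong T^*S\setminus S$, obtained with $\tau$ an area form by completing, at both ends, a compact piece of $(T^*S\setminus S,\,d\lambda+\pi^*\tau)$ with convex boundary.) Equip $M_1$ with $\omega_1=\omega\oplus dx\wedge dy$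 and $M_2$ with its standard symplectic form $\omega_2=d\lambda$. Then both $(M_k,\omega_k)$ admit compatible smooth almost complex structures, and there is a diffeomorphism $\varphi\colon M_1\to M_2$ which is compatible with the homotopy classes of almost complex structures associated to $\omega_1$ and $\omega_2$: for every smooth $\omega_1$-compatible $J_1$ and every smooth $\omega_2$-compatible $J_2$, the almost complex structures $J_1$ and $\varphi^*J_2=(d\varphi)^{-1}\circ J_2\circ d\varphi$ are homotopic through almost complex structures on $M_1$ (a family $J_s$, $s\in[0,1]$, of endomorphism fields of $TM_1$ with $J_s^2=-1$, jointly continuous in $s$ and the point). -/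

import Mathlib

open Set Function Bundle Metric
open scoped Manifold ContDiff Topology

/-! ### The tangent circle bundle of a surface

`C → S` is the bundle of rays in the tangent planes, `(TS ∖ 0) / ℝ_{>0}`.  In a chart of `S` a ray
is represented by its unit vector, and a change of charts acts by its derivative, followed by
normalization. -/

section CircleBundle

/-- The action of a linear map of the plane on the circle of rays: `s ↦ A s / ‖A s‖`
(only used for invertible `A`; the value at `A s = 0` is irrelevant). -/
noncomputable def rayMap (A : EuclideanSpace ℝ (Fin 2) →L[ℝ] EuclideanSpace ℝ (Fin 2))
    (s : sphere (0 : EuclideanSpace ℝ (Fin 2)) 1) : sphere (0 : EuclideanSpace ℝ (Fin 2)) 1 :=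
  open Classical in
  if h : A s = 0 then s else
    ⟨‖A s‖⁻¹ • A s, by
      rw [mem_sphere_zero_iff_norm, norm_smul, norm_inv, norm_norm,
        inv_mul_cancel₀ (norm_ne_zero_iff.mpr h)]⟩

lemma rayMap_coe {A : EuclideanSpace ℝ (Fin 2) →L[ℝ] EuclideanSpace ℝ (Fin 2)}
    {s : sphere (0 : EuclideanSpace ℝ (Fin 2)) 1} (h : A s ≠ 0) :
    (rayMap A s : EuclideanSpace ℝ (Fin 2)) = ‖A s‖⁻¹ • A s := by
  simp [rayMap, h]

lemma rayMap_eq_of_smul {A : EuclideanSpace ℝ (Fin 2) →L[ℝ] EuclideanSpace ℝ (Fin 2)}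
    {s t : sphere (0 : EuclideanSpace ℝ (Fin 2)) 1} {c : ℝ} (hc : 0 < c)
    (h : A s = c • (t : EuclideanSpace ℝ (Fin 2))) : rayMap A s = t := by
  have ht : ‖(t : EuclideanSpace ℝ (Fin 2))‖ = 1 := by simp
  have hn : ‖A s‖ = c := by rw [h, norm_smul, ht, mul_one, Real.norm_of_nonneg hc.le]
  have h0 : A s ≠ 0 := by
    rw [← norm_ne_zero_iff, hn]; exact hc.ne'
  apply Subtype.ext
  rw [rayMap_coe h0, hn, h, smul_smul, inv_mul_cancel₀ hc.ne', one_smul]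

variable (S : Type*) [TopologicalSpace S] [ChartedSpace (EuclideanSpace ℝ (Fin 2)) S]
  [IsManifold (𝓡 2) ∞ S]

lemma tangentCore_apply_ne_zero {i j : atlas (EuclideanSpace ℝ (Fin 2)) S} {x : S}
    (hi : x ∈ i.1.source) (hj : x ∈ j.1.source) {v : EuclideanSpace ℝ (Fin 2)} (hv : v ≠ 0) :
    (tangentBundleCore (𝓡 2) S).coordChange i j x v ≠ 0 := by
  intro h
  apply hv
  have h1 := (tangentBundleCore (𝓡 2) S).coordChange_comp i j i x ⟨⟨hi, hj⟩, hi⟩ v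
  rw [h, map_zero, (tangentBundleCore (𝓡 2) S).coordChange_self i x hi] at h1
  exact h1.symm

lemma sphere_coe_ne_zero (s : sphere (0 : EuclideanSpace ℝ (Fin 2)) 1) :
    (s : EuclideanSpace ℝ (Fin 2)) ≠ 0 := by
  rw [← norm_ne_zero_iff]; simp

/-- The cocycle of the tangent circle bundle: the one of the tangent bundle, acting on rays. -/
noncomputable def circleBundleCore :
    FiberBundleCore (atlas (EuclideanSpace ℝ (Fin 2)) S) S
      (sphere (0 : EuclideanSpace ℝ (Fin 2)) 1) where
  baseSet i := i.1.source
  isOpen_baseSet i := i.1.open_source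
  indexAt := achart (EuclideanSpace ℝ (Fin 2))
  mem_baseSet_at := mem_chart_source (EuclideanSpace ℝ (Fin 2))
  coordChange i j x s := rayMap ((tangentBundleCore (𝓡 2) S).coordChange i j x) s
  coordChange_self i x hx s :=
    rayMap_eq_of_smul one_pos
      (by rw [(tangentBundleCore (𝓡 2) S).coordChange_self i x hx, one_smul])
  continuousOn_coordChange i j := by
    rw [Topology.IsInducing.subtypeVal.continuousOn_iff]
    have hA : ContinuousOn (fun p : S × sphere (0 : EuclideanSpace ℝ (Fin 2)) 1 =>
        (tangentBundleCore (𝓡 2) S).coordChange i j p.1 (p.2 : EuclideanSpace ℝ (Fin 2)))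
        ((i.1.source ∩ j.1.source) ×ˢ univ) :=
      (((tangentBundleCore (𝓡 2) S).continuousOn_coordChange i j).comp continuousOn_fst
        (fun p hp => hp.1)).clm_apply
        (continuous_subtype_val.comp continuous_snd).continuousOn
    have hne : ∀ p ∈ (i.1.source ∩ j.1.source) ×ˢ
        (univ : Set (sphere (0 : EuclideanSpace ℝ (Fin 2)) 1)),
        (tangentBundleCore (𝓡 2) S).coordChange i j p.1 (p.2 : EuclideanSpace ℝ (Fin 2)) ≠ 0 :=
      fun p hp => tangentCore_apply_ne_zero S hp.1.1 hp.1.2 (sphere_coe_ne_zero p.2)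
    refine ContinuousOn.congr (f := fun p : S × sphere (0 : EuclideanSpace ℝ (Fin 2)) 1 =>
      ‖(tangentBundleCore (𝓡 2) S).coordChange i j p.1 (p.2 : EuclideanSpace ℝ (Fin 2))‖⁻¹ •
        (tangentBundleCore (𝓡 2) S).coordChange i j p.1 (p.2 : EuclideanSpace ℝ (Fin 2))) ?_ ?_
    · exact (hA.norm.inv₀ fun p hp => norm_ne_zero_iff.mpr (hne p hp)).smul hA
    · intro p hp
      exact rayMap_coe (hne p hp)
  coordChange_comp i j k x hx s := by
    have hs := sphere_coe_ne_zero s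
    have h1 := tangentCore_apply_ne_zero S hx.1.1 hx.1.2 hs
    have h2 := tangentCore_apply_ne_zero S hx.1.1 hx.2 hs
    have hn1 := norm_pos_iff.mpr h1
    have hn2 := norm_pos_iff.mpr h2
    refine rayMap_eq_of_smul (mul_pos (inv_pos.mpr hn1) hn2) ?_
    rw [rayMap_coe h1, map_smul, (tangentBundleCore (𝓡 2) S).coordChange_comp i j k x hx,
      rayMap_coe h2, smul_smul, mul_assoc, mul_inv_cancel₀ hn2.ne', mul_one]

/-- The total space `C` of the tangent circle bundle of the surface `S`.  A point is a pair
`⟨x, s⟩`, where the unit vector `s` represents a ray of `T_x S` in the preferred chart at `x`,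
hence in Mathlib's model of `T_x S`. -/
abbrev TangentCircleBundle : Type _ :=
  Bundle.TotalSpace (sphere (0 : EuclideanSpace ℝ (Fin 2)) 1) (circleBundleCore S).Fiber

/-- The charts of `C`: local trivializations, followed by charts of `S` and of the circle. -/
noncomputable instance : ChartedSpace (ModelProd (EuclideanSpace ℝ (Fin 2)) (EuclideanSpace ℝ (Fin 1)))
    (TangentCircleBundle S) :=
  ChartedSpace.comp _ (S × sphere (0 : EuclideanSpace ℝ (Fin 2)) 1) _

/-- A map into the circle is smooth if it is smooth as a map into the plane. -/
lemma contMDiffOn_of_coe_sphere {E' : Type*} [NormedAddCommGroup E'] [NormedSpace ℝ E']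
    {H' : Type*} [TopologicalSpace H'] {J : ModelWithCorners ℝ E' H'}
    {N : Type*} [TopologicalSpace N] [ChartedSpace H' N]
    [IsManifold J ∞ N]
    {f : N → sphere (0 : EuclideanSpace ℝ (Fin 2)) 1} {s : Set N}
    (hf : ContMDiffOn J 𝓘(ℝ, EuclideanSpace ℝ (Fin 2)) ∞
      (fun x => (f x : EuclideanSpace ℝ (Fin 2))) s) :
    ContMDiffOn J (𝓡 1) ∞ f s := by
  have : Fact (Module.finrank ℝ (EuclideanSpace ℝ (Fin 2)) = 1 + 1) :=
    ⟨finrank_euclideanSpace_fin⟩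
  rw [contMDiffOn_iff_target]
  refine ⟨continuousOn_iff_continuous_domRestrict.2 (continuous_induced_rng.2
    (continuousOn_iff_continuous_domRestrict.1 hf.continuousOn)), ?_⟩
  intro v
  let U : _ ≃ₗᵢ[ℝ] _ :=
    (OrthonormalBasis.fromOrthogonalSpanSingleton
        (𝕜 := ℝ) 1 (ne_zero_of_mem_unit_sphere (-v))).repr
  have h : ContDiffOn ℝ ω _ Set.univ := U.contDiff.contDiffOn
  have H₁ := (h.comp_inter contDiffOn_stereoToFun).contMDiffOn
  refine ((H₁.of_le le_top).comp' hf).congr_mono ?_ ?_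
  · intro x _
    rfl
  · intro x hx
    refine ⟨hx.1, ?_⟩
    have h2 := hx.2
    have hfxv : ((f x : EuclideanSpace ℝ (Fin 2)) = -(v : EuclideanSpace ℝ (Fin 2))) ↔
        inner ℝ (f x : EuclideanSpace ℝ (Fin 2)) (-(v : EuclideanSpace ℝ (Fin 2))) = 1 := by
      rw [inner_eq_one_iff_of_norm_eq_one (by simp) (by simp)]
    simp [chartAt, ChartedSpace.chartAt, Subtype.ext_iff, hfxv, real_inner_comm] at h2 ⊢
    exact h2

lemma contMDiffOn_circleBundle_trivChange (i j : atlas (EuclideanSpace ℝ (Fin 2)) S) :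
    ContMDiffOn ((𝓡 2).prod (𝓡 1)) ((𝓡 2).prod (𝓡 1)) ∞
      ((circleBundleCore S).trivChange i j) ((circleBundleCore S).trivChange i j).source := by
  have hne : ∀ p ∈ ((circleBundleCore S).trivChange i j).source,
      (tangentBundleCore (𝓡 2) S).coordChange i j p.1 (p.2 : EuclideanSpace ℝ (Fin 2)) ≠ 0 :=
    fun p hp => tangentCore_apply_ne_zero S hp.1.1 hp.1.2 (sphere_coe_ne_zero p.2)
  have : Fact (Module.finrank ℝ (EuclideanSpace ℝ (Fin 2)) = 1 + 1) :=
    ⟨finrank_euclideanSpace_fin⟩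
  have hcoe : ContMDiff (𝓡 1) 𝓘(ℝ, EuclideanSpace ℝ (Fin 2)) ∞
      (fun s : sphere (0 : EuclideanSpace ℝ (Fin 2)) 1 => (s : EuclideanSpace ℝ (Fin 2))) :=
    contMDiff_coe_sphere
  have : (tangentBundleCore (𝓡 2) S).IsContMDiff (𝓡 2) ∞ :=
    tangentBundleCore.isContMDiff (h := by simpa using (inferInstance : IsManifold (𝓡 2) ∞ S))
  have hA : ContMDiffOn ((𝓡 2).prod (𝓡 1)) 𝓘(ℝ, EuclideanSpace ℝ (Fin 2)) ∞
      (fun p : S × sphere (0 : EuclideanSpace ℝ (Fin 2)) 1 =>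
        (tangentBundleCore (𝓡 2) S).coordChange i j p.1 (p.2 : EuclideanSpace ℝ (Fin 2)))
      ((circleBundleCore S).trivChange i j).source :=
    ContMDiffOn.clm_apply
      (((tangentBundleCore (𝓡 2) S).contMDiffOn_coordChange (𝓡 2) i j).comp contMDiffOn_fst
        (fun p hp => hp.1))
      (hcoe.comp contMDiff_snd).contMDiffOn
  have hN : ContMDiffOn ((𝓡 2).prod (𝓡 1)) 𝓘(ℝ, EuclideanSpace ℝ (Fin 2)) ∞
      (fun p : S × sphere (0 : EuclideanSpace ℝ (Fin 2)) 1 =>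
        ‖(tangentBundleCore (𝓡 2) S).coordChange i j p.1 (p.2 : EuclideanSpace ℝ (Fin 2))‖⁻¹ •
          (tangentBundleCore (𝓡 2) S).coordChange i j p.1 (p.2 : EuclideanSpace ℝ (Fin 2)))
      ((circleBundleCore S).trivChange i j).source := by
    have hn : ContDiffOn ℝ ∞ (fun v : EuclideanSpace ℝ (Fin 2) => ‖v‖⁻¹ • v) {0}ᶜ := by
      intro v hv
      have hv' : v ≠ 0 := hv
      exact (((contDiffAt_norm ℝ hv').inv (norm_ne_zero_iff.mpr hv')).smul
        contDiffAt_id).contDiffWithinAt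
    exact hn.contMDiffOn.comp hA hne
  refine contMDiffOn_fst.prodMk (contMDiffOn_of_coe_sphere (hN.congr ?_))
  intro p hp
  exact rayMap_coe (hne p hp)

instance : IsManifold ((𝓡 2).prod (𝓡 1)) ∞ (TangentCircleBundle S) := by
  refine isManifold_of_contDiffOn _ _ _ ?_
  rintro _ _ ⟨_, ⟨_, ⟨i, rfl⟩, rfl⟩, c, hc, rfl⟩ ⟨_, ⟨_, ⟨j, rfl⟩, rfl⟩, c', hc', rfl⟩
  have h1 := contMDiffOn_symm_of_mem_maximalAtlas (I := (𝓡 2).prod (𝓡 1)) (n := ∞)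
    (IsManifold.subset_maximalAtlas hc)
  have h2 := contMDiffOn_of_mem_maximalAtlas (I := (𝓡 2).prod (𝓡 1)) (n := ∞)
    (IsManifold.subset_maximalAtlas hc')
  have h3 := contMDiffOn_circleBundle_trivChange S i j
  set T := (circleBundleCore S).trivChange i j with hT
  set Ψ := (((circleBundleCore S).localTriv i).toOpenPartialHomeomorph.trans c).symm.trans
    (((circleBundleCore S).localTriv j).toOpenPartialHomeomorph.trans c') with hΨ
  have hsrc : ∀ y ∈ Ψ.source, y ∈ c.target ∧ c.symm y ∈ T.source ∧ T (c.symm y) ∈ c'.source ∧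
      Ψ y = c' (T (c.symm y)) := by
    intro y hy
    obtain ⟨⟨ha, hb⟩, hc1, hd⟩ := hy
    have hi : (c.symm y).1 ∈ i.1.source := hb.1
    have hj : (c.symm y).1 ∈ j.1.source := hc1
    have hTy : ((circleBundleCore S).localTriv j)
        (((circleBundleCore S).localTriv i).toOpenPartialHomeomorph.symm (c.symm y)) =
          T (c.symm y) :=
      Prod.ext rfl ((circleBundleCore S).coordChange_comp i _ j (c.symm y).1
        ⟨⟨hi, (circleBundleCore S).mem_baseSet_at _⟩, hj⟩ (c.symm y).2)
    have hd' : T (c.symm y) ∈ c'.source := hTy ▸ hd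
    refine ⟨ha, ⟨⟨hi, hj⟩, mem_univ _⟩, hd', ?_⟩
    rw [← hTy]; rfl
  have h4 : ContMDiffOn ((𝓡 2).prod (𝓡 1)) ((𝓡 2).prod (𝓡 1)) ∞ Ψ Ψ.source :=
    (h2.comp (h3.comp (h1.mono fun y hy => (hsrc y hy).1) fun y hy => (hsrc y hy).2.1)
      fun y hy => (hsrc y hy).2.2.1).congr fun y hy => (hsrc y hy).2.2.2
  rw [← contMDiffOn_iff_contDiffOn]
  exact ((𝓡 2).prod (𝓡 1)).contMDiff.comp_contMDiffOn
    (h4.comp (((𝓡 2).prod (𝓡 1)).contMDiffOn_symm.mono inter_subset_right) fun y hy => hy.1)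

end CircleBundle

/-! ### Differential forms of degree one and two -/

section Forms

variable {E : Type*} [NormedAddCommGroup E] [NormedSpace ℝ E] {H : Type*} [TopologicalSpace H]
  (I : ModelWithCorners ℝ E H) (M : Type*) [TopologicalSpace M] [ChartedSpace H M]

/-- Fields of linear forms on the tangent spaces of `M`. -/
abbrev OneForm : Type _ := ∀ x : M, TangentSpace I x →L[ℝ] ℝ

/-- Fields of bilinear forms on the tangent spaces of `M`. -/
abbrev BilinForm : Type _ := ∀ x : M, TangentSpace I x →L[ℝ] TangentSpace I x →L[ℝ] ℝ

/-- The cotangent bundle `T^*M`. -/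
abbrev CotangentBundle : Type _ :=
  Bundle.TotalSpace (E →L[ℝ] ℝ) (fun x : M => TangentSpace I x →L[ℝ] ℝ)

variable {I M}

/-- The exterior derivative of a 1-form, `dθ(u, v) = D_u θ(v) - D_v θ(u)` computed at `x` in the
preferred chart at `x`. -/
noncomputable def extDerivOneForm (θ : OneForm I M) : BilinForm I M := fun x =>
  let θ' : E → E →L[ℝ] ℝ := fun y =>
    (θ ((extChartAt I x).symm y)).comp
      (mfderivWithin 𝓘(ℝ, E) I (extChartAt I x).symm (range I) y)
  let D : E →L[ℝ] E →L[ℝ] ℝ := fderivWithin ℝ θ' (range I) (extChartAt I x x)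
  let A : E →L[ℝ] E := mfderiv I 𝓘(ℝ, E) (extChartAt I x) x
  ((D - D.flip).bilinearComp A A : E →L[ℝ] E →L[ℝ] ℝ)

/-- The pullback of a field of bilinear forms under a map. -/
noncomputable def pullbackBilin {E' : Type*} [NormedAddCommGroup E'] [NormedSpace ℝ E']
    {H' : Type*} [TopologicalSpace H'] {I' : ModelWithCorners ℝ E' H'} {M' : Type*}
    [TopologicalSpace M'] [ChartedSpace H' M'] (f : M → M') (Ω : BilinForm I' M') :
    BilinForm I M := fun x =>
  let B : E' →L[ℝ] E' →L[ℝ] ℝ := Ω (f x)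
  let A : E →L[ℝ] E' := mfderiv I I' f x
  (B.bilinearComp A A : E →L[ℝ] E →L[ℝ] ℝ)

/-- Smoothness of a 1-form. -/
def IsSmoothOneForm [IsManifold I ∞ M] (θ : OneForm I M) : Prop :=
  ContMDiff I (I.prod 𝓘(ℝ, E →L[ℝ] ℝ)) ∞ (fun x => (⟨x, θ x⟩ : CotangentBundle I M))

/-- Nondegeneracy of a field of bilinear forms. -/
def IsNondegenerateBilin (Ω : BilinForm I M) : Prop :=
  ∀ (x : M) (u : TangentSpace I x), (∀ v : TangentSpace I x, Ω x u v = 0) → u = 0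

/-- `Ω` is a smooth 2-form (a smooth field of alternating bilinear forms). -/
def IsSmoothTwoForm [IsManifold I ∞ M] (Ω : BilinForm I M) : Prop :=
  (∀ (x : M) (v : TangentSpace I x), Ω x v v = 0) ∧
  ContMDiff I (I.prod 𝓘(ℝ, E →L[ℝ] E →L[ℝ] ℝ)) ∞
    (fun x => TotalSpace.mk' (E →L[ℝ] E →L[ℝ] ℝ) x (Ω x))

/-- The canonical (Liouville) 1-form of `T^*M`: `λ_p(ξ) = p (dπ ξ)`. -/
noncomputable def canonicalOneForm [IsManifold I ∞ M] :
    OneForm (I.prod 𝓘(ℝ, E →L[ℝ] ℝ)) (CotangentBundle I M) := fun p =>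
  (p.2 : TangentSpace I p.1 →L[ℝ] ℝ).comp
    (mfderiv (I.prod 𝓘(ℝ, E →L[ℝ] ℝ)) I (fun q : CotangentBundle I M => q.1) p)

variable (I M) in
/-- The standard symplectic form `dλ` of `T^*M`. -/
noncomputable def cotangentForm [IsManifold I ∞ M] :
    BilinForm (I.prod 𝓘(ℝ, E →L[ℝ] ℝ)) (CotangentBundle I M) :=
  extDerivOneForm canonicalOneForm

end Forms

/-- The standard symplectic form `dx₀ ∧ dx₁` of the plane. -/
noncomputable def planeForm : BilinForm (𝓡 2) (EuclideanSpace ℝ (Fin 2)) := fun _ =>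
  ((EuclideanSpace.proj (0 : Fin 2) : EuclideanSpace ℝ (Fin 2) →L[ℝ] ℝ).smulRight
      (EuclideanSpace.proj (1 : Fin 2) : EuclideanSpace ℝ (Fin 2) →L[ℝ] ℝ)) -
    ((EuclideanSpace.proj (1 : Fin 2) : EuclideanSpace ℝ (Fin 2) →L[ℝ] ℝ).smulRight
      (EuclideanSpace.proj (0 : Fin 2) : EuclideanSpace ℝ (Fin 2) →L[ℝ] ℝ))

/-! ### Almost complex structures -/

section AlmostComplex

variable {E : Type*} [NormedAddCommGroup E] [NormedSpace ℝ E] {H : Type*} [TopologicalSpace H]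
  (I : ModelWithCorners ℝ E H) (M : Type*) [TopologicalSpace M] [ChartedSpace H M]

/-- Fields of endomorphisms of the tangent spaces of `M`. -/
abbrev EndField : Type _ := ∀ x : M, TangentSpace I x →L[ℝ] TangentSpace I x

variable {I M}

/-- `J` is a (smooth) almost complex structure. -/
def IsAlmostComplex [IsManifold I ∞ M] (J : EndField I M) : Prop :=
  (∀ (x : M) (v : TangentSpace I x), J x (J x v) = -v) ∧
  ContMDiff I.tangent I.tangent ∞
    (fun v : TangentBundle I M => (⟨v.1, J v.1 v.2⟩ : TangentBundle I M))

/-- `J` is compatible with `Ω`: `Ω(J·, J·) = Ω` and `Ω(v, J v) > 0` for `v ≠ 0`. -/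
def IsCompatible (J : EndField I M) (Ω : BilinForm I M) : Prop :=
  (∀ (x : M) (u v : TangentSpace I x), Ω x (J x u) (J x v) = Ω x u v) ∧
  ∀ (x : M) (v : TangentSpace I x), v ≠ 0 → 0 < Ω x v (J x v)

/-- `J₀` and `J₁` are homotopic through almost complex structures: there is a family `K s`,
`s ∈ [0, 1]`, of fields of endomorphisms of square `-1`, jointly continuous in `s` and the point
of `M`. -/
def AlmostComplexHomotopic [IsManifold I ∞ M] (J₀ J₁ : EndField I M) : Prop :=
  ∃ K : unitInterval → EndField I M,
    (∀ (s : unitInterval) (x : M) (v : TangentSpace I x), K s x (K s x v) = -v) ∧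
    Continuous (fun p : unitInterval × TangentBundle I M =>
      (⟨p.2.1, K p.1 p.2.1 p.2.2⟩ : TangentBundle I M)) ∧
    K 0 = J₀ ∧ K 1 = J₁

/-- The pullback `(dφ)⁻¹ ∘ J ∘ dφ` under a diffeomorphism. -/
noncomputable def pullbackEnd {E' : Type*} [NormedAddCommGroup E'] [NormedSpace ℝ E']
    {H' : Type*} [TopologicalSpace H'] {I' : ModelWithCorners ℝ E' H'} {M' : Type*}
    [TopologicalSpace M'] [ChartedSpace H' M'] [IsManifold I ∞ M] [IsManifold I' ∞ M']
    (φ : M ≃ₘ^∞⟮I, I'⟯ M') (J : EndField I' M') : EndField I M := fun x =>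
  let dφ : TangentSpace I x ≃L[ℝ] TangentSpace I' (φ x) :=
    φ.mfderivToContinuousLinearEquiv (by simp) x
  (dφ.symm : TangentSpace I' (φ x) →L[ℝ] TangentSpace I x).comp
    ((J (φ x)).comp (dφ : TangentSpace I x →L[ℝ] TangentSpace I' (φ x)))

end AlmostComplex

/-! ### The symplectic forms -/

section McDuff

variable (S : Type*) [TopologicalSpace S] [ChartedSpace (EuclideanSpace ℝ (Fin 2)) S]
  [IsManifold (𝓡 2) ∞ S]

/-- Model of `C`. -/
noncomputable abbrev modelC := (𝓡 2).prod (𝓡 1)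

/-- Model of `C × ℝ`. -/
noncomputable abbrev modelCR := modelC.prod 𝓘(ℝ, ℝ)

/-- Model of `(C × ℝ) × ℝ²`. -/
noncomputable abbrev modelCRR := modelCR.prod (𝓡 2)

/-- Model of `T^*C`. -/
noncomputable abbrev modelCotangentC :=
  modelC.prod 𝓘(ℝ, (EuclideanSpace ℝ (Fin 2) × EuclideanSpace ℝ (Fin 1)) →L[ℝ] ℝ)

variable {S}

/-- The `g`-unit vector in a ray. -/
noncomputable def rayUnitVector
    (g : ContMDiffRiemannianMetric (𝓡 2) ∞ (EuclideanSpace ℝ (Fin 2))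
      (fun x : S => TangentSpace (𝓡 2) x))
    (c : TangentCircleBundle S) : TangentSpace (𝓡 2) c.1 :=
  let s : sphere (0 : EuclideanSpace ℝ (Fin 2)) 1 := c.2
  let v : TangentSpace (𝓡 2) c.1 := (s : EuclideanSpace ℝ (Fin 2))
  (√(g.inner c.1 v v))⁻¹ • v

/-- The identification of `C × ℝ` with `T^*S` minus the zero section given by a Riemannian metric:
`(c, t) ↦ g(e^t u, ·)`, with `u` the unit vector in the ray `c`. -/
noncomputable def polarMap
    (g : ContMDiffRiemannianMetric (𝓡 2) ∞ (EuclideanSpace ℝ (Fin 2))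
      (fun x : S => TangentSpace (𝓡 2) x)) :
    TangentCircleBundle S × ℝ → CotangentBundle (𝓡 2) S := fun p =>
  ⟨p.1.1, g.inner p.1.1 (Real.exp p.2 • rayUnitVector g p.1)⟩

/-- The magnetic symplectic form `dλ + π^*τ` of `T^*S`, on `C × ℝ = T^*S ∖ S`. -/
noncomputable def magneticForm
    (g : ContMDiffRiemannianMetric (𝓡 2) ∞ (EuclideanSpace ℝ (Fin 2))
      (fun x : S => TangentSpace (𝓡 2) x))
    (τ : BilinForm (𝓡 2) S) : BilinForm modelCR (TangentCircleBundle S × ℝ) := fun x =>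
  pullbackBilin (polarMap g) (cotangentForm (𝓡 2) S) x +
    pullbackBilin (fun p : TangentCircleBundle S × ℝ => p.1.1) τ x

/-- The product of a 2-form `Ω` on `C × ℝ` with the standard form of `ℝ²`. -/
noncomputable def productForm (Ω : BilinForm modelCR (TangentCircleBundle S × ℝ)) :
    BilinForm modelCRR ((TangentCircleBundle S × ℝ) × EuclideanSpace ℝ (Fin 2)) := fun x =>
  pullbackBilin Prod.fst Ω x + pullbackBilin Prod.snd planeForm x

end McDuff

/-! ### Square roots of positive operators and polar decomposition -/

section PolarDecomposition

variable {E : Type*} [NormedAddCommGroup E] [InnerProductSpace ℝ E]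

/-- Symmetric positive definite operators on a real inner product space. -/
def IsPosDefOp (Q : E →L[ℝ] E) : Prop :=
  (∀ u v, inner ℝ (Q u) v = inner ℝ u (Q v)) ∧ ∀ v, v ≠ 0 → 0 < inner ℝ (Q v) v

lemma IsPosDefOp.isSymmetric {Q : E →L[ℝ] E} (hQ : IsPosDefOp Q) :
    (Q : E →ₗ[ℝ] E).IsSymmetric := fun u v => hQ.1 u v

variable [FiniteDimensional ℝ E]

lemma IsPosDefOp.isUnit {Q : E →L[ℝ] E} (hQ : IsPosDefOp Q) : IsUnit Q := by
  have hinj : Injective (Q : E →ₗ[ℝ] E) := by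
    rw [injective_iff_map_eq_zero]
    intro v hv
    by_contra h
    have := hQ.2 v h
    rw [show Q v = 0 from hv, inner_zero_left] at this
    exact lt_irrefl _ this
  let e := (LinearEquiv.ofInjectiveEndo (Q : E →ₗ[ℝ] E) hinj).toContinuousLinearEquiv
  refine ⟨ContinuousLinearEquiv.toUnit e, ?_⟩
  ext v
  rfl

lemma eq_zero_of_sylvester {Q Q' X : E →L[ℝ] E} (hQ : IsPosDefOp Q) (hQ' : IsPosDefOp Q')
    (h : Q * X + X * Q' = 0) : X = 0 := by
  have hs := hQ'.isSymmetric
  let b := hs.eigenvectorBasis rfl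
  have hX : (X : E →ₗ[ℝ] E) = 0 := by
    refine b.toBasis.ext fun i => ?_
    have hb : Q' (b i) = hs.eigenvalues rfl i • b i := hs.apply_eigenvectorBasis rfl i
    have hbn : b i ≠ 0 := b.orthonormal.ne_zero i
    have hpos : 0 < hs.eigenvalues rfl i := by
      have := hQ'.2 _ hbn
      rw [hb, real_inner_smul_left] at this
      exact pos_of_mul_pos_left this real_inner_self_nonneg
    have h1 : Q (X (b i)) + hs.eigenvalues rfl i • X (b i) = 0 := by
      have := congrArg (fun T : E →L[ℝ] E => T (b i)) h
      simpa [hb] using this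
    by_contra hne
    have hne' : X (b i) ≠ 0 := by simpa using hne
    have h2 := congrArg (fun w => inner ℝ w (X (b i))) h1
    simp only [inner_add_left, real_inner_smul_left, inner_zero_left] at h2
    have h3 := hQ.2 _ hne'
    have h4 : 0 < inner ℝ (X (b i)) (X (b i)) := real_inner_self_pos.mpr hne'
    nlinarith [mul_pos hpos h4]
  ext v
  exact congrArg (fun T : E →ₗ[ℝ] E => T v) hX

lemma IsPosDefOp.eq_of_sq_eq {Q Q' : E →L[ℝ] E} (hQ : IsPosDefOp Q) (hQ' : IsPosDefOp Q')
    (h : Q * Q = Q' * Q') : Q = Q' := by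
  refine sub_eq_zero.mp (eq_zero_of_sylvester hQ hQ' ?_)
  rw [mul_sub, sub_mul, h]
  abel

lemma IsPosDefOp.commute_of_commute_sq {Q A : E →L[ℝ] E} (hQ : IsPosDefOp Q)
    (h : Commute A (Q * Q)) : Commute A Q := by
  refine sub_eq_zero.mp (eq_zero_of_sylvester hQ hQ ?_)
  have := h.eq
  simp only [mul_sub, sub_mul, ← mul_assoc] at this ⊢
  rw [mul_assoc Q A Q, ← this]
  simp only [mul_assoc]
  abel

lemma IsPosDefOp.exists_sqrt {P : E →L[ℝ] E} (hP : IsPosDefOp P) :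
    ∃ Q, IsPosDefOp Q ∧ Q * Q = P := by
  have hs := hP.isSymmetric
  let b := hs.eigenvectorBasis rfl
  let l := hs.eigenvalues rfl
  have hb : ∀ i, P (b i) = l i • b i := fun i => hs.apply_eigenvectorBasis rfl i
  have hpos : ∀ i, 0 < l i := by
    intro i
    have := hP.2 _ (b.orthonormal.ne_zero i)
    rw [hb, real_inner_smul_left] at this
    exact pos_of_mul_pos_left this real_inner_self_nonneg
  let Q : E →L[ℝ] E := ∑ i, √(l i) • (innerSL ℝ (b i)).smulRight (b i)
  have hQ : ∀ u v, inner ℝ (Q u) v = ∑ i, √(l i) * inner ℝ (b i) u * inner ℝ (b i) v := by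
    intro u v
    simp [Q, sum_inner, inner_smul_left, mul_assoc]
  have hQb : ∀ i, Q (b i) = √(l i) • b i := by
    intro i
    simp [Q, b.inner_eq_ite]
  refine ⟨Q, ⟨fun u v => ?_, fun v hv => ?_⟩, ?_⟩
  · rw [hQ, ← real_inner_comm u (Q v), hQ]
    exact Finset.sum_congr rfl fun i _ => by rw [real_inner_comm]; ring
  · rw [hQ]
    refine Finset.sum_pos' (fun i _ => ?_) ?_
    · rw [mul_assoc]
      exact mul_nonneg (Real.sqrt_nonneg _) (mul_self_nonneg _)
    · by_contra! hcon
      apply hv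
      refine b.toBasis.ext_elem fun i => ?_
      have h1 := hcon i (Finset.mem_univ i)
      have h2 : inner ℝ (b i) v = 0 := by
        by_contra hne
        have := mul_pos (Real.sqrt_pos.mpr (hpos i)) (mul_self_pos.mpr hne)
        rw [← mul_assoc] at this
        linarith
      simpa [b.repr_apply_apply] using h2
  · have : ((Q * Q : E →L[ℝ] E) : E →ₗ[ℝ] E) = P := by
      refine b.toBasis.ext fun i => ?_
      have : Q (Q (b i)) = P (b i) := by
        rw [hQb, map_smul, hQb, smul_smul, Real.mul_self_sqrt (hpos i).le, hb]
      simpa using this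
    ext v
    exact congrArg (fun T : E →ₗ[ℝ] E => T v) this

lemma IsPosDefOp.eventually {Q : E →L[ℝ] E} (hQ : IsPosDefOp Q) :
    ∀ᶠ Q' in 𝓝 Q, (∀ u v, inner ℝ (Q' u) v = inner ℝ u (Q' v)) → IsPosDefOp Q' := by
  obtain ⟨c, hc, hcQ⟩ : ∃ c > 0, ∀ v, c * ‖v‖ ^ 2 ≤ inner ℝ (Q v) v := by
    obtain ⟨R, hR, hRQ⟩ := hQ.exists_sqrt
    obtain ⟨U, rfl⟩ := hR.isUnit
    rcases subsingleton_or_nontrivial E with hE | hE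
    · exact ⟨1, one_pos, fun v => by simp [Subsingleton.elim v 0]⟩
    have hUinv : 0 < ‖(↑U⁻¹ : E →L[ℝ] E)‖ := norm_pos_iff.mpr (Units.ne_zero _)
    refine ⟨(‖(↑U⁻¹ : E →L[ℝ] E)‖ ^ 2)⁻¹, by positivity, fun v => ?_⟩
    have h1 : inner ℝ (Q v) v = ‖(U : E →L[ℝ] E) v‖ ^ 2 := by
      rw [← hRQ, ← real_inner_self_eq_norm_sq]
      exact hR.1 _ _
    have h2 : ‖v‖ ≤ ‖(↑U⁻¹ : E →L[ℝ] E)‖ * ‖(U : E →L[ℝ] E) v‖ := by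
      have h3 : (↑U⁻¹ : E →L[ℝ] E) ((U : E →L[ℝ] E) v) = v :=
        congrArg (fun T : E →L[ℝ] E => T v) U.inv_mul
      calc ‖v‖ = ‖(↑U⁻¹ : E →L[ℝ] E) ((U : E →L[ℝ] E) v)‖ := by rw [h3]
        _ ≤ _ := ContinuousLinearMap.le_opNorm _ _
    rw [h1, inv_mul_le_iff₀ (by positivity), ← mul_pow]
    gcongr
  filter_upwards [Metric.ball_mem_nhds Q hc] with Q' hQ' hs
  refine ⟨hs, fun v hv => ?_⟩
  have hv' : 0 < ‖v‖ := norm_pos_iff.mpr hv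
  have h1 : |inner ℝ ((Q' - Q) v) v| ≤ ‖Q' - Q‖ * ‖v‖ * ‖v‖ :=
    (abs_real_inner_le_norm _ _).trans (by gcongr; exact ContinuousLinearMap.le_opNorm _ _)
  have h2 : ‖Q' - Q‖ < c := by simpa [dist_eq_norm] using hQ'
  have h3 : inner ℝ (Q' v) v = inner ℝ (Q v) v + inner ℝ ((Q' - Q) v) v := by
    rw [← inner_add_left]; simp
  have h4 := neg_abs_le (inner ℝ ((Q' - Q) v) v)
  have h5 := hcQ v
  have h6 : ‖Q' - Q‖ * ‖v‖ * ‖v‖ < c * ‖v‖ ^ 2 := by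
    rw [mul_assoc, ← pow_two]; gcongr
  linarith

lemma IsPosDefOp.exists_contDiffAt_sqrt {Q : E →L[ℝ] E} (hQ : IsPosDefOp Q) :
    ∃ R : (E →L[ℝ] E) → (E →L[ℝ] E), ContDiffAt ℝ ∞ R (Q * Q) ∧
      ∀ᶠ P in 𝓝 (Q * Q), IsPosDefOp P → IsPosDefOp (R P) ∧ R P * R P = P := by
  let sq : (E →L[ℝ] E) → (E →L[ℝ] E) := fun T => T * T
  have hsq : ContDiff ℝ ∞ sq := contDiff_id.mul contDiff_id
  let D : (E →L[ℝ] E) →ₗ[ℝ] (E →L[ℝ] E) := LinearMap.mulLeft ℝ Q + LinearMap.mulRight ℝ Q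
  have hD : Injective D := by
    rw [injective_iff_map_eq_zero]
    exact fun X hX => eq_zero_of_sylvester hQ hQ hX
  let e := (LinearEquiv.ofInjectiveEndo D hD).toContinuousLinearEquiv
  have hder : HasFDerivAt sq (e : (E →L[ℝ] E) →L[ℝ] (E →L[ℝ] E)) Q := by
    have := (hasFDerivAt_id (𝕜 := ℝ) Q).mul' (hasFDerivAt_id Q)
    refine this.congr_fderiv ?_
    ext X : 1
    rfl
  let Φ := hsq.contDiffAt.toOpenPartialHomeomorph sq hder (by simp)
  have hΦ : ∀ T, Φ T = T * T := fun T => rfl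
  have hmem : Q ∈ Φ.source :=
    hsq.contDiffAt.mem_toOpenPartialHomeomorph_source hder (by simp)
  have hmem' : Q * Q ∈ Φ.target := Φ.map_source hmem
  have hsymmQ : Φ.symm (Q * Q) = Q := Φ.left_inv hmem
  have hsm : ContDiffAt ℝ ∞ Φ.symm (Q * Q) := hsq.contDiffAt.to_localInverse hder (by simp)
  refine ⟨Φ.symm, hsm, ?_⟩
  have hcont : Filter.Tendsto Φ.symm (𝓝 (Q * Q)) (𝓝 Q) := by
    have := hsm.continuousAt.tendsto
    rwa [hsymmQ] at this
  have hadj : Filter.Tendsto (fun P => ContinuousLinearMap.adjoint (Φ.symm P)) (𝓝 (Q * Q))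
      (𝓝 Q) := by
    have h1 : ContinuousLinearMap.adjoint Q = Q :=
      ((ContinuousLinearMap.eq_adjoint_iff Q Q).mpr hQ.1).symm
    have h2 := (ContinuousLinearMap.adjoint (𝕜 := ℝ) (E := E) (F := E)).continuous.tendsto Q
    rw [h1] at h2
    exact h2.comp hcont
  filter_upwards [Φ.open_target.mem_nhds hmem', hadj (Φ.open_source.mem_nhds hmem),
    hcont hQ.eventually] with P hP hP' hP'' hPP
  have hsqP : Φ.symm P * Φ.symm P = P := Φ.right_inv hP
  refine ⟨hP'' ?_, hsqP⟩
  have hPadj : ContinuousLinearMap.adjoint P = P :=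
    ((ContinuousLinearMap.eq_adjoint_iff P P).mpr hPP.1).symm
  have h1 : ContinuousLinearMap.adjoint (Φ.symm P) = Φ.symm P := by
    refine Φ.injOn hP' (Φ.map_target hP) ?_
    rw [hΦ, hΦ, hsqP]
    have := congrArg ContinuousLinearMap.adjoint hsqP
    rw [hPadj] at this
    exact (ContinuousLinearMap.adjoint_comp _ _).symm.trans this
  exact (ContinuousLinearMap.eq_adjoint_iff _ _).mp h1.symm

variable {EM HM M : Type*} [NormedAddCommGroup EM] [NormedSpace ℝ EM] [TopologicalSpace HM]
  {I : ModelWithCorners ℝ EM HM} [TopologicalSpace M] [ChartedSpace HM M]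

lemma exists_contMDiff_sqrt {P : M → E →L[ℝ] E} (hP : ∀ x, IsPosDefOp (P x))
    (hs : ContMDiff I 𝓘(ℝ, E →L[ℝ] E) ∞ P) :
    ∃ Q : M → E →L[ℝ] E, ContMDiff I 𝓘(ℝ, E →L[ℝ] E) ∞ Q ∧
      ∀ x, IsPosDefOp (Q x) ∧ Q x * Q x = P x := by
  choose Q hQ hQP using fun x => (hP x).exists_sqrt
  refine ⟨Q, fun x => ?_, fun x => ⟨hQ x, hQP x⟩⟩
  obtain ⟨R, hR, hev⟩ := (hQ x).exists_contDiffAt_sqrt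
  rw [hQP x] at hR hev
  refine (hR.contMDiffAt.comp x (hs x)).congr_of_eventuallyEq ?_
  filter_upwards [(hs x).continuousAt.tendsto hev] with y hy
  obtain ⟨h1, h2⟩ := hy (hP y)
  exact (hQ y).eq_of_sq_eq h1 ((hQP y).trans h2.symm)

lemma exists_contMDiff_polar {A : M → E →L[ℝ] E} (hs : ContMDiff I 𝓘(ℝ, E →L[ℝ] E) ∞ A)
    (hskew : ∀ x u v, inner ℝ (A x u) v = -inner ℝ u (A x v))
    (hinj : ∀ x u, A x u = 0 → u = 0) :
    ∃ J : M → E →L[ℝ] E, ContMDiff I 𝓘(ℝ, E →L[ℝ] E) ∞ J ∧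
      (∀ x v, J x (J x v) = -v) ∧
      (∀ x u v, inner ℝ (A x (J x u)) (J x v) = inner ℝ (A x u) v) ∧
      ∀ x v, v ≠ 0 → 0 < inner ℝ (A x v) (J x v) := by
  have hP : ∀ x, IsPosDefOp (-(A x * A x)) := by
    refine fun x => ⟨fun u v => ?_, fun v hv => ?_⟩
    · simp [inner_neg_left, hskew]
    · have h1 : A x v ≠ 0 := fun h => hv (hinj x v h)
      have h2 : 0 < inner ℝ (A x v) (A x v) := real_inner_self_pos.mpr h1
      simpa [inner_neg_left, hskew x (A x v)] using h2
  have hPs : ContMDiff I 𝓘(ℝ, E →L[ℝ] E) ∞ (fun x => -(A x * A x)) := by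
    have : ContDiff ℝ ∞ (fun T : E →L[ℝ] E => -(T * T)) :=
      (contDiff_id.mul contDiff_id).neg
    exact this.contMDiff.comp hs
  obtain ⟨Q, hQs, hQ⟩ := exists_contMDiff_sqrt hP hPs
  choose U hU using fun x => (hQ x).1.isUnit
  have hinvs : ContMDiff I 𝓘(ℝ, E →L[ℝ] E) ∞ (fun x => Ring.inverse (Q x)) := by
    intro x
    have h1 : ContDiffAt ℝ ∞ Ring.inverse (Q x) := by
      rw [← hU x]; exact contDiffAt_ringInverse ℝ (U x)
    exact h1.contMDiffAt.comp x (hQs x)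
  have hcom : ∀ x, Commute (A x) (Q x) := fun x =>
    (hQ x).1.commute_of_commute_sq (by
      rw [(hQ x).2]; exact ((Commute.refl _).mul_right (Commute.refl _)).neg_right)
  have hinv : ∀ x v, Q x (Ring.inverse (Q x) v) = v := by
    intro x v
    have := congrArg (fun T : E →L[ℝ] E => T v) (Ring.mul_inverse_cancel _ (hQ x).1.isUnit)
    simpa using this
  have hinv' : ∀ x v, Ring.inverse (Q x) (Q x v) = v := by
    intro x v
    have := congrArg (fun T : E →L[ℝ] E => T v) (Ring.inverse_mul_cancel _ (hQ x).1.isUnit)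
    simpa using this
  have hAQ : ∀ x v, A x (Q x v) = Q x (A x v) := fun x v =>
    congrArg (fun T : E →L[ℝ] E => T v) (hcom x).eq
  have hAQ' : ∀ x v, A x (Ring.inverse (Q x) v) = Ring.inverse (Q x) (A x v) := by
    intro x v
    rw [← hinv' x (A x (Ring.inverse (Q x) v)), ← hAQ, hinv]
  have hQQ : ∀ x v, A x (A x v) = -Q x (Q x v) := by
    intro x v
    have := congrArg (fun T : E →L[ℝ] E => -T v) (hQ x).2
    simpa using this.symm
  have hsymm' : ∀ x u v, inner ℝ (Ring.inverse (Q x) u) v = inner ℝ u (Ring.inverse (Q x) v) := by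
    intro x u v
    conv_lhs => rw [← hinv x v]
    conv_rhs => rw [← hinv x u]
    rw [(hQ x).1.1]
  refine ⟨fun x => A x * Ring.inverse (Q x), ?_, fun x v => ?_, fun x u v => ?_, fun x v hv => ?_⟩
  · have : ContDiff ℝ ∞ (fun T : (E →L[ℝ] E) × (E →L[ℝ] E) => T.1 * T.2) :=
      contDiff_fst.mul contDiff_snd
    exact this.contMDiff.comp (hs.prodMk_space hinvs)
  · change A x (Ring.inverse (Q x) (A x (Ring.inverse (Q x) v))) = -v
    rw [hAQ' x (A x _), hQQ, map_neg, hinv', hinv]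
  · change inner ℝ (A x (A x (Ring.inverse (Q x) u))) (A x (Ring.inverse (Q x) v)) = _
    rw [hQQ, hinv, inner_neg_left, hAQ', ← hsymm', hinv', hskew]
  · change 0 < inner ℝ (A x v) (A x (Ring.inverse (Q x) v))
    have : inner ℝ (A x v) (A x (Ring.inverse (Q x) v)) = inner ℝ (Q x v) v := by
      rw [hskew, hQQ, hinv, inner_neg_right, neg_neg, real_inner_comm]
    rw [this]
    exact (hQ x).1.2 v hv

end PolarDecomposition

/-! ### Smooth families of linear maps on tangent spaces -/

section SmoothFamily

variable {E : Type*} [NormedAddCommGroup E] [NormedSpace ℝ E]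
  {H : Type*} [TopologicalSpace H] {I : ModelWithCorners ℝ E H}
  {M : Type*} [TopologicalSpace M] [ChartedSpace H M]
  {E' : Type*} [NormedAddCommGroup E'] [NormedSpace ℝ E']
  {H' : Type*} [TopologicalSpace H'] {J : ModelWithCorners ℝ E' H'}
  {N : Type*} [TopologicalSpace N] [ChartedSpace H' N]
  {F : Type*} [NormedAddCommGroup F] [NormedSpace ℝ F]

lemma contMDiffAt_clm_of_apply {G : Type*} [NormedAddCommGroup G] [NormedSpace ℝ G]
    [FiniteDimensional ℝ G] {f : N → G →L[ℝ] F} {n : N}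
    (h : ∀ v, ContMDiffAt J 𝓘(ℝ, F) ∞ (fun m => f m v) n) :
    ContMDiffAt J 𝓘(ℝ, G →L[ℝ] F) ∞ f n := by
  let b := Module.finBasis ℝ G
  let φ : (i : Fin (Module.finrank ℝ G)) → F →L[ℝ] (G →L[ℝ] F) := fun i =>
    ContinuousLinearMap.smulRightL ℝ G F (LinearMap.toContinuousLinearMap (b.coord i))
  have hf : f = fun m => ∑ i, φ i (f m (b i)) := by
    funext m
    ext v
    conv_lhs => rw [← b.sum_repr v, map_sum]
    simp only [map_smul]
    simp [φ]
  rw [hf]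
  refine contMDiffAt_finsetSum fun i _ => ?_
  exact (φ i).contDiff.contMDiff.contMDiffAt.comp n (h (b i))

lemma contMDiff_clm_of_apply {G : Type*} [NormedAddCommGroup G] [NormedSpace ℝ G]
    [FiniteDimensional ℝ G] {f : N → G →L[ℝ] F}
    (h : ∀ v, ContMDiff J 𝓘(ℝ, F) ∞ (fun m => f m v)) :
    ContMDiff J 𝓘(ℝ, G →L[ℝ] F) ∞ f :=
  fun n => contMDiffAt_clm_of_apply fun v => h v n

variable [IsManifold I ∞ M]

variable (J) in
/-- A family of linear maps `T_{p n} M → F` depending smoothly on the parameter `n`. -/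
def IsSmoothFamily (p : N → M) (L : ∀ n, TangentSpace I (p n) →L[ℝ] F) : Prop :=
  ∀ n₀, ContMDiffAt J 𝓘(ℝ, E →L[ℝ] F) ∞
    (fun n => ((L n).comp ((trivializationAt E (TangentSpace I) (p n₀)).symmL ℝ (p n)) :
      E →L[ℝ] F)) n₀

lemma IsSmoothFamily.apply {p : N → M} {L : ∀ n, TangentSpace I (p n) →L[ℝ] F}
    (hL : IsSmoothFamily J p L) {v : ∀ n, TangentSpace I (p n)}
    (hv : ContMDiff J I.tangent ∞ (fun n => (⟨p n, v n⟩ : TangentBundle I M))) :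
    ContMDiff J 𝓘(ℝ, F) ∞ (fun n => L n (v n)) := by
  intro n₀
  have hv₀ := contMDiffAt_totalSpace.mp (hv n₀)
  refine ((hL n₀).clm_apply hv₀.2).congr_of_eventuallyEq ?_
  filter_upwards [hv₀.1.continuousAt (((trivializationAt E (TangentSpace I)
    (p n₀)).open_baseSet).mem_nhds (FiberBundle.mem_baseSet_trivializationAt' (p n₀)))] with n hn
  have hn' : p n ∈ (trivializationAt E (TangentSpace I) (p n₀)).baseSet := hn
  have h1 := (trivializationAt E (TangentSpace I) (p n₀)).symmL_continuousLinearMapAt (R := ℝ)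
    hn' (v n)
  have h2 := (trivializationAt E (TangentSpace I)
    (p n₀)).continuousLinearMapAt_apply_of_mem (R := ℝ) hn' (v n)
  change L n (v n) = L n ((trivializationAt E (TangentSpace I) (p n₀)).symmL ℝ (p n) _)
  conv_lhs => rw [← h1, h2]

lemma isSmoothFamily_of_tangentBundle [FiniteDimensional ℝ E]
    {L : ∀ x : M, TangentSpace I x →L[ℝ] F}
    (hL : ContMDiff I.tangent 𝓘(ℝ, F) ∞ (fun v : TangentBundle I M => L v.1 v.2)) :
    IsSmoothFamily I (fun x : M => x) L := by
  intro x₀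
  refine contMDiffAt_clm_of_apply fun e => ?_
  have hs : ContMDiffAt I I.tangent ∞
      (fun x => (⟨x, (trivializationAt E (TangentSpace I) x₀).symmL ℝ x e⟩ :
        TangentBundle I M)) x₀ := by
    refine contMDiffAt_totalSpace.mpr ⟨contMDiffAt_id, ?_⟩
    refine (contMDiffAt_const (c := e)).congr_of_eventuallyEq ?_
    filter_upwards [((trivializationAt E (TangentSpace I) x₀).open_baseSet).mem_nhds
      (FiberBundle.mem_baseSet_trivializationAt' x₀)] with x hx
    have h1 := (trivializationAt E (TangentSpace I) x₀).continuousLinearMapAt_symmL (R := ℝ)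
      hx e
    rw [(trivializationAt E (TangentSpace I) x₀).continuousLinearMapAt_apply_of_mem (R := ℝ) hx] at h1
    exact h1
  exact hL.contMDiffAt.comp x₀ hs

lemma IsSmoothFamily.comp {E'' : Type*} [NormedAddCommGroup E''] [NormedSpace ℝ E'']
    {H'' : Type*} [TopologicalSpace H''] {J' : ModelWithCorners ℝ E'' H''}
    {N' : Type*} [TopologicalSpace N'] [ChartedSpace H'' N']
    {p : N → M} {L : ∀ n, TangentSpace I (p n) →L[ℝ] F}
    (hL : IsSmoothFamily J p L) {q : N' → N} (hq : ContMDiff J' J ∞ q) :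
    IsSmoothFamily J' (fun m => p (q m)) (fun m => L (q m)) :=
  fun m₀ => (hL (q m₀)).comp m₀ (hq m₀)

lemma IsSmoothFamily.prod {F' : Type*} [NormedAddCommGroup F'] [NormedSpace ℝ F']
    {p : N → M} {L : ∀ n, TangentSpace I (p n) →L[ℝ] F}
    {L' : ∀ n, TangentSpace I (p n) →L[ℝ] F'}
    (hL : IsSmoothFamily J p L) (hL' : IsSmoothFamily J p L') :
    IsSmoothFamily J p (fun n => (L n).prod (L' n)) := by
  intro n₀
  have := (ContinuousLinearMap.prodₗᵢ (E := E) (F := F) (G := F') (𝕜 := ℝ) ℝ).contDiff (n := ∞) |>.contMDiff.contMDiffAt.comp n₀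
      ((hL n₀).prodMk_space (hL' n₀))
  exact this

lemma IsSmoothFamily.symm [CompleteSpace E] {p : N → M} (hp : ContMDiff J I ∞ p)
    {L : ∀ n, TangentSpace I (p n) ≃L[ℝ] F}
    (hL : IsSmoothFamily J p (fun n => (L n : TangentSpace I (p n) →L[ℝ] F))) :
    ContMDiff (J.prod 𝓘(ℝ, F)) I.tangent ∞
      (fun q : N × F => (⟨p q.1, (L q.1).symm q.2⟩ : TangentBundle I M)) := by
  rintro ⟨n₀, f₀⟩
  refine contMDiffAt_totalSpace.mpr ⟨hp.contMDiffAt.comp (n₀, f₀) contMDiffAt_fst, ?_⟩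
  let e := trivializationAt E (TangentSpace I) (p n₀)
  have he : ∀ n, p n ∈ e.baseSet → ∃ A : E ≃L[ℝ] F,
      (A : E →L[ℝ] F) = (L n : TangentSpace I (p n) →L[ℝ] F).comp (e.symmL ℝ (p n)) ∧
      ∀ f, A.symm f = (e ⟨p n, (L n).symm f⟩).2 := by
    intro n hn
    refine ⟨(e.continuousLinearEquivAt ℝ (p n) hn).symm.trans (L n), ?_, fun f => ?_⟩
    · rw [← e.symm_continuousLinearEquivAt_eq' hn]; rfl
    · rfl
  have hmem : ∀ᶠ n in 𝓝 n₀, p n ∈ e.baseSet :=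
    hp.continuous.continuousAt (e.open_baseSet.mem_nhds
      (FiberBundle.mem_baseSet_trivializationAt' (p n₀)))
  obtain ⟨A₀, hA₀, -⟩ := he n₀ hmem.self_of_nhds
  have hinv : ContMDiffAt J 𝓘(ℝ, F →L[ℝ] E) ∞ (fun n => ContinuousLinearMap.inverse
      ((L n : TangentSpace I (p n) →L[ℝ] F).comp (e.symmL ℝ (p n)) : E →L[ℝ] F)) n₀ := by
    have h1 := contDiffAt_map_inverse (n := ∞) A₀
    rw [hA₀] at h1
    exact h1.contMDiffAt.comp n₀ (hL n₀)
  refine ((hinv.comp (n₀, f₀) contMDiffAt_fst).clm_apply contMDiffAt_snd).congr_of_eventuallyEq ?_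
  filter_upwards [continuousAt_fst.eventually hmem] with q hq
  obtain ⟨A, hA, hA'⟩ := he q.1 hq
  change _ = ContinuousLinearMap.inverse
      ((L q.1 : TangentSpace I (p q.1) →L[ℝ] F).comp (e.symmL ℝ (p q.1)) : E →L[ℝ] F) q.2
  rw [← hA, ContinuousLinearMap.inverse_equiv]
  exact (hA' q.2).symm

/-- Smooth families of linear forms are smooth maps to the cotangent bundle. -/
lemma isSmoothFamily_iff_hom {p : N → M} (hp : ContMDiff J I ∞ p)
    {L : ∀ n, TangentSpace I (p n) →L[ℝ] ℝ} :
    IsSmoothFamily J p L ↔ ContMDiff J (I.prod 𝓘(ℝ, E →L[ℝ] ℝ)) ∞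
      (fun n => (⟨p n, L n⟩ : CotangentBundle I M)) := by
  refine forall_congr' fun n₀ => ?_
  rw [contMDiffAt_totalSpace]
  constructor
  · intro h
    refine ⟨hp n₀, h.congr_of_eventuallyEq (Filter.Eventually.of_forall fun n => ?_)⟩
    simp [hom_trivializationAt_apply, ContinuousLinearMap.inCoordinates]
  · intro h
    refine h.2.congr_of_eventuallyEq (Filter.Eventually.of_forall fun n => ?_)
    simp [hom_trivializationAt_apply, ContinuousLinearMap.inCoordinates]

end SmoothFamily

/-! ### Almost complex structures in a global frame -/

section LinearComplexStructures

variable (F : Type*) [NormedAddCommGroup F] [NormedSpace ℝ F]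

/-- The space of linear complex structures on `F`. -/
abbrev LinearComplexStructure : Type _ := {T : F →L[ℝ] F // T * T = -1}

variable {F} [FiniteDimensional ℝ F] {M : Type*} [TopologicalSpace M]

lemma isUnit_of_forall_eq_zero {B : F →L[ℝ] F} (h : ∀ v, B v = 0 → v = 0) : IsUnit B := by
  have hinj : Injective (B : F →ₗ[ℝ] F) := by
    rw [injective_iff_map_eq_zero]
    exact h
  let e := (LinearEquiv.ofInjectiveEndo (B : F →ₗ[ℝ] F) hinj).toContinuousLinearEquiv
  refine ⟨ContinuousLinearEquiv.toUnit e, ?_⟩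
  ext v
  rfl

/-- Two families of complex structures are homotopic if the segments between them consist of
invertible operators. -/
lemma LinearComplexStructure.homotopic {f₀ f₁ : C(M, LinearComplexStructure F)}
    (h : ∀ x (a b : ℝ), 0 ≤ a → 0 ≤ b → 0 < a + b →
      ∀ v, a • (f₀ x).1 v + b • (f₁ x).1 v = 0 → v = 0) :
    f₀.Homotopic f₁ := by
  let B : unitInterval × M → (F →L[ℝ] F) := fun p =>
    (1 + (p.1 : ℝ)) • (f₁ p.2).1 + (1 - (p.1 : ℝ)) • (f₀ p.2).1
  have hBu : ∀ p, IsUnit (B p) := by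
    intro p
    have h0 := p.1.2.1
    have h1 := p.1.2.2
    refine isUnit_of_forall_eq_zero fun v hv => ?_
    refine h p.2 (1 - p.1) (1 + p.1) (by linarith) (by linarith) (by linarith) v ?_
    rw [add_comm]
    exact hv
  have hBc : Continuous B := by
    have h0 : Continuous fun p : unitInterval × M => (f₀ p.2).1 :=
      continuous_subtype_val.comp (f₀.continuous.comp continuous_snd)
    have h1 : Continuous fun p : unitInterval × M => (f₁ p.2).1 :=
      continuous_subtype_val.comp (f₁.continuous.comp continuous_snd)
    have hs : Continuous fun p : unitInterval × M => (p.1 : ℝ) :=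
      continuous_subtype_val.comp continuous_fst
    exact ((continuous_const.add hs).smul h1).add ((continuous_const.sub hs).smul h0)
  have hBi : Continuous fun p => Ring.inverse (B p) := by
    rw [continuous_iff_continuousAt]
    intro p
    obtain ⟨u, hu⟩ := hBu p
    have := NormedRing.inverse_continuousAt u
    rw [hu] at this
    exact this.comp hBc.continuousAt
  let K : unitInterval × M → (F →L[ℝ] F) := fun p =>
    Ring.inverse (B p) * ((f₁ p.2).1 * B p)
  have hK : ∀ p, K p * K p = -1 := by
    intro p
    have h1 := Ring.mul_inverse_cancel _ (hBu p)
    have h2 := Ring.inverse_mul_cancel _ (hBu p)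
    calc K p * K p = Ring.inverse (B p) * (f₁ p.2).1 * (B p * Ring.inverse (B p)) *
          (f₁ p.2).1 * B p := by simp only [K, mul_assoc]
      _ = Ring.inverse (B p) * ((f₁ p.2).1 * (f₁ p.2).1) * B p := by
          rw [h1, mul_one]; simp only [mul_assoc]
      _ = -1 := by rw [(f₁ p.2).2, mul_neg_one, neg_mul, h2]
  have hKc : Continuous K :=
    hBi.mul ((continuous_subtype_val.comp (f₁.continuous.comp continuous_snd)).mul hBc)
  refine ⟨⟨⟨fun p => ⟨K p, hK p⟩, hKc.subtype_mk hK⟩, fun x => ?_, fun x => ?_⟩⟩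
  · apply Subtype.ext
    change K (0, x) = (f₀ x).1
    have h1 := Ring.inverse_mul_cancel _ (hBu (0, x))
    have hB : B (0, x) = (f₁ x).1 + (f₀ x).1 := by simp [B]
    have : (f₁ x).1 * B (0, x) = B (0, x) * (f₀ x).1 := by
      rw [hB, mul_add, add_mul, (f₁ x).2, (f₀ x).2, add_comm]
    change Ring.inverse (B (0, x)) * ((f₁ x).1 * B (0, x)) = (f₀ x).1
    rw [this, ← mul_assoc, h1, one_mul]
  · apply Subtype.ext
    have h1 := Ring.inverse_mul_cancel _ (hBu (1, x))
    have hB : B (1, x) = (1 + 1 : ℝ) • (f₁ x).1 := by simp [B]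
    have : (f₁ x).1 * B (1, x) = B (1, x) * (f₁ x).1 := by
      rw [hB, mul_smul_comm, smul_mul_assoc]
    change Ring.inverse (B (1, x)) * ((f₁ x).1 * B (1, x)) = (f₁ x).1
    rw [this, ← mul_assoc, h1, one_mul]

/-- Complex structures which are tamed by the same bilinear forms are homotopic. -/
lemma LinearComplexStructure.homotopic_of_tame {f₀ f₁ : C(M, LinearComplexStructure F)}
    (β : M → F → F → ℝ) (hadd : ∀ x u v w, β x u (v + w) = β x u v + β x u w)
    (hsmul : ∀ x u (a : ℝ) v, β x u (a • v) = a * β x u v)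
    (h₀ : ∀ x v, v ≠ 0 → 0 < β x v ((f₀ x).1 v)) (h₁ : ∀ x v, v ≠ 0 → 0 < β x v ((f₁ x).1 v)) :
    f₀.Homotopic f₁ := by
  refine LinearComplexStructure.homotopic fun x a b ha hb hab v hv => ?_
  by_contra hne
  have h2 : β x v 0 = 0 := by simpa using hsmul x v 0 0
  rw [← hv, hadd, hsmul, hsmul] at h2
  have h3 := h₀ x v hne
  have h4 := h₁ x v hne
  rcases ha.eq_or_lt with rfl | ha
  · rw [zero_add] at hab
    nlinarith [mul_pos hab h4]
  · nlinarith [mul_pos ha h3, mul_nonneg hb h4.le]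

end LinearComplexStructures

section Frame

variable {E : Type*} [NormedAddCommGroup E] [NormedSpace ℝ E] [FiniteDimensional ℝ E]
  {H : Type*} [TopologicalSpace H] {I : ModelWithCorners ℝ E H}
  {M : Type*} [TopologicalSpace M] [ChartedSpace H M]
  {F : Type*} [NormedAddCommGroup F] [NormedSpace ℝ F]

variable [IsManifold I ∞ M]

/-- Smoothness of a field of bilinear forms, tested on vector fields. -/
def IsSmoothOnFields (Ω : BilinForm I M) : Prop :=
  ∀ X Y : ∀ x : M, TangentSpace I x,
    ContMDiff I I.tangent ∞ (fun x => (⟨x, X x⟩ : TangentBundle I M)) →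
    ContMDiff I I.tangent ∞ (fun x => (⟨x, Y x⟩ : TangentBundle I M)) →
    ContMDiff I 𝓘(ℝ, ℝ) ∞ (fun x => Ω x (X x) (Y x))

/-- A smooth trivialization of the tangent bundle. -/
def IsSmoothFrame (Ψ : ∀ x : M, TangentSpace I x ≃L[ℝ] F) : Prop :=
  ContMDiff I.tangent 𝓘(ℝ, F) ∞ (fun v : TangentBundle I M => Ψ v.1 v.2)

lemma IsSmoothFrame.symm {Ψ : ∀ x : M, TangentSpace I x ≃L[ℝ] F} (hΨ : IsSmoothFrame Ψ) :
    ContMDiff (I.prod 𝓘(ℝ, F)) I.tangent ∞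
      (fun q : M × F => (⟨q.1, (Ψ q.1).symm q.2⟩ : TangentBundle I M)) := by
  have : CompleteSpace E := FiniteDimensional.complete ℝ E
  exact IsSmoothFamily.symm (p := fun x : M => x) contMDiff_id
    (isSmoothFamily_of_tangentBundle (L := fun x => (Ψ x : TangentSpace I x →L[ℝ] F)) hΨ)

lemma IsSmoothFrame.contMDiff_symm_const {Ψ : ∀ x : M, TangentSpace I x ≃L[ℝ] F}
    (hΨ : IsSmoothFrame Ψ) (f : F) :
    ContMDiff I I.tangent ∞ (fun x => (⟨x, (Ψ x).symm f⟩ : TangentBundle I M)) :=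
  hΨ.symm.comp (contMDiff_id.prodMk contMDiff_const)

lemma IsSmoothFrame.isAlmostComplex {Ψ : ∀ x : M, TangentSpace I x ≃L[ℝ] F}
    (hΨ : IsSmoothFrame Ψ) {T : M → F →L[ℝ] F} (hT : ContMDiff I 𝓘(ℝ, F →L[ℝ] F) ∞ T)
    (hT' : ∀ x v, T x (T x v) = -v) :
    IsAlmostComplex (I := I) (M := M) (fun x =>
      ((Ψ x).symm : F →L[ℝ] TangentSpace I x).comp
        ((T x).comp (Ψ x : TangentSpace I x →L[ℝ] F))) := by
  refine ⟨fun x v => by simp [hT'], ?_⟩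
  have h1 : ContMDiff I.tangent 𝓘(ℝ, F) ∞
      (fun v : TangentBundle I M => T v.1 (Ψ v.1 v.2)) :=
    (hT.comp (contMDiff_proj (TangentSpace I))).clm_apply hΨ
  exact hΨ.symm.comp ((contMDiff_proj (TangentSpace I)).prodMk h1)

lemma IsSmoothFrame.exists_compatible_of_inner {G : Type*} [NormedAddCommGroup G]
    [InnerProductSpace ℝ G] [FiniteDimensional ℝ G]
    {Ψ : ∀ x : M, TangentSpace I x ≃L[ℝ] G} (hΨ : IsSmoothFrame Ψ) {Ω : BilinForm I M}
    (halt : ∀ x v, Ω x v v = 0) (hnd : IsNondegenerateBilin Ω) (hsm : IsSmoothOnFields Ω) :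
    ∃ J, IsAlmostComplex J ∧ IsCompatible J Ω := by
  let b := stdOrthonormalBasis ℝ G
  have hskew : ∀ x u v, Ω x u v = -Ω x v u := by
    intro x u v
    have := halt x (u + v)
    simp only [map_add, add_apply, halt] at this
    linarith
  let A : M → G →L[ℝ] G := fun x => ∑ i,
    (-((Ω x ((Ψ x).symm (b i))).comp
      ((Ψ x).symm : G →L[ℝ] TangentSpace I x)) : G →L[ℝ] ℝ).smulRight (b i)
  have hAu : ∀ x u, A x u = ∑ i, Ω x ((Ψ x).symm u) ((Ψ x).symm (b i)) • b i := by
    intro x u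
    simp [A, hskew x ((Ψ x).symm u)]
  have hA : ∀ x u v, inner ℝ (A x u) v = Ω x ((Ψ x).symm u) ((Ψ x).symm v) := by
    intro x u v
    rw [hAu]
    conv_rhs => rw [← b.sum_repr v, map_sum, map_sum]
    simp [sum_inner, real_inner_smul_left, b.repr_apply_apply, mul_comm]
  have hAs : ContMDiff I 𝓘(ℝ, G →L[ℝ] G) ∞ A := by
    refine contMDiff_clm_of_apply fun u => ?_
    simp only [hAu]
    refine contMDiff_finsetSum fun i _ => ?_
    exact (hsm _ _ (hΨ.contMDiff_symm_const u) (hΨ.contMDiff_symm_const (b i))).smul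
      contMDiff_const
  obtain ⟨T, hTs, hT, hTc, hTp⟩ := exists_contMDiff_polar hAs
    (fun x u v => by rw [hA, hskew, ← hA, real_inner_comm])
    (fun x u hu => by
      have : (Ψ x).symm u = 0 := hnd x _ fun v => by
        have := hA x u (Ψ x v)
        rw [hu, inner_zero_left] at this
        simpa using this.symm
      simpa using this)
  refine ⟨_, hΨ.isAlmostComplex hTs hT, fun x u v => ?_, fun x v hv => ?_⟩
  · have := hTc x (Ψ x u) (Ψ x v)
    rw [hA, hA] at this
    simpa using this
  · have := hTp x (Ψ x v) (by simpa using hv)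
    rw [hA] at this
    simpa using this

variable [FiniteDimensional ℝ F]

/-- A nondegenerate 2-form on a parallelizable manifold has compatible almost complex
structures. -/
lemma IsSmoothFrame.exists_compatible {Ψ : ∀ x : M, TangentSpace I x ≃L[ℝ] F}
    (hΨ : IsSmoothFrame Ψ) {Ω : BilinForm I M}
    (halt : ∀ x v, Ω x v v = 0) (hnd : IsNondegenerateBilin Ω) (hsm : IsSmoothOnFields Ω) :
    ∃ J, IsAlmostComplex J ∧ IsCompatible J Ω := by
  have h : IsSmoothFrame fun x : M => (Ψ x).trans (toEuclidean (E := F)) :=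
    (toEuclidean (E := F)).contDiff.contMDiff.comp hΨ
  exact h.exists_compatible_of_inner halt hnd hsm

/-- The matrix of an almost complex structure in a frame. -/
noncomputable def frameStructure (Ψ : ∀ x : M, TangentSpace I x ≃L[ℝ] F) {J : EndField I M}
    (hJ : IsAlmostComplex J) (x : M) : LinearComplexStructure F :=
  ⟨(Ψ x : TangentSpace I x →L[ℝ] F).comp ((J x).comp
      ((Ψ x).symm : F →L[ℝ] TangentSpace I x)), by
    ext v
    simp [hJ.1]⟩

lemma IsSmoothFrame.continuous_frameStructure {Ψ : ∀ x : M, TangentSpace I x ≃L[ℝ] F}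
    (hΨ : IsSmoothFrame Ψ) {J : EndField I M} (hJ : IsAlmostComplex J) :
    Continuous (frameStructure Ψ hJ) := by
  refine Continuous.subtype_mk ?_ _
  have : ContMDiff I 𝓘(ℝ, F →L[ℝ] F) ∞ fun x => ((frameStructure Ψ hJ x).1 : F →L[ℝ] F) := by
    refine contMDiff_clm_of_apply fun v => ?_
    exact ContMDiff.comp (I' := I.tangent) (g := fun v : TangentBundle I M => Ψ v.1 v.2) hΨ
      (hJ.2.comp (hΨ.contMDiff_symm_const v))
  exact this.continuous

/-- Homotopies of almost complex structures from homotopies of their matrices in a frame. -/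
lemma IsSmoothFrame.almostComplexHomotopic {Ψ : ∀ x : M, TangentSpace I x ≃L[ℝ] F}
    (hΨ : IsSmoothFrame Ψ) {J₀ J₁ : EndField I M} (hJ₀ : IsAlmostComplex J₀)
    (hJ₁ : IsAlmostComplex J₁)
    (h : ContinuousMap.Homotopic ⟨frameStructure Ψ hJ₀, hΨ.continuous_frameStructure hJ₀⟩
      ⟨frameStructure Ψ hJ₁, hΨ.continuous_frameStructure hJ₁⟩) :
    AlmostComplexHomotopic J₀ J₁ := by
  obtain ⟨K⟩ := h
  refine ⟨fun s x => ((Ψ x).symm : F →L[ℝ] TangentSpace I x).comp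
        ((K (s, x)).1.comp (Ψ x : TangentSpace I x →L[ℝ] F)), fun s x v => ?_, ?_, ?_, ?_⟩
  · have := congrArg (fun T : F →L[ℝ] F => T (Ψ x v)) (K (s, x)).2
    have h2 : (K (s, x)).1 ((K (s, x)).1 (Ψ x v)) = -Ψ x v := this
    simp [h2]
  · have hp : Continuous fun v : TangentBundle I M => v.1 :=
      (contMDiff_proj (n := ∞) (IB := I) (TangentSpace I (M := M))).continuous
    have h1 : Continuous fun p : unitInterval × TangentBundle I M =>
        (K (p.1, p.2.1)).1 (Ψ p.2.1 p.2.2) :=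
      (continuous_subtype_val.comp (K.continuous.comp
        (continuous_fst.prodMk (hp.comp continuous_snd)))).clm_apply
        (hΨ.continuous.comp continuous_snd)
    exact hΨ.symm.continuous.comp ((hp.comp continuous_snd).prodMk h1)
  · funext x
    ext v
    simp [frameStructure]
  · funext x
    ext v
    simp [frameStructure]

end Frame

/-! ### The exterior derivative of a 1-form in a chart -/

section ExteriorDerivative

variable {E : Type*} [NormedAddCommGroup E] [NormedSpace ℝ E]
  {H : Type*} [TopologicalSpace H] {I : ModelWithCorners ℝ E H}
  {M : Type*} [TopologicalSpace M] [ChartedSpace H M]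

/-- A 1-form in the preferred chart at `x₀`. -/
noncomputable def chartForm (θ : OneForm I M) (x₀ : M) : E → E →L[ℝ] ℝ := fun y =>
  (θ ((extChartAt I x₀).symm y)).comp
    (mfderivWithin 𝓘(ℝ, E) I (extChartAt I x₀).symm (range I) y)

variable [IsManifold I ∞ M] [I.Boundaryless]

lemma extDerivOneForm_apply (θ : OneForm I M) (x : M) (u v : TangentSpace I x) :
    extDerivOneForm θ x u v =
      fderiv ℝ (chartForm θ x) (extChartAt I x x) u v -
        fderiv ℝ (chartForm θ x) (extChartAt I x x) v u := by
  have : IsManifold I 1 M := IsManifold.of_le (n := ∞) (by simp)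
  let A : E →L[ℝ] E := mfderiv I 𝓘(ℝ, E) (extChartAt I x) x
  have hA : A = ContinuousLinearMap.id ℝ E := mfderiv_extChartAt_self
  have h : extDerivOneForm θ x u v =
      fderivWithin ℝ (chartForm θ x) (range I) (extChartAt I x x) (A u) (A v) -
        fderivWithin ℝ (chartForm θ x) (range I) (extChartAt I x x) (A v) (A u) := rfl
  rw [h, hA, I.range_eq_univ, fderivWithin_univ]
  rfl

lemma extDerivOneForm_self (θ : OneForm I M) (x : M) (v : TangentSpace I x) :
    extDerivOneForm θ x v v = 0 := by
  rw [extDerivOneForm_apply, sub_self]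

lemma contDiffAt_chartForm [FiniteDimensional ℝ E] {θ : OneForm I M} (hθ : IsSmoothOneForm θ)
    (x₀ : M) {y : E} (hy : y ∈ (extChartAt I x₀).target) :
    ContDiffAt ℝ ∞ (chartForm θ x₀) y := by
  have : IsManifold I 1 M := IsManifold.of_le (n := ∞) (by simp)
  let e := trivializationAt E (TangentSpace I) x₀
  let x₁ := (extChartAt I x₀).symm y
  have hx₁ : x₁ ∈ (chartAt H x₀).source := by
    rw [← extChartAt_source I]; exact (extChartAt I x₀).map_target hy
  have hx₁' : x₁ ∈ e.baseSet := hx₁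
  have h1 : ContMDiffAt I 𝓘(ℝ, E →L[ℝ] ℝ) ∞
      (fun x => ((θ x).comp (e.symmL ℝ x) : E →L[ℝ] ℝ)) x₁ := by
    refine contMDiffAt_clm_of_apply fun w => ?_
    have hs : ContMDiffAt I I.tangent ∞
        (fun x => (⟨x, e.symmL ℝ x w⟩ : TangentBundle I M)) x₁ := by
      refine (e.contMDiffAt_iff (by rw [e.mem_source]; exact hx₁')).mpr ⟨contMDiffAt_id, ?_⟩
      refine (contMDiffAt_const (c := w)).congr_of_eventuallyEq ?_
      filter_upwards [e.open_baseSet.mem_nhds hx₁'] with x hx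
      have h1 := e.continuousLinearMapAt_symmL (R := ℝ) hx w
      rwa [e.continuousLinearMapAt_apply_of_mem (R := ℝ) hx] at h1
    exact ((contMDiffAt_totalSpace.mp (ContMDiffAt.clm_bundle_apply
      (E₂ := fun _ : M => ℝ) (hθ x₁) hs))).2
  have h2 := h1.comp y ((contMDiffOn_extChartAt_symm (I := I) (n := ∞) x₀).contMDiffAt
    ((isOpen_extChartAt_target x₀).mem_nhds hy))
  refine (contMDiffAt_iff_contDiffAt.mp h2).congr_of_eventuallyEq ?_
  filter_upwards [(isOpen_extChartAt_target x₀).mem_nhds hy] with z hz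
  have hz' : (extChartAt I x₀).symm z ∈ (chartAt H x₀).source := by
    rw [← extChartAt_source I]; exact (extChartAt I x₀).map_target hz
  have h3 := TangentBundle.symmL_trivializationAt (I := I) (𝕜 := ℝ) hz'
  rw [(extChartAt I x₀).right_inv hz] at h3
  change _ = ((θ _).comp (e.symmL ℝ _) : E →L[ℝ] ℝ)
  rw [h3]
  rfl

/-- The exterior derivative can be computed in any chart. -/
lemma extDerivOneForm_eq_chart [FiniteDimensional ℝ E] {θ : OneForm I M} (hθ : IsSmoothOneForm θ)
    (x₀ : M) {x : M} (hx : x ∈ (chartAt H x₀).source) (u v : TangentSpace I x) :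
    extDerivOneForm θ x u v =
      fderiv ℝ (chartForm θ x₀) (extChartAt I x₀ x) (mfderiv I 𝓘(ℝ, E) (extChartAt I x₀) x u)
        (mfderiv I 𝓘(ℝ, E) (extChartAt I x₀) x v) -
      fderiv ℝ (chartForm θ x₀) (extChartAt I x₀ x) (mfderiv I 𝓘(ℝ, E) (extChartAt I x₀) x v)
        (mfderiv I 𝓘(ℝ, E) (extChartAt I x₀) x u) := by
  have : IsManifold I 1 M := IsManifold.of_le (n := ∞) (by simp)
  rw [extDerivOneForm_apply]
  set e := extChartAt I x₀ with he
  set e' := extChartAt I x with he'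
  have hxe : x ∈ e.source := by rw [he, extChartAt_source]; exact hx
  set y := e' x with hy
  have hye : y ∈ e'.target := mem_extChartAt_target x
  have hxy : e'.symm y = x := extChartAt_to_inv x
  have he's : ContMDiffAt 𝓘(ℝ, E) I ∞ e'.symm y :=
    (contMDiffOn_extChartAt_symm x).contMDiffAt ((isOpen_extChartAt_target x).mem_nhds hye)
  have hτ : ContDiffAt ℝ ∞ (e ∘ e'.symm) y := by
    rw [← contMDiffAt_iff_contDiffAt]
    refine ContMDiffAt.comp (I' := I) y ?_ he's
    rw [hxy]
    exact contMDiffAt_extChartAt' hx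
  set τ : E → E := e ∘ e'.symm with hτdef
  have hτy : τ y = e x := by simp [hτdef, hxy]
  have hnear : ∀ᶠ z in 𝓝 y, z ∈ e'.target ∧ e'.symm z ∈ e.source := by
    refine Filter.Eventually.and ((isOpen_extChartAt_target x).mem_nhds hye) ?_
    have : e'.symm y ∈ e.source := by rw [hxy]; exact hxe
    exact he's.continuousAt ((isOpen_extChartAt_source x₀).mem_nhds this)
  have hcf : chartForm θ x =ᶠ[𝓝 y] fun z => (chartForm θ x₀ (τ z)).comp (fderiv ℝ τ z) := by
    filter_upwards [hnear.eventually_nhds,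
      (hτ.of_le (m := 1) (by exact WithTop.coe_le_coe.mpr le_top)).eventually (by simp)] with z hz hτz
    have hz' := hz.self_of_nhds
    have hτt : τ z ∈ e.target := e.map_source hz'.2
    have hinv : e.symm (τ z) = e'.symm z := e.left_inv hz'.2
    have h1 : mfderiv 𝓘(ℝ, E) I e'.symm z =
        (mfderiv 𝓘(ℝ, E) I e.symm (τ z)).comp (fderiv ℝ τ z) := by
      have h2 : e'.symm =ᶠ[𝓝 z] e.symm ∘ τ := by
        filter_upwards [hz] with w hw
        exact (e.left_inv hw.2).symm
      have h3 : MDifferentiableAt 𝓘(ℝ, E) I e.symm (τ z) :=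
        ((contMDiffOn_extChartAt_symm (n := 1) x₀).contMDiffAt
          ((isOpen_extChartAt_target x₀).mem_nhds hτt)).mdifferentiableAt (by simp)
      have h4 : MDifferentiableAt 𝓘(ℝ, E) 𝓘(ℝ, E) τ z :=
        (hτz.differentiableAt (by simp)).mdifferentiableAt
      rw [h2.mfderiv_eq, mfderiv_comp z h3 h4, mfderiv_eq_fderiv]
      rfl
    ext w
    simp only [chartForm, I.range_eq_univ, mfderivWithin_univ]
    rw [← he, ← he', h1]
    change θ (e'.symm z) _ = θ (e.symm (τ z)) _
    rw [hinv]
    rfl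
  have hmf : (mfderiv I 𝓘(ℝ, E) e x : E →L[ℝ] E) = fderiv ℝ τ y := by
    have h1 : (mfderiv 𝓘(ℝ, E) I e'.symm y : E →L[ℝ] E) = ContinuousLinearMap.id ℝ E := by
      have := mfderivWithin_range_extChartAt_symm (I := I) (x := x)
      rwa [I.range_eq_univ, mfderivWithin_univ] at this
    have hd : MDifferentiableAt I 𝓘(ℝ, E) e (e'.symm y) := by
      rw [hxy]; exact mdifferentiableAt_extChartAt hx
    have h2 := mfderiv_comp (I' := I) y hd (he's.mdifferentiableAt (by simp))
    rw [← hτdef, mfderiv_eq_fderiv] at h2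
    have h3 : (fderiv ℝ τ y : E →L[ℝ] E) = (mfderiv I 𝓘(ℝ, E) e (e'.symm y) : E →L[ℝ] E).comp
      (mfderiv 𝓘(ℝ, E) I e'.symm y : E →L[ℝ] E) := h2
    have h4 : ∀ A B : E →L[ℝ] E, B = ContinuousLinearMap.id ℝ E → A.comp B = A := by
      rintro A _ rfl; rfl
    have h5 : ∀ z, z = x →
        (mfderiv I 𝓘(ℝ, E) e z : E →L[ℝ] E) = (mfderiv I 𝓘(ℝ, E) e x : E →L[ℝ] E) := by
      rintro _ rfl; rfl
    exact (h5 _ hxy).symm.trans ((h4 _ _ h1).symm.trans h3.symm)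
  have hmf' : ∀ w : TangentSpace I x, (mfderiv I 𝓘(ℝ, E) e x w : E) = fderiv ℝ τ y w :=
    fun w => congrArg (fun T : E →L[ℝ] E => T w) hmf
  have hd0 : DifferentiableAt ℝ (chartForm θ x₀) (τ y) := by
    refine (contDiffAt_chartForm hθ x₀ ?_).differentiableAt (by simp)
    rw [hτy]; exact e.map_source hxe
  have hdτ : DifferentiableAt ℝ τ y := hτ.differentiableAt (by simp)
  have hddτ : DifferentiableAt ℝ (fderiv ℝ τ) y :=
    (hτ.fderiv_right (m := 1) (by exact WithTop.coe_le_coe.mpr le_top)).differentiableAt (by simp)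
  have hder : ∀ a b : E, fderiv ℝ (chartForm θ x) y a b =
      fderiv ℝ (chartForm θ x₀) (e x) (fderiv ℝ τ y a) (fderiv ℝ τ y b) +
        chartForm θ x₀ (e x) (fderiv ℝ (fderiv ℝ τ) y a b) := by
    intro a b
    rw [hcf.fderiv_eq]
    have h1 : HasFDerivAt (fun z => chartForm θ x₀ (τ z))
        ((fderiv ℝ (chartForm θ x₀) (τ y)).comp (fderiv ℝ τ y)) y :=
      hd0.hasFDerivAt.comp y hdτ.hasFDerivAt
    rw [(h1.clm_comp hddτ.hasFDerivAt).fderiv, hτy]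
    simp
    ring
  have hsymm : IsSymmSndFDerivAt ℝ τ y := hτ.isSymmSndFDerivAt (by
    simp only [minSmoothness_of_isRCLikeNormedField]
    exact WithTop.coe_le_coe.mpr le_top)
  have hfin : ∀ a b a' b' : E, a' = fderiv ℝ τ y a → b' = fderiv ℝ τ y b →
      fderiv ℝ (chartForm θ x) y a b - fderiv ℝ (chartForm θ x) y b a =
      fderiv ℝ (chartForm θ x₀) (e x) a' b' - fderiv ℝ (chartForm θ x₀) (e x) b' a' := by
    rintro a b _ _ rfl rfl
    rw [hder, hder, hsymm a b]
    ring
  exact hfin u v _ _ (hmf' u) (hmf' v)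

lemma isSmoothOnFields_extDerivOneForm [FiniteDimensional ℝ E] {θ : OneForm I M}
    (hθ : IsSmoothOneForm θ) : IsSmoothOnFields (extDerivOneForm θ) := by
  have : IsManifold I 1 M := IsManifold.of_le (n := ∞) (by simp)
  intro X Y hX hY x₀
  let e := trivializationAt E (TangentSpace I) x₀
  have hX₀ := (contMDiffAt_totalSpace.mp (hX x₀)).2
  have hY₀ := (contMDiffAt_totalSpace.mp (hY x₀)).2
  have hD : ContMDiffAt I 𝓘(ℝ, E →L[ℝ] E →L[ℝ] ℝ) ∞
      (fun x => fderiv ℝ (chartForm θ x₀) (extChartAt I x₀ x)) x₀ := by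
    have h1 : ContDiffAt ℝ ∞ (fderiv ℝ (chartForm θ x₀)) (extChartAt I x₀ x₀) :=
      (contDiffAt_chartForm hθ x₀ (mem_extChartAt_target x₀)).fderiv_right (by simp)
    exact h1.contMDiffAt.comp x₀ contMDiffAt_extChartAt
  refine (((hD.clm_apply hX₀).clm_apply hY₀).sub
    ((hD.clm_apply hY₀).clm_apply hX₀)).congr_of_eventuallyEq ?_
  filter_upwards [(chartAt H x₀).open_source.mem_nhds (mem_chart_source H x₀)] with x hx
  rw [extDerivOneForm_eq_chart hθ x₀ hx]
  have h1 : ∀ w : TangentSpace I x, (mfderiv I 𝓘(ℝ, E) (extChartAt I x₀) x w : E) =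
      (e ⟨x, w⟩).2 := by
    intro w
    rw [← TangentBundle.continuousLinearMapAt_trivializationAt hx]
    exact e.continuousLinearMapAt_apply_of_mem (R := ℝ) hx w
  rw [h1, h1]

end ExteriorDerivative

/-! ### The cotangent bundle and its symplectic form -/

section Cotangent

variable {E : Type*} [NormedAddCommGroup E] [NormedSpace ℝ E]
  {H : Type*} [TopologicalSpace H] {I : ModelWithCorners ℝ E H}
  {M : Type*} [TopologicalSpace M] [ChartedSpace H M] [IsManifold I ∞ M]

lemma trivializationAt_cotangent_apply (x₀ : M) (q : CotangentBundle I M) :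
    (trivializationAt (E →L[ℝ] ℝ) (fun x : M => TangentSpace I x →L[ℝ] ℝ) x₀ q).2 =
      ((q.2 : TangentSpace I q.1 →L[ℝ] ℝ).comp
        ((trivializationAt E (TangentSpace I) x₀).symmL ℝ q.1) : E →L[ℝ] ℝ) := by
  simp [hom_trivializationAt_apply, ContinuousLinearMap.inCoordinates]

lemma extChartAt_cotangent_apply (p q : CotangentBundle I M) :
    extChartAt (I.prod 𝓘(ℝ, E →L[ℝ] ℝ)) p q =
      (extChartAt I p.1 q.1, ((q.2 : TangentSpace I q.1 →L[ℝ] ℝ).comp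
        ((trivializationAt E (TangentSpace I) p.1).symmL ℝ q.1) : E →L[ℝ] ℝ)) := by
  rw [FiberBundle.extChartAt]
  refine Prod.ext ?_ (trivializationAt_cotangent_apply p.1 q)
  simp only [mfld_simps]
  rfl

lemma symmL_trivializationAt_self (x : M) :
    ((trivializationAt E (TangentSpace I) x).symmL ℝ x : E →L[ℝ] E) =
      ContinuousLinearMap.id ℝ E := by
  have : IsManifold I 1 M := IsManifold.of_le (n := ∞) (by simp)
  rw [TangentBundle.symmL_trivializationAt (mem_chart_source H x)]
  exact mfderivWithin_range_extChartAt_symm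

lemma extChartAt_cotangent_symm_fst (p : CotangentBundle I M) {y : E × (E →L[ℝ] ℝ)}
    (hy : y ∈ (extChartAt (I.prod 𝓘(ℝ, E →L[ℝ] ℝ)) p).target) :
    y.1 ∈ (extChartAt I p.1).target ∧
    ((extChartAt (I.prod 𝓘(ℝ, E →L[ℝ] ℝ)) p).symm y).1 = (extChartAt I p.1).symm y.1 := by
  have h1 := (extChartAt (I.prod 𝓘(ℝ, E →L[ℝ] ℝ)) p).map_target hy
  have h2 := (extChartAt (I.prod 𝓘(ℝ, E →L[ℝ] ℝ)) p).right_inv hy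
  rw [extChartAt_cotangent_apply] at h2
  have h0 : ∀ q : CotangentBundle I M, q ∈ (extChartAt (I.prod 𝓘(ℝ, E →L[ℝ] ℝ)) p).source →
      q.1 ∈ (extChartAt I p.1).source := by
    intro q hq
    rw [FiberBundle.extChartAt] at hq
    rw [extChartAt_source]
    simp only [mfld_simps] at hq
    exact hq.1.1
  have h3 := h0 _ h1
  have h4 := congrArg Prod.fst h2
  dsimp only at h4
  rw [← h4]
  exact ⟨(extChartAt I p.1).map_source h3, ((extChartAt I p.1).left_inv h3).symm⟩

lemma isSmoothOneForm_canonicalOneForm [FiniteDimensional ℝ E] :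
    IsSmoothOneForm (canonicalOneForm : OneForm _ (CotangentBundle I M)) := by
  have hp := contMDiff_proj (n := ∞) (IB := I) (F := E →L[ℝ] ℝ) (fun x : M => TangentSpace I x →L[ℝ] ℝ)
  have h1 : IsSmoothFamily (I.prod 𝓘(ℝ, E →L[ℝ] ℝ)) (fun q : CotangentBundle I M => q.1)
      (fun q => q.2) := (isSmoothFamily_iff_hom hp).mpr contMDiff_id
  have h2 := h1.comp (contMDiff_proj (n := ∞) (F := E × (E →L[ℝ] ℝ)) (IB := I.prod 𝓘(ℝ, E →L[ℝ] ℝ))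
    (TangentSpace (I.prod 𝓘(ℝ, E →L[ℝ] ℝ)) (M := CotangentBundle I M)))
  have h3 := h2.apply (v := fun v => mfderiv (I.prod 𝓘(ℝ, E →L[ℝ] ℝ)) I
    (fun q : CotangentBundle I M => q.1) v.1 v.2) (hp.contMDiff_tangentMap (by simp))
  exact (isSmoothFamily_iff_hom (p := fun q : CotangentBundle I M => q) contMDiff_id).mp
    (isSmoothFamily_of_tangentBundle h3)

/-- The derivative of the inclusion of a fibre of the cotangent bundle. -/
lemma hasMFDerivAt_cotangent_fibre (x : M) (ξ : E →L[ℝ] ℝ) :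
    HasMFDerivAt 𝓘(ℝ, E →L[ℝ] ℝ) (I.prod 𝓘(ℝ, E →L[ℝ] ℝ))
      (fun η : E →L[ℝ] ℝ => (⟨x, η⟩ : CotangentBundle I M)) ξ
      (ContinuousLinearMap.inr ℝ E (E →L[ℝ] ℝ)) := by
  refine ⟨?_, HasFDerivAt.hasFDerivWithinAt ?_⟩
  · exact (FiberBundle.continuous_totalSpaceMk (E →L[ℝ] ℝ)
      (fun x : M => TangentSpace I x →L[ℝ] ℝ) x).continuousAt
  · have h : writtenInExtChartAt 𝓘(ℝ, E →L[ℝ] ℝ) (I.prod 𝓘(ℝ, E →L[ℝ] ℝ)) ξ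
        (fun η : E →L[ℝ] ℝ => (⟨x, η⟩ : CotangentBundle I M)) =
        fun η => (extChartAt I x x, η) := by
      funext η
      change extChartAt (I.prod 𝓘(ℝ, E →L[ℝ] ℝ)) (⟨x, ξ⟩ : CotangentBundle I M) ⟨x, η⟩ = _
      rw [extChartAt_cotangent_apply]
      dsimp only
      refine Prod.ext rfl ?_
      change η.comp ((trivializationAt E (TangentSpace I) x).symmL ℝ x : E →L[ℝ] E) = η
      rw [symmL_trivializationAt_self]
      rfl
    rw [h]
    exact (hasFDerivAt_const _ _).prodMk (hasFDerivAt_id _)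

variable [I.Boundaryless]

lemma hasMFDerivAt_cotangent_proj (p : CotangentBundle I M) :
    HasMFDerivAt (I.prod 𝓘(ℝ, E →L[ℝ] ℝ)) I (fun q : CotangentBundle I M => q.1) p
      (ContinuousLinearMap.fst ℝ E (E →L[ℝ] ℝ)) := by
  refine ⟨(contMDiff_proj (n := ∞) (IB := I)
    (fun x : M => TangentSpace I x →L[ℝ] ℝ)).continuous.continuousAt, ?_⟩
  refine HasFDerivAt.hasFDerivWithinAt ?_
  refine (ContinuousLinearMap.fst ℝ E (E →L[ℝ] ℝ)).hasFDerivAt.congr_of_eventuallyEq ?_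
  filter_upwards [(isOpen_extChartAt_target p).mem_nhds (mem_extChartAt_target p)] with y hy
  obtain ⟨h1, h2⟩ := extChartAt_cotangent_symm_fst p hy
  change extChartAt I p.1 (((extChartAt (I.prod 𝓘(ℝ, E →L[ℝ] ℝ)) p).symm y).1) = y.1
  rw [h2, (extChartAt I p.1).right_inv h1]

lemma chartForm_canonicalOneForm (p : CotangentBundle I M) {y : E × (E →L[ℝ] ℝ)}
    (hy : y ∈ (extChartAt (I.prod 𝓘(ℝ, E →L[ℝ] ℝ)) p).target) (w : E × (E →L[ℝ] ℝ)) :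
    chartForm (canonicalOneForm : OneForm _ (CotangentBundle I M)) p y w = y.2 w.1 := by
  have : IsManifold I 1 M := IsManifold.of_le (n := ∞) (by simp)
  obtain ⟨hy1, hfst⟩ := extChartAt_cotangent_symm_fst p hy
  set e := extChartAt (I.prod 𝓘(ℝ, E →L[ℝ] ℝ)) p with he
  have hsm : ContMDiffAt 𝓘(ℝ, E × (E →L[ℝ] ℝ)) (I.prod 𝓘(ℝ, E →L[ℝ] ℝ)) ∞ e.symm y :=
    (contMDiffOn_extChartAt_symm p).contMDiffAt ((isOpen_extChartAt_target p).mem_nhds hy)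
  have h1 : mfderiv 𝓘(ℝ, E × (E →L[ℝ] ℝ)) I (fun z => (e.symm z).1) y =
      (mfderiv (I.prod 𝓘(ℝ, E →L[ℝ] ℝ)) I (fun q : CotangentBundle I M => q.1) (e.symm y)).comp
        (mfderiv 𝓘(ℝ, E × (E →L[ℝ] ℝ)) (I.prod 𝓘(ℝ, E →L[ℝ] ℝ)) e.symm y) :=
    mfderiv_comp y (hasMFDerivAt_cotangent_proj _).mdifferentiableAt
      (hsm.mdifferentiableAt (by simp))
  have h2 : mfderiv 𝓘(ℝ, E × (E →L[ℝ] ℝ)) I (fun z => (e.symm z).1) y =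
      (mfderiv 𝓘(ℝ, E) I (extChartAt I p.1).symm y.1).comp
        (ContinuousLinearMap.fst ℝ E (E →L[ℝ] ℝ)) := by
    have h3 : (fun z => (e.symm z).1) =ᶠ[𝓝 y]
        (extChartAt I p.1).symm ∘ (Prod.fst : E × (E →L[ℝ] ℝ) → E) := by
      filter_upwards [(isOpen_extChartAt_target p).mem_nhds hy] with z hz
      exact (extChartAt_cotangent_symm_fst p hz).2
    have h4 : MDifferentiableAt 𝓘(ℝ, E) I (extChartAt I p.1).symm y.1 :=
      ((contMDiffOn_extChartAt_symm (n := 1) p.1).contMDiffAt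
        ((isOpen_extChartAt_target p.1).mem_nhds hy1)).mdifferentiableAt (by simp)
    have h5 : MDifferentiableAt 𝓘(ℝ, E × (E →L[ℝ] ℝ)) 𝓘(ℝ, E)
        (Prod.fst : E × (E →L[ℝ] ℝ) → E) y :=
      differentiableAt_fst.mdifferentiableAt
    rw [h3.mfderiv_eq, mfderiv_comp y h4 h5, mfderiv_eq_fderiv, fderiv_fst]
    rfl
  have hsrc : (extChartAt I p.1).symm y.1 ∈ (chartAt H p.1).source := by
    rw [← extChartAt_source I]; exact (extChartAt I p.1).map_target hy1
  have h3 := TangentBundle.symmL_trivializationAt (I := I) (𝕜 := ℝ) hsrc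
  rw [(extChartAt I p.1).right_inv hy1, I.range_eq_univ, mfderivWithin_univ] at h3
  have h4 := congrArg Prod.snd (e.right_inv hy)
  rw [he, extChartAt_cotangent_apply, ← he, hfst] at h4
  have h5 := congrArg (fun T : E →L[ℝ] ℝ => T w.1) h4
  rw [← h5]
  have h6 := h1.symm.trans h2
  rw [← h3] at h6
  unfold chartForm
  rw [(I.prod 𝓘(ℝ, E →L[ℝ] ℝ)).range_eq_univ, mfderivWithin_univ]
  exact congrArg (fun T : E × (E →L[ℝ] ℝ) →L[ℝ] E => ((e.symm y).2 : E →L[ℝ] ℝ) (T w)) h6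

set_option synthInstance.maxHeartbeats 200000 in
/-- The standard symplectic form in canonical coordinates. -/
lemma cotangentForm_apply (p : CotangentBundle I M)
    (u v : TangentSpace (I.prod 𝓘(ℝ, E →L[ℝ] ℝ)) p) :
    cotangentForm I M p u v =
      (u : E × (E →L[ℝ] ℝ)).2 (v : E × (E →L[ℝ] ℝ)).1 -
        (v : E × (E →L[ℝ] ℝ)).2 (u : E × (E →L[ℝ] ℝ)).1 := by
  let L : E × (E →L[ℝ] ℝ) →L[ℝ] E × (E →L[ℝ] ℝ) →L[ℝ] ℝ :=
    ((ContinuousLinearMap.compL ℝ (E × (E →L[ℝ] ℝ)) E ℝ).flip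
      (ContinuousLinearMap.fst ℝ E (E →L[ℝ] ℝ))).comp (ContinuousLinearMap.snd ℝ E (E →L[ℝ] ℝ))
  have hL : fderiv ℝ (chartForm (canonicalOneForm : OneForm _ (CotangentBundle I M)) p)
      (extChartAt (I.prod 𝓘(ℝ, E →L[ℝ] ℝ)) p p) = L := by
    have hLd : ∀ z, HasFDerivAt (fun y => L y) L z := fun z =>
      ContinuousLinearMap.hasFDerivAt (𝕜 := ℝ) (E := E × (E →L[ℝ] ℝ))
        (F := E × (E →L[ℝ] ℝ) →L[ℝ] ℝ) L
    refine ((hLd _).congr_of_eventuallyEq ?_).fderiv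
    filter_upwards [(isOpen_extChartAt_target p).mem_nhds (mem_extChartAt_target p)] with y hy
    exact ContinuousLinearMap.ext fun w => chartForm_canonicalOneForm p hy w
  unfold cotangentForm
  rw [extDerivOneForm_apply, hL]
  rfl

lemma isNondegenerateBilin_cotangentForm [FiniteDimensional ℝ E] :
    IsNondegenerateBilin (cotangentForm I M) := by
  intro p u hu
  have h : ∀ v : E × (E →L[ℝ] ℝ),
      (u : E × (E →L[ℝ] ℝ)).2 v.1 - v.2 (u : E × (E →L[ℝ] ℝ)).1 = 0 := by
    exact fun v => (cotangentForm_apply p u v).symm.trans (hu v)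
  refine Prod.ext (SeparatingDual.eq_zero_of_forall_dual_eq_zero (R := ℝ) fun f => ?_) ?_
  · simpa using h (0, f)
  · refine ContinuousLinearMap.ext fun w => ?_
    change (u : E × (E →L[ℝ] ℝ)).2 w = 0
    simpa using h (w, 0)

/-- The derivative of the zero section of the cotangent bundle. -/
lemma hasMFDerivAt_cotangent_zeroSection (x : M) :
    HasMFDerivAt I (I.prod 𝓘(ℝ, E →L[ℝ] ℝ))
      (fun z : M => (⟨z, 0⟩ : CotangentBundle I M)) x
      (ContinuousLinearMap.inl ℝ E (E →L[ℝ] ℝ)) := by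
  refine ⟨?_, HasFDerivAt.hasFDerivWithinAt ?_⟩
  · exact (contMDiff_zeroSection (n := ∞) (IB := I) ℝ
      (fun x : M => TangentSpace I x →L[ℝ] ℝ)).continuous.continuousAt
  · refine ((hasFDerivAt_id (𝕜 := ℝ) _).prodMk (hasFDerivAt_const (0 : E →L[ℝ] ℝ)
      (extChartAt I x x))).congr_of_eventuallyEq ?_
    filter_upwards [(isOpen_extChartAt_target (I := I) x).mem_nhds (mem_extChartAt_target x)]
      with y hy
    change extChartAt (I.prod 𝓘(ℝ, E →L[ℝ] ℝ)) (⟨x, 0⟩ : CotangentBundle I M)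
      ⟨(extChartAt I x).symm y, 0⟩ = _
    rw [extChartAt_cotangent_apply]
    exact Prod.ext ((extChartAt I x).right_inv hy) (ContinuousLinearMap.zero_comp _)

end Cotangent

/-! ### The smooth structure of the tangent circle bundle -/

section CircleBundleSmooth

variable {S : Type*} [TopologicalSpace S] [ChartedSpace (EuclideanSpace ℝ (Fin 2)) S]
  [IsManifold (𝓡 2) ∞ S]

local instance : Fact (Module.finrank ℝ (EuclideanSpace ℝ (Fin 2)) = 1 + 1) :=
  ⟨finrank_euclideanSpace_fin⟩

/-- The local trivialization of the circle bundle in the preferred chart at `x`. -/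
noncomputable abbrev circleTriv (x : S) :=
  (circleBundleCore S).localTriv (achart (EuclideanSpace ℝ (Fin 2)) x)

lemma circleBundle_chartAt (c : TangentCircleBundle S) :
    chartAt (ModelProd (EuclideanSpace ℝ (Fin 2)) (EuclideanSpace ℝ (Fin 1))) c =
      (circleTriv c.1).toOpenPartialHomeomorph.trans
        ((chartAt (EuclideanSpace ℝ (Fin 2)) c.1).prod
          (chartAt (EuclideanSpace ℝ (Fin 1))
            (c.2 : sphere (0 : EuclideanSpace ℝ (Fin 2)) 1))) := by
  have h : (circleTriv c.1) c = (c.1, c.2) :=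
    Prod.ext rfl ((circleBundleCore S).coordChange_self _ c.1
      ((circleBundleCore S).mem_baseSet_at c.1) c.2)
  change (circleTriv c.1).toOpenPartialHomeomorph.trans
    (chartAt _ ((circleTriv c.1) c)) = _
  rw [h]
  rfl

lemma circleTriv_self (c : TangentCircleBundle S) : circleTriv c.1 c = (c.1, c.2) :=
  Prod.ext rfl ((circleBundleCore S).coordChange_self _ c.1
    ((circleBundleCore S).mem_baseSet_at c.1) c.2)

lemma contMDiffAt_circleTriv (c : TangentCircleBundle S) :
    ContMDiffAt modelC ((𝓡 2).prod (𝓡 1)) ∞ (circleTriv c.1) c := by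
  have h1 : ContMDiffAt modelC modelC ∞
      (chartAt (ModelProd (EuclideanSpace ℝ (Fin 2)) (EuclideanSpace ℝ (Fin 1))) c) c :=
    (contMDiffOn_chart (I := modelC) (x := c)).contMDiffAt
      ((chartAt _ c).open_source.mem_nhds (mem_chart_source _ c))
  let d : S × sphere (0 : EuclideanSpace ℝ (Fin 2)) 1 := (c.1, c.2)
  have h2 : ContMDiffAt modelC ((𝓡 2).prod (𝓡 1)) ∞ (chartAt (ModelProd
      (EuclideanSpace ℝ (Fin 2)) (EuclideanSpace ℝ (Fin 1))) d).symm (chartAt (ModelProd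
      (EuclideanSpace ℝ (Fin 2)) (EuclideanSpace ℝ (Fin 1))) c c) := by
    refine (contMDiffOn_chart_symm (I := (𝓡 2).prod (𝓡 1)) (x := d)).contMDiffAt
      ((chartAt _ d).open_target.mem_nhds ?_)
    have : chartAt (ModelProd (EuclideanSpace ℝ (Fin 2)) (EuclideanSpace ℝ (Fin 1))) c c =
        chartAt (ModelProd (EuclideanSpace ℝ (Fin 2)) (EuclideanSpace ℝ (Fin 1))) d d := by
      rw [circleBundle_chartAt]
      change ((chartAt _ c.1).prod (chartAt _ _)) ((circleTriv c.1) c) = _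
      rw [circleTriv_self]
      rfl
    rw [this]
    exact mem_chart_target _ d
  refine (h2.comp c h1).congr_of_eventuallyEq ?_
  filter_upwards [(chartAt (ModelProd (EuclideanSpace ℝ (Fin 2))
    (EuclideanSpace ℝ (Fin 1))) c).open_source.mem_nhds (mem_chart_source _ c)] with c' hc'
  rw [circleBundle_chartAt] at hc'
  change _ = (chartAt _ d).symm (chartAt _ c c')
  rw [circleBundle_chartAt]
  exact ((chartAt _ d).left_inv hc'.2).symm

lemma contMDiff_circleBundle_proj :
    ContMDiff modelC (𝓡 2) ∞ (fun c : TangentCircleBundle S => c.1) := by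
  intro c
  exact (contMDiff_fst.contMDiffAt.comp c (contMDiffAt_circleTriv c)).congr_of_eventuallyEq
    (Filter.Eventually.of_forall fun c' => rfl)

lemma hasMFDerivAt_circleBundle_proj (c : TangentCircleBundle S) :
    HasMFDerivAt modelC (𝓡 2) (fun c : TangentCircleBundle S => c.1) c
      (ContinuousLinearMap.fst ℝ (EuclideanSpace ℝ (Fin 2)) (EuclideanSpace ℝ (Fin 1))) := by
  refine ⟨contMDiff_circleBundle_proj.continuous.continuousAt, HasFDerivAt.hasFDerivWithinAt ?_⟩
  refine (ContinuousLinearMap.fst ℝ (EuclideanSpace ℝ (Fin 2))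
    (EuclideanSpace ℝ (Fin 1))).hasFDerivAt.congr_of_eventuallyEq ?_
  filter_upwards [(isOpen_extChartAt_target (I := modelC) c).mem_nhds
    (mem_extChartAt_target c)] with y hy
  have h1 := (extChartAt modelC c).right_inv hy
  have h2 : ∀ c' : TangentCircleBundle S,
      (extChartAt modelC c c').1 = extChartAt (𝓡 2) c.1 c'.1 := by
    intro c'
    simp only [extChartAt, OpenPartialHomeomorph.extend, PartialEquiv.coe_trans, comp_apply]
    change (modelC (chartAt _ c c')).1 = _
    rw [circleBundle_chartAt]
    rfl
  change extChartAt (𝓡 2) c.1 (((extChartAt modelC c).symm y).1) = y.1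
  rw [← h2, h1]

/-- The derivative of the inclusion of a fibre of the circle bundle. -/
lemma hasMFDerivAt_circleBundle_fibre (x : S) (s : sphere (0 : EuclideanSpace ℝ (Fin 2)) 1) :
    HasMFDerivAt (𝓡 1) modelC
      (fun s' : sphere (0 : EuclideanSpace ℝ (Fin 2)) 1 => (⟨x, s'⟩ : TangentCircleBundle S)) s
      (ContinuousLinearMap.inr ℝ (EuclideanSpace ℝ (Fin 2)) (EuclideanSpace ℝ (Fin 1))) := by
  refine ⟨?_, HasFDerivAt.hasFDerivWithinAt ?_⟩
  · exact (FiberBundle.continuous_totalSpaceMk (sphere (0 : EuclideanSpace ℝ (Fin 2)) 1)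
      (circleBundleCore S).Fiber x).continuousAt
  · refine ((hasFDerivAt_const (extChartAt (𝓡 2) x x) _).prodMk
      (hasFDerivAt_id (𝕜 := ℝ) _)).congr_of_eventuallyEq ?_
    filter_upwards [(isOpen_extChartAt_target (I := 𝓡 1) s).mem_nhds
      (mem_extChartAt_target s)] with y hy
    change extChartAt modelC (⟨x, s⟩ : TangentCircleBundle S)
      ⟨x, (extChartAt (𝓡 1) s).symm y⟩ = _
    simp only [extChartAt, OpenPartialHomeomorph.extend, PartialEquiv.coe_trans, comp_apply]
    change modelC (chartAt _ (⟨x, s⟩ : TangentCircleBundle S)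
      ⟨x, (extChartAt (𝓡 1) s).symm y⟩) = _
    rw [circleBundle_chartAt]
    change modelC (((chartAt _ x).prod (chartAt _ s)) ((circleTriv x)
      ⟨x, (extChartAt (𝓡 1) s).symm y⟩)) = _
    rw [circleTriv_self ⟨x, (extChartAt (𝓡 1) s).symm y⟩]
    exact Prod.ext rfl ((extChartAt (𝓡 1) s).right_inv hy)

end CircleBundleSmooth

/-! ### The unit vector of a ray -/

section UnitVector

variable {S : Type*} [TopologicalSpace S] [ChartedSpace (EuclideanSpace ℝ (Fin 2)) S]
  [IsManifold (𝓡 2) ∞ S]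
  (g : ContMDiffRiemannianMetric (𝓡 2) ∞ (EuclideanSpace ℝ (Fin 2))
      (fun x : S => TangentSpace (𝓡 2) x))

local instance : Fact (Module.finrank ℝ (EuclideanSpace ℝ (Fin 2)) = 1 + 1) :=
  ⟨finrank_euclideanSpace_fin⟩

/-- The unit vector representing a ray in the preferred chart. -/
def rayVector (c : TangentCircleBundle S) : TangentSpace (𝓡 2) c.1 :=
  let s : sphere (0 : EuclideanSpace ℝ (Fin 2)) 1 := c.2
  (s : EuclideanSpace ℝ (Fin 2))

/-- The `g`-normalization of a tangent vector. -/
noncomputable def normalizeVector (x : S) (v : TangentSpace (𝓡 2) x) : TangentSpace (𝓡 2) x :=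
  (√(g.inner x v v))⁻¹ • v

lemma normalizeVector_smul (x : S) (v : TangentSpace (𝓡 2) x) {m : ℝ} (hm : 0 < m) :
    normalizeVector g x (m • v) = normalizeVector g x v := by
  have h : g.inner x (m • v) (m • v) = m ^ 2 * g.inner x v v := by
    simp only [map_smul, smul_apply, smul_eq_mul]
    ring
  rw [normalizeVector, normalizeVector, h, Real.sqrt_mul (sq_nonneg m), Real.sqrt_sq hm.le,
    smul_smul, mul_inv, mul_comm m⁻¹, mul_assoc, inv_mul_cancel₀ hm.ne', mul_one]

lemma contMDiff_rayUnitVector :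
    ContMDiff modelC (𝓡 2).tangent ∞ (fun c : TangentCircleBundle S =>
      (⟨c.1, rayUnitVector g c⟩ : TangentBundle (𝓡 2) S)) := by
  intro c₀
  let e := trivializationAt (EuclideanSpace ℝ (Fin 2)) (TangentSpace (𝓡 2) (M := S)) c₀.1
  let s : TangentCircleBundle S → EuclideanSpace ℝ (Fin 2) := fun c =>
    ((circleTriv c₀.1 c).2 : sphere (0 : EuclideanSpace ℝ (Fin 2)) 1)
  let w : ∀ c : TangentCircleBundle S, TangentSpace (𝓡 2) c.1 := fun c => e.symmL ℝ c.1 (s c)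
  have hs : ContMDiffAt modelC 𝓘(ℝ, EuclideanSpace ℝ (Fin 2)) ∞ s c₀ :=
    ((contMDiff_coe_sphere (n := 1) (m := ∞)).comp contMDiff_snd).contMDiffAt.comp c₀
      (contMDiffAt_circleTriv c₀)
  have hbase : ∀ᶠ c : TangentCircleBundle S in 𝓝 c₀, c.1 ∈ e.baseSet :=
    contMDiff_circleBundle_proj.continuous.continuousAt (e.open_baseSet.mem_nhds
      (FiberBundle.mem_baseSet_trivializationAt' c₀.1))
  have hes : ∀ c : TangentCircleBundle S, c.1 ∈ e.baseSet → (e ⟨c.1, w c⟩).2 = s c := by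
    intro c hc
    have h1 := e.continuousLinearMapAt_symmL (R := ℝ) hc (s c)
    rwa [e.continuousLinearMapAt_apply_of_mem (R := ℝ) hc] at h1
  have hw : ContMDiffAt modelC (𝓡 2).tangent ∞
      (fun c => (⟨c.1, w c⟩ : TangentBundle (𝓡 2) S)) c₀ := by
    refine contMDiffAt_totalSpace.mpr ⟨contMDiff_circleBundle_proj c₀, ?_⟩
    refine hs.congr_of_eventuallyEq ?_
    filter_upwards [hbase] with c hc
    exact hes c hc
  have hwc : ∀ c : TangentCircleBundle S, c.1 ∈ e.baseSet → ∃ m : ℝ, 0 < m ∧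
      w c = m • rayVector c := by
    intro c hc
    let T := (tangentBundleCore (𝓡 2) S).coordChange (achart (EuclideanSpace ℝ (Fin 2)) c.1)
      (achart (EuclideanSpace ℝ (Fin 2)) c₀.1) c.1
    have hT : ∀ v, e.symmL ℝ c.1 (T v) = v := by
      intro v
      have h1 := e.symmL_continuousLinearMapAt (R := ℝ) hc v
      rw [TangentBundle.continuousLinearMapAt_trivializationAt_eq_core hc] at h1
      exact h1
    have hne : T (rayVector c) ≠ 0 :=
      tangentCore_apply_ne_zero S (mem_chart_source _ c.1) hc (sphere_coe_ne_zero _)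
    refine ⟨_, inv_pos.mpr (norm_pos_iff.mpr hne), ?_⟩
    have h1 : s c = _ := rayMap_coe hne
    change e.symmL ℝ c.1 (s c) = _
    rw [h1, map_smul]
    exact congrArg _ (hT _)
  have hwne : ∀ c : TangentCircleBundle S, c.1 ∈ e.baseSet → w c ≠ 0 := by
    intro c hc h0
    have h1 := hes c hc
    rw [h0, e.apply_eq_prod_continuousLinearEquivAt ℝ c.1 hc 0, map_zero] at h1
    exact sphere_coe_ne_zero _ h1.symm
  have hgw : ContMDiffAt modelC 𝓘(ℝ, ℝ) ∞ (fun c => g.inner c.1 (w c) (w c)) c₀ := by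
    have hg := g.contMDiff.contMDiffAt.comp c₀ (contMDiff_circleBundle_proj c₀)
    exact (contMDiffAt_totalSpace.mp (ContMDiffAt.clm_bundle_apply₂
      (E₃ := fun _ : S => ℝ) hg hw hw)).2
  have hc₀ : c₀.1 ∈ e.baseSet := hbase.self_of_nhds
  have hpos := g.pos c₀.1 (w c₀) (hwne c₀ hc₀)
  have hk : ContMDiffAt modelC 𝓘(ℝ, ℝ) ∞ (fun c => (√(g.inner c.1 (w c) (w c)))⁻¹) c₀ := by
    have h1 : ContDiffAt ℝ ∞ (fun r : ℝ => (√r)⁻¹) (g.inner c₀.1 (w c₀) (w c₀)) :=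
      (Real.contDiffAt_sqrt hpos.ne').inv (Real.sqrt_ne_zero'.mpr hpos)
    exact ContMDiffAt.comp (g := fun r : ℝ => (√r)⁻¹) c₀ h1.contMDiffAt hgw
  refine contMDiffAt_totalSpace.mpr ⟨contMDiff_circleBundle_proj c₀, ?_⟩
  refine (hk.smul hs).congr_of_eventuallyEq ?_
  filter_upwards [hbase] with c hc
  obtain ⟨m, hm, hmw⟩ := hwc c hc
  have h1 : rayUnitVector g c = normalizeVector g c.1 (w c) := by
    rw [hmw, normalizeVector_smul g c.1 _ hm]
    rfl
  change (e ⟨c.1, rayUnitVector g c⟩).2 = _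
  change _ = (√(g.inner c.1 (w c) (w c)))⁻¹ • s c
  rw [h1, ← hes c hc, normalizeVector, e.apply_eq_prod_continuousLinearEquivAt ℝ c.1 hc,
    e.apply_eq_prod_continuousLinearEquivAt ℝ c.1 hc, map_smul]

end UnitVector

/-! ### The polar map and its vertical derivatives -/

section Vertical

variable {S : Type*} [TopologicalSpace S] [ChartedSpace (EuclideanSpace ℝ (Fin 2)) S]
  [IsManifold (𝓡 2) ∞ S]
  (g : ContMDiffRiemannianMetric (𝓡 2) ∞ (EuclideanSpace ℝ (Fin 2))
      (fun x : S => TangentSpace (𝓡 2) x))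

local instance : Fact (Module.finrank ℝ (EuclideanSpace ℝ (Fin 2)) = 1 + 1) :=
  ⟨finrank_euclideanSpace_fin⟩

/-- A Riemannian metric at a point, in the model space. -/
def metricAt (x : S) : EuclideanSpace ℝ (Fin 2) →L[ℝ] EuclideanSpace ℝ (Fin 2) →L[ℝ] ℝ :=
  g.inner x

/-- The unit vectors at a point, as a function on the circle. -/
noncomputable def fibreUnit (x : S) (s : sphere (0 : EuclideanSpace ℝ (Fin 2)) 1) :
    EuclideanSpace ℝ (Fin 2) :=
  (√(metricAt g x s s))⁻¹ • (s : EuclideanSpace ℝ (Fin 2))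

lemma metricAt_pos (x : S) {v : EuclideanSpace ℝ (Fin 2)} (hv : v ≠ 0) : 0 < metricAt g x v v :=
  g.pos x v hv

lemma metricAt_symm (x : S) (v w : EuclideanSpace ℝ (Fin 2)) :
    metricAt g x v w = metricAt g x w v :=
  g.symm x v w

lemma metricAt_fibreUnit (x : S) (s : sphere (0 : EuclideanSpace ℝ (Fin 2)) 1) :
    metricAt g x (fibreUnit g x s) (fibreUnit g x s) = 1 := by
  have h := metricAt_pos g x (sphere_coe_ne_zero s)
  simp only [fibreUnit, map_smul, smul_apply, smul_eq_mul]
  rw [← mul_assoc, ← mul_inv, Real.mul_self_sqrt h.le, inv_mul_cancel₀ h.ne']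

lemma fibreUnit_ne_zero (x : S) (s : sphere (0 : EuclideanSpace ℝ (Fin 2)) 1) :
    fibreUnit g x s ≠ 0 := by
  intro h
  have := metricAt_fibreUnit g x s
  rw [h] at this
  simp at this

lemma contMDiff_fibreUnit (x : S) :
    ContMDiff (𝓡 1) 𝓘(ℝ, EuclideanSpace ℝ (Fin 2)) ∞ (fibreUnit g x) := by
  intro s
  have hcoe : ContMDiffAt (𝓡 1) 𝓘(ℝ, EuclideanSpace ℝ (Fin 2)) ∞
      (fun s : sphere (0 : EuclideanSpace ℝ (Fin 2)) 1 => (s : EuclideanSpace ℝ (Fin 2))) s :=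
    contMDiff_coe_sphere s
  have h := metricAt_pos g x (sphere_coe_ne_zero s)
  have hG : ContDiffAt ℝ ∞ (fun v : EuclideanSpace ℝ (Fin 2) =>
      (√(metricAt g x v v))⁻¹ • v) s := by
    have h1 : ContDiffAt ℝ ∞ (fun v : EuclideanSpace ℝ (Fin 2) => metricAt g x v v)
        (s : EuclideanSpace ℝ (Fin 2)) :=
      ((metricAt g x).contDiff.clm_apply contDiff_id).contDiffAt
    exact ((h1.sqrt h.ne').inv (Real.sqrt_ne_zero'.mpr h)).smul contDiffAt_id
  exact ContMDiffAt.comp (g := fun v : EuclideanSpace ℝ (Fin 2) =>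
      (√(metricAt g x v v))⁻¹ • v) s hG.contMDiffAt hcoe

/-- The derivative of the unit vector along the fibre. -/
noncomputable def fibreVelocity (x : S) (s : sphere (0 : EuclideanSpace ℝ (Fin 2)) 1) :
    EuclideanSpace ℝ (Fin 1) →L[ℝ] EuclideanSpace ℝ (Fin 2) :=
  mfderiv (𝓡 1) 𝓘(ℝ, EuclideanSpace ℝ (Fin 2)) (fibreUnit g x) s

lemma hasMFDerivAt_fibreUnit (x : S) (s : sphere (0 : EuclideanSpace ℝ (Fin 2)) 1) :
    HasMFDerivAt (𝓡 1) 𝓘(ℝ, EuclideanSpace ℝ (Fin 2)) (fibreUnit g x) s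
      (fibreVelocity g x s) :=
  ((contMDiff_fibreUnit g x).mdifferentiableAt (by simp)).hasMFDerivAt

lemma metricAt_fibreUnit_fibreVelocity (x : S) (s : sphere (0 : EuclideanSpace ℝ (Fin 2)) 1)
    (η : EuclideanSpace ℝ (Fin 1)) :
    metricAt g x (fibreUnit g x s) (fibreVelocity g x s η) = 0 := by
  let b : EuclideanSpace ℝ (Fin 2) → ℝ := fun v => metricAt g x v v
  have hb : HasFDerivAt b (metricAt g x (fibreUnit g x s) +
      (metricAt g x).flip (fibreUnit g x s)) (fibreUnit g x s) := by
    have := (metricAt g x).hasFDerivAt (x := fibreUnit g x s) |>.clm_apply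
      (hasFDerivAt_id (fibreUnit g x s))
    refine this.congr_fderiv ?_
    ext v
    simp
  have h1 := hb.hasMFDerivAt.comp s (hasMFDerivAt_fibreUnit g x s)
  have h2 : b ∘ fibreUnit g x = fun _ => (1 : ℝ) := funext fun s' => metricAt_fibreUnit g x s'
  rw [h2] at h1
  have h3 := hasMFDerivAt_unique h1 (hasMFDerivAt_const 1 s)
  have h4 : (metricAt g x (fibreUnit g x s) + (metricAt g x).flip (fibreUnit g x s))
      (fibreVelocity g x s η) = 0 :=
    congrArg (fun T : EuclideanSpace ℝ (Fin 1) →L[ℝ] ℝ => T η) h3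
  rw [add_apply, ContinuousLinearMap.flip_apply, metricAt_symm g x (fibreVelocity g x s η)] at h4
  linarith

lemma fibreVelocity_injective (x : S) (s : sphere (0 : EuclideanSpace ℝ (Fin 2)) 1)
    {η : EuclideanSpace ℝ (Fin 1)} (h : fibreVelocity g x s η = 0) : η = 0 := by
  let R : EuclideanSpace ℝ (Fin 2) → EuclideanSpace ℝ (Fin 2) := fun v => ‖v‖⁻¹ • v
  have hR : DifferentiableAt ℝ R (fibreUnit g x s) :=
    (((contDiffAt_norm ℝ (n := 1) (fibreUnit_ne_zero g x s)).inv
      (norm_ne_zero_iff.mpr (fibreUnit_ne_zero g x s))).smul contDiffAt_id).differentiableAt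
      (by simp)
  have h1 := hR.hasFDerivAt.hasMFDerivAt.comp s (hasMFDerivAt_fibreUnit g x s)
  have h2 : R ∘ fibreUnit g x = fun s' : sphere (0 : EuclideanSpace ℝ (Fin 2)) 1 =>
      (s' : EuclideanSpace ℝ (Fin 2)) := by
    funext s'
    have hk : 0 < (√(metricAt g x s' s'))⁻¹ :=
      inv_pos.mpr (Real.sqrt_pos.mpr (metricAt_pos g x (sphere_coe_ne_zero s')))
    simp only [R, comp_apply, fibreUnit, norm_smul, Real.norm_of_nonneg hk.le]
    rw [norm_eq_of_mem_sphere, mul_one, smul_smul, inv_mul_cancel₀ hk.ne', one_smul]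
  rw [h2] at h1
  have h3 : Injective (mfderiv (𝓡 1) 𝓘(ℝ, EuclideanSpace ℝ (Fin 2))
      (fun s' : sphere (0 : EuclideanSpace ℝ (Fin 2)) 1 => (s' : EuclideanSpace ℝ (Fin 2))) s) :=
    injective_mvfderiv_subtypeVal_sphere s
  rw [h1.mfderiv] at h3
  refine h3 ?_
  change fderiv ℝ R (fibreUnit g x s) (fibreVelocity g x s η) =
    fderiv ℝ R (fibreUnit g x s) (fibreVelocity g x s 0)
  rw [h, map_zero, map_zero, map_zero]

/-- The vertical derivative of the image of the unit vector under an immersion. -/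
lemma mfderiv_rayUnitVector_vertical {n : ℕ} {ι : S → EuclideanSpace ℝ (Fin n)}
    {c : TangentCircleBundle S}
    (hF : MDifferentiableAt modelC 𝓘(ℝ, EuclideanSpace ℝ (Fin n))
      (fun c : TangentCircleBundle S =>
        (mfderiv (𝓡 2) 𝓘(ℝ, EuclideanSpace ℝ (Fin n)) ι c.1 (rayUnitVector g c) :
          EuclideanSpace ℝ (Fin n))) c) (η : EuclideanSpace ℝ (Fin 1)) :
    (mfderiv modelC 𝓘(ℝ, EuclideanSpace ℝ (Fin n)) (fun c : TangentCircleBundle S =>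
        (mfderiv (𝓡 2) 𝓘(ℝ, EuclideanSpace ℝ (Fin n)) ι c.1 (rayUnitVector g c) :
          EuclideanSpace ℝ (Fin n))) c ((0 : EuclideanSpace ℝ (Fin 2)), η) :
          EuclideanSpace ℝ (Fin n)) =
      mfderiv (𝓡 2) 𝓘(ℝ, EuclideanSpace ℝ (Fin n)) ι c.1 (fibreVelocity g c.1 c.2 η) := by
  obtain ⟨x, s⟩ := c
  change sphere (0 : EuclideanSpace ℝ (Fin 2)) 1 at s
  let A : EuclideanSpace ℝ (Fin 2) →L[ℝ] EuclideanSpace ℝ (Fin n) :=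
    mfderiv (𝓡 2) 𝓘(ℝ, EuclideanSpace ℝ (Fin n)) ι x
  have h1 := hF.hasMFDerivAt.comp (x := (s : sphere (0 : EuclideanSpace ℝ (Fin 2)) 1))
    (f := fun s' : sphere (0 : EuclideanSpace ℝ (Fin 2)) 1 => (⟨x, s'⟩ : TangentCircleBundle S))
    (hasMFDerivAt_circleBundle_fibre x s)
  have h2 := A.hasFDerivAt.hasMFDerivAt.comp (x := s) (hasMFDerivAt_fibreUnit g x s)
  exact congrArg (fun T : EuclideanSpace ℝ (Fin 1) →L[ℝ] EuclideanSpace ℝ (Fin n) => T η)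
    (hasMFDerivAt_unique h1 h2)

lemma contMDiff_polarMap :
    ContMDiff modelCR ((𝓡 2).prod 𝓘(ℝ, EuclideanSpace ℝ (Fin 2) →L[ℝ] ℝ)) ∞ (polarMap g) := by
  have hu := (contMDiff_rayUnitVector g).comp
    (contMDiff_fst (I := modelC) (J := 𝓘(ℝ, ℝ)) (M := TangentCircleBundle S) (N := ℝ))
  have hg := g.contMDiff.comp ((contMDiff_circleBundle_proj (S := S)).comp
    (contMDiff_fst (I := modelC) (J := 𝓘(ℝ, ℝ)) (M := TangentCircleBundle S) (N := ℝ)))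
  have h1 : ContMDiff modelCR ((𝓡 2).prod 𝓘(ℝ, EuclideanSpace ℝ (Fin 2) →L[ℝ] ℝ)) ∞
      (fun p : TangentCircleBundle S × ℝ =>
        (⟨p.1.1, g.inner p.1.1 (rayUnitVector g p.1)⟩ : CotangentBundle (𝓡 2) S)) :=
    ContMDiff.clm_bundle_apply (E₂ := fun x : S => TangentSpace (𝓡 2) x →L[ℝ] ℝ) hg hu
  intro p₀
  have h2 := contMDiffAt_totalSpace.mp (h1 p₀)
  refine contMDiffAt_totalSpace.mpr ⟨h2.1, ?_⟩
  have hexp : ContMDiffAt modelCR 𝓘(ℝ, ℝ) ∞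
      (fun p : TangentCircleBundle S × ℝ => Real.exp p.2) p₀ :=
    (Real.contDiff_exp.contMDiff.comp contMDiff_snd).contMDiffAt
  refine (hexp.smul h2.2).congr_of_eventuallyEq (Filter.Eventually.of_forall fun p => ?_)
  let e := trivializationAt (EuclideanSpace ℝ (Fin 2) →L[ℝ] ℝ)
    (fun x : S => TangentSpace (𝓡 2) x →L[ℝ] ℝ) p₀.1.1
  change (e (⟨p.1.1, g.inner p.1.1 (Real.exp p.2 • rayUnitVector g p.1)⟩ :
      CotangentBundle (𝓡 2) S)).2 = Real.exp p.2 •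
    (e (⟨p.1.1, g.inner p.1.1 (rayUnitVector g p.1)⟩ : CotangentBundle (𝓡 2) S)).2
  rw [trivializationAt_cotangent_apply, trivializationAt_cotangent_apply]
  ext v
  simp

lemma hasMFDerivAt_proj_fst (p : TangentCircleBundle S × ℝ) :
    HasMFDerivAt modelCR (𝓡 2) (fun p : TangentCircleBundle S × ℝ => p.1.1) p
      ((ContinuousLinearMap.fst ℝ (EuclideanSpace ℝ (Fin 2)) (EuclideanSpace ℝ (Fin 1))).comp
        (ContinuousLinearMap.fst ℝ (EuclideanSpace ℝ (Fin 2) × EuclideanSpace ℝ (Fin 1)) ℝ)) :=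
  (hasMFDerivAt_circleBundle_proj p.1).comp p (hasMFDerivAt_fst p)

lemma mfderiv_polarMap_fst (p : TangentCircleBundle S × ℝ)
    (w : (EuclideanSpace ℝ (Fin 2) × EuclideanSpace ℝ (Fin 1)) × ℝ) :
    (mfderiv modelCR ((𝓡 2).prod 𝓘(ℝ, EuclideanSpace ℝ (Fin 2) →L[ℝ] ℝ)) (polarMap g) p w :
      EuclideanSpace ℝ (Fin 2) × (EuclideanSpace ℝ (Fin 2) →L[ℝ] ℝ)).1 = w.1.1 := by
  have h1 := (hasMFDerivAt_cotangent_proj (polarMap g p)).comp p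
    ((contMDiff_polarMap g).mdifferentiableAt (by simp)).hasMFDerivAt
  exact congrArg (fun T : (EuclideanSpace ℝ (Fin 2) × EuclideanSpace ℝ (Fin 1)) × ℝ →L[ℝ]
    EuclideanSpace ℝ (Fin 2) => T w) (hasMFDerivAt_unique h1 (hasMFDerivAt_proj_fst p))

lemma mfderiv_polarMap_vertical (c : TangentCircleBundle S) (t : ℝ)
    (η : EuclideanSpace ℝ (Fin 1)) :
    (mfderiv modelCR ((𝓡 2).prod 𝓘(ℝ, EuclideanSpace ℝ (Fin 2) →L[ℝ] ℝ)) (polarMap g) (c, t)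
      (((0 : EuclideanSpace ℝ (Fin 2)), η), (0 : ℝ)) :
      EuclideanSpace ℝ (Fin 2) × (EuclideanSpace ℝ (Fin 2) →L[ℝ] ℝ)) =
      (0, metricAt g c.1 (Real.exp t • fibreVelocity g c.1 c.2 η)) := by
  obtain ⟨x, s⟩ := c
  change sphere (0 : EuclideanSpace ℝ (Fin 2)) 1 at s
  let A : EuclideanSpace ℝ (Fin 2) →L[ℝ] (EuclideanSpace ℝ (Fin 2) →L[ℝ] ℝ) :=
    Real.exp t • metricAt g x
  have hP := ((contMDiff_polarMap g).mdifferentiableAt (by simp)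
    (x := ((⟨x, s⟩ : TangentCircleBundle S), t))).hasMFDerivAt
  have h1 := hP.comp (x := (s : sphere (0 : EuclideanSpace ℝ (Fin 2)) 1))
    (f := fun s' : sphere (0 : EuclideanSpace ℝ (Fin 2)) 1 =>
      ((⟨x, s'⟩ : TangentCircleBundle S), t))
    ((hasMFDerivAt_circleBundle_fibre x s).prodMk (hasMFDerivAt_const t s))
  have h2 := (hasMFDerivAt_cotangent_fibre (I := 𝓡 2) x (A (fibreUnit g x s))).comp s
    (A.hasFDerivAt.hasMFDerivAt.comp (x := s) (hasMFDerivAt_fibreUnit g x s))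
  have h3 : (polarMap g ∘ fun s' : sphere (0 : EuclideanSpace ℝ (Fin 2)) 1 =>
      ((⟨x, s'⟩ : TangentCircleBundle S), t)) =
      ((fun η : EuclideanSpace ℝ (Fin 2) →L[ℝ] ℝ => (⟨x, η⟩ : CotangentBundle (𝓡 2) S)) ∘
        (A ∘ fibreUnit g x)) := by
    funext s'
    refine congrArg (TotalSpace.mk x) ?_
    change metricAt g x (Real.exp t • fibreUnit g x s') = Real.exp t • _
    rw [map_smul]
    rfl
  rw [h3] at h1
  have h4 := congrArg (fun T : EuclideanSpace ℝ (Fin 1) →L[ℝ]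
    EuclideanSpace ℝ (Fin 2) × (EuclideanSpace ℝ (Fin 2) →L[ℝ] ℝ) => T η)
    (hasMFDerivAt_unique h1 h2)
  refine h4.trans ?_
  change ((0 : EuclideanSpace ℝ (Fin 2)), Real.exp t • metricAt g x (fibreVelocity g x s η)) = _
  rw [map_smul]

lemma mfderiv_polarMap_radial (c : TangentCircleBundle S) (t : ℝ) :
    (mfderiv modelCR ((𝓡 2).prod 𝓘(ℝ, EuclideanSpace ℝ (Fin 2) →L[ℝ] ℝ)) (polarMap g) (c, t)
      ((0 : EuclideanSpace ℝ (Fin 2) × EuclideanSpace ℝ (Fin 1)), (1 : ℝ)) :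
      EuclideanSpace ℝ (Fin 2) × (EuclideanSpace ℝ (Fin 2) →L[ℝ] ℝ)) =
      (0, metricAt g c.1 (Real.exp t • fibreUnit g c.1 c.2)) := by
  obtain ⟨x, s⟩ := c
  change sphere (0 : EuclideanSpace ℝ (Fin 2)) 1 at s
  have hP := ((contMDiff_polarMap g).mdifferentiableAt (by simp)
    (x := ((⟨x, s⟩ : TangentCircleBundle S), t))).hasMFDerivAt
  have h1 := hP.comp (x := t) (f := fun t' : ℝ => ((⟨x, s⟩ : TangentCircleBundle S), t'))
    ((hasMFDerivAt_const (⟨x, s⟩ : TangentCircleBundle S) t).prodMk (hasMFDerivAt_id t))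
  have hl : HasFDerivAt (fun t' : ℝ => metricAt g x (Real.exp t' • fibreUnit g x s))
      ((metricAt g x).comp ((ContinuousLinearMap.toSpanSingleton ℝ (Real.exp t)).smulRight
        (fibreUnit g x s))) t :=
    (metricAt g x).hasFDerivAt.comp t
      ((Real.hasDerivAt_exp t).hasFDerivAt.smul_const (fibreUnit g x s))
  have h2 := (hasMFDerivAt_cotangent_fibre (I := 𝓡 2) x
    (metricAt g x (Real.exp t • fibreUnit g x s))).comp t hl.hasMFDerivAt
  have h4 := congrArg (fun T : ℝ →L[ℝ]
    EuclideanSpace ℝ (Fin 2) × (EuclideanSpace ℝ (Fin 2) →L[ℝ] ℝ) => T 1)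
    (hasMFDerivAt_unique h1 h2)
  refine h4.trans ?_
  change ((0 : EuclideanSpace ℝ (Fin 2)),
    metricAt g x (((1 : ℝ) • Real.exp t) • fibreUnit g x s)) = _
  rw [one_smul]

lemma magneticForm_of_vertical (τ : BilinForm (𝓡 2) S) (p : TangentCircleBundle S × ℝ)
    {u : (EuclideanSpace ℝ (Fin 2) × EuclideanSpace ℝ (Fin 1)) × ℝ} (hu : u.1.1 = 0)
    {ξ : EuclideanSpace ℝ (Fin 2)}
    (h : (mfderiv modelCR ((𝓡 2).prod 𝓘(ℝ, EuclideanSpace ℝ (Fin 2) →L[ℝ] ℝ)) (polarMap g) p u :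
      EuclideanSpace ℝ (Fin 2) × (EuclideanSpace ℝ (Fin 2) →L[ℝ] ℝ)) = (0, metricAt g p.1.1 ξ))
    (w : (EuclideanSpace ℝ (Fin 2) × EuclideanSpace ℝ (Fin 1)) × ℝ) :
    magneticForm g τ p u w = metricAt g p.1.1 ξ w.1.1 := by
  have h1 : pullbackBilin (I := modelCR) (polarMap g) (cotangentForm (𝓡 2) S) p u w =
      metricAt g p.1.1 ξ w.1.1 := by
    refine (cotangentForm_apply (polarMap g p) _ _).trans ?_
    have h2 := mfderiv_polarMap_fst g p w
    have key : ∀ a b : EuclideanSpace ℝ (Fin 2) × (EuclideanSpace ℝ (Fin 2) →L[ℝ] ℝ),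
        a = (0, metricAt g p.1.1 ξ) → b.1 = w.1.1 →
        a.2 b.1 - b.2 a.1 = metricAt g p.1.1 ξ w.1.1 := by
      rintro _ b rfl hb
      simp [hb]
    exact key _ _ h h2
  have h2 : pullbackBilin (I := modelCR) (fun p : TangentCircleBundle S × ℝ => p.1.1) τ p u w = 0 := by
    unfold pullbackBilin
    rw [(hasMFDerivAt_proj_fst p).mfderiv]
    change τ p.1.1 u.1.1 w.1.1 = 0
    rw [hu]
    exact congrArg (fun T : EuclideanSpace ℝ (Fin 2) →L[ℝ] ℝ => T w.1.1) (map_zero (τ p.1.1))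
  change pullbackBilin (I := modelCR) (polarMap g) (cotangentForm (𝓡 2) S) p u w +
    pullbackBilin (I := modelCR) (fun p : TangentCircleBundle S × ℝ => p.1.1) τ p u w = _
  rw [h1, h2, add_zero]

end Vertical

/-! ### The metric induced by an immersion and the coframe of the circle bundle -/

section VectorDeriv

variable {E : Type*} [NormedAddCommGroup E] [NormedSpace ℝ E]
  {H : Type*} [TopologicalSpace H] {I : ModelWithCorners ℝ E H}
  {M : Type*} [TopologicalSpace M] [ChartedSpace H M]
  {F : Type*} [NormedAddCommGroup F] [NormedSpace ℝ F]

/-- The derivative of a map to a vector space, in the model spaces. -/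
noncomputable def vectorDeriv (I : ModelWithCorners ℝ E H) (ι : M → F) (x : M) : E →L[ℝ] F :=
  mfderiv I 𝓘(ℝ, F) ι x

variable [IsManifold I ∞ M]

lemma contMDiff_vectorDeriv {ι : M → F} (hι : ContMDiff I 𝓘(ℝ, F) ∞ ι) :
    ContMDiff I.tangent 𝓘(ℝ, F) ∞ (fun v : TangentBundle I M => vectorDeriv I ι v.1 v.2) :=
  (contMDiff_snd_tangentBundle_modelSpace F 𝓘(ℝ, F)).comp
    (hι.contMDiff_tangentMap (m := ∞) (by simp))

end VectorDeriv

section InducedMetric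

variable {E : Type*} [NormedAddCommGroup E] [NormedSpace ℝ E]
  {H : Type*} [TopologicalSpace H] {I : ModelWithCorners ℝ E H}
  {M : Type*} [TopologicalSpace M] [ChartedSpace H M]
  {F : Type*} [NormedAddCommGroup F] [InnerProductSpace ℝ F]

lemma isBounded_of_injective [FiniteDimensional ℝ E] {A : E →L[ℝ] F} (hA : Injective A) :
    Bornology.IsBounded {v : E | inner ℝ (A v) (A v) < 1} := by
  obtain ⟨K, -, hK⟩ := (A : E →ₗ[ℝ] F).exists_antilipschitzWith (LinearMap.ker_eq_bot.mpr hA)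
  refine isBounded_iff_forall_norm_le.mpr ⟨K, fun v hv => ?_⟩
  have h1 : ‖A v‖ ≤ 1 := by
    have : ‖A v‖ ^ 2 < 1 := by rw [← real_inner_self_eq_norm_sq]; exact hv
    nlinarith [norm_nonneg (A v)]
  have h2 := hK.le_mul_dist v 0
  rw [map_zero, dist_zero_right, dist_zero_right] at h2
  exact h2.trans (mul_le_of_le_one_right K.2 h1)

variable [IsManifold I ∞ M]

lemma isSmoothFamily_vectorDeriv [FiniteDimensional ℝ E] {ι : M → F} (hι : ContMDiff I 𝓘(ℝ, F) ∞ ι) :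
    IsSmoothFamily I (F := F) (fun x : M => x)
      (fun x => (mfderiv I 𝓘(ℝ, F) ι x)) :=
  isSmoothFamily_of_tangentBundle (contMDiff_vectorDeriv hι)

/-- The Riemannian metric induced by an immersion in a Euclidean space. -/
noncomputable def inducedMetric [FiniteDimensional ℝ E] {ι : M → F} (hι : ContMDiff I 𝓘(ℝ, F) ∞ ι)
    (hinj : ∀ x, Injective (mfderiv I 𝓘(ℝ, F) ι x)) :
    ContMDiffRiemannianMetric I ∞ E (fun x : M => TangentSpace I x) where
  inner x := ((innerSL ℝ).bilinearComp (vectorDeriv I ι x) (vectorDeriv I ι x) :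
    E →L[ℝ] E →L[ℝ] ℝ)
  symm x v w := real_inner_comm (vectorDeriv I ι x w) (vectorDeriv I ι x v)
  pos x v hv := by
    refine real_inner_self_pos.mpr fun h => hv (hinj x ?_)
    exact h.trans (map_zero (vectorDeriv I ι x)).symm
  isVonNBounded x := by
    have := NormedSpace.isVonNBounded_iff (𝕜 := ℝ).mpr (isBounded_of_injective
      (A := vectorDeriv I ι x) (hinj x))
    exact this
  contMDiff := by
    intro x₀
    refine contMDiffAt_totalSpace.mpr ⟨contMDiffAt_id, ?_⟩
    refine contMDiffAt_clm_of_apply fun v => contMDiffAt_clm_of_apply fun w => ?_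
    let e := trivializationAt E (TangentSpace I) x₀
    have hL := isSmoothFamily_vectorDeriv hι x₀
    refine ((contDiff_inner (𝕜 := ℝ)).contMDiff.contMDiffAt.comp x₀
      ((hL.clm_apply (contMDiffAt_const (c := v))).prodMk_space
      (hL.clm_apply (contMDiffAt_const (c := w))))).congr_of_eventuallyEq ?_
    filter_upwards [e.open_baseSet.mem_nhds
      (FiberBundle.mem_baseSet_trivializationAt' x₀)] with x hx
    have key : ∀ f : TangentSpace I x →L[ℝ] ℝ,
        ((trivializationAt (E →L[ℝ] ℝ) (fun x : M => TangentSpace I x →L[ℝ] ℝ)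
          x₀).continuousLinearMapAt ℝ x f : E →L[ℝ] ℝ) = f.comp (e.symmL ℝ x) := by
      intro f
      rw [Trivialization.continuousLinearMapAt_apply_of_mem (R := ℝ) _
        (by rw [hom_trivializationAt_baseSet]; exact ⟨hx, mem_univ _⟩)]
      exact trivializationAt_cotangent_apply x₀ (⟨x, f⟩ : CotangentBundle I M)
    rw [hom_trivializationAt_apply]
    exact congrArg (fun T : E →L[ℝ] ℝ => T w) (key _)

end InducedMetric

section Coframe

variable {V W : Type*} [NormedAddCommGroup V] [NormedSpace ℝ V] [FiniteDimensional ℝ V]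
  [NormedAddCommGroup W] [NormedSpace ℝ W] [FiniteDimensional ℝ W]

lemma exists_continuousLinearEquiv_of_injective (L : V →L[ℝ] W) (hL : ∀ v, L v = 0 → v = 0)
    (hd : Module.finrank ℝ V = Module.finrank ℝ W) :
    ∃ e : V ≃L[ℝ] W, (e : V →L[ℝ] W) = L := by
  refine ⟨(LinearMap.linearEquivOfInjective (L : V →ₗ[ℝ] W)
    ((injective_iff_map_eq_zero _).mpr hL) hd).toContinuousLinearEquiv, ?_⟩
  ext v
  rfl

variable {S : Type*} [TopologicalSpace S] [ChartedSpace (EuclideanSpace ℝ (Fin 2)) S]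
  [IsManifold (𝓡 2) ∞ S]
  (g : ContMDiffRiemannianMetric (𝓡 2) ∞ (EuclideanSpace ℝ (Fin 2))
      (fun x : S => TangentSpace (𝓡 2) x))

/-- In a plane, a nonzero vector is detected by an inner product and an area form. -/
lemma eq_zero_of_plane {G σ : EuclideanSpace ℝ (Fin 2) →L[ℝ] EuclideanSpace ℝ (Fin 2) →L[ℝ] ℝ}
    (hG : ∀ v, v ≠ 0 → 0 < G v v)
    (hσ : ∀ v, σ v v = 0) (hσ' : ∀ u, (∀ v, σ u v = 0) → u = 0)
    {u v : EuclideanSpace ℝ (Fin 2)} (hu : u ≠ 0) (h1 : G u v = 0) (h2 : σ u v = 0) : v = 0 := by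
  by_contra hv
  have hli : LinearIndependent ℝ ![u, v] := by
    rw [LinearIndependent.pair_iff]
    intro s t hst
    have h3 : G u (s • u + t • v) = 0 := by rw [hst, map_zero]
    rw [map_add, map_smul, map_smul, h1, smul_zero, add_zero, smul_eq_mul] at h3
    have hs : s = 0 := (mul_eq_zero.mp h3).resolve_right (hG u hu).ne'
    rw [hs, zero_smul, zero_add] at hst
    exact ⟨hs, (smul_eq_zero.mp hst).resolve_right hv⟩
  have hspan := hli.span_eq_top_of_card_eq_finrank (by simp)
  refine hu (hσ' u fun w => ?_)
  have hw : w ∈ Submodule.span ℝ (range ![u, v]) := hspan ▸ Submodule.mem_top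
  rw [Matrix.range_cons, Matrix.range_cons, Matrix.range_empty, union_empty,
    singleton_union, Submodule.mem_span_pair] at hw
  obtain ⟨a, b, rfl⟩ := hw
  rw [map_add, map_smul, map_smul, hσ, h2, smul_zero, smul_zero, add_zero]

/-- The pair of forms `g(u, ·)`, `σ(u, ·)`. -/
lemma exists_pairEquiv {σ : BilinForm (𝓡 2) S} (hσ : IsSmoothTwoForm σ)
    (hσ' : IsNondegenerateBilin σ) :
    ∃ L : ∀ c : TangentCircleBundle S, TangentSpace (𝓡 2) c.1 ≃L[ℝ] ℝ × ℝ,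
      IsSmoothFamily modelC (fun c : TangentCircleBundle S => c.1)
        (fun c => (L c : TangentSpace (𝓡 2) c.1 →L[ℝ] ℝ × ℝ)) ∧
      (∀ c (v : EuclideanSpace ℝ (Fin 2)),
        (L c v).1 = metricAt g c.1 (fibreUnit g c.1 c.2) v) ∧
      ∀ c, L c (fibreUnit g c.1 c.2) = (1, 0) := by
  have hex : ∀ c : TangentCircleBundle S, ∃ L : TangentSpace (𝓡 2) c.1 ≃L[ℝ] ℝ × ℝ,
      (L : TangentSpace (𝓡 2) c.1 →L[ℝ] ℝ × ℝ) =
        (g.inner c.1 (rayUnitVector g c)).prod (σ c.1 (rayUnitVector g c)) := by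
    intro c
    refine exists_continuousLinearEquiv_of_injective (V := EuclideanSpace ℝ (Fin 2))
      (W := ℝ × ℝ) ((metricAt g c.1 (fibreUnit g c.1 c.2)).prod (σ c.1 (rayUnitVector g c)))
      (fun v hv => ?_) (by simp)
    exact eq_zero_of_plane (G := metricAt g c.1) (σ := σ c.1)
      (fun v => metricAt_pos g c.1) (hσ.1 c.1) (hσ' c.1) (fibreUnit_ne_zero g c.1 c.2)
      (congrArg Prod.fst hv) (congrArg Prod.snd hv)
  choose L hL using hex
  refine ⟨L, ?_, fun c v => congrArg (fun T : EuclideanSpace ℝ (Fin 2) →L[ℝ] ℝ × ℝ =>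
    (T v).1) (hL c), fun c => ?_⟩
  rotate_left
  · refine (congrArg (fun T : EuclideanSpace ℝ (Fin 2) →L[ℝ] ℝ × ℝ =>
      T (fibreUnit g c.1 c.2)) (hL c)).trans ?_
    exact Prod.ext (metricAt_fibreUnit g c.1 c.2) (hσ.1 c.1 (rayUnitVector g c))
  have hp := contMDiff_circleBundle_proj (S := S)
  have hu := contMDiff_rayUnitVector g
  simp only [hL]
  refine IsSmoothFamily.prod ?_ ?_
  · exact (isSmoothFamily_iff_hom hp).mpr (ContMDiff.clm_bundle_apply
      (E₂ := fun x : S => TangentSpace (𝓡 2) x →L[ℝ] ℝ) (g.contMDiff.comp hp) hu)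
  · exact (isSmoothFamily_iff_hom hp).mpr (ContMDiff.clm_bundle_apply
      (E₂ := fun x : S => TangentSpace (𝓡 2) x →L[ℝ] ℝ) (hσ.2.comp hp) hu)

/-- A smooth coframe of the circle bundle adapted to the metric. -/
lemma exists_circleFrame [T2Space S] [CompactSpace S] {σ : BilinForm (𝓡 2) S}
    (hσ : IsSmoothTwoForm σ) (hσ' : IsNondegenerateBilin σ) :
    ∃ Φ : ∀ c : TangentCircleBundle S, TangentSpace modelC c ≃L[ℝ] ℝ × ℝ × ℝ,
      IsSmoothFrame Φ ∧
      (∀ c (w : EuclideanSpace ℝ (Fin 2) × EuclideanSpace ℝ (Fin 1)),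
        (Φ c w).1 = metricAt g c.1 (fibreUnit g c.1 c.2) w.1) ∧
      ∀ c, ∃ η : EuclideanSpace ℝ (Fin 1),
        (Φ c).symm (0, 0, 1) = ((0 : EuclideanSpace ℝ (Fin 2)), η) ∧
        ∃ μ : ℝ, 0 < μ ∧ ∀ w : EuclideanSpace ℝ (Fin 2) × EuclideanSpace ℝ (Fin 1),
          metricAt g c.1 (fibreVelocity g c.1 c.2 η) w.1 = μ * (Φ c w).2.1 := by
  obtain ⟨n, ι, hι, -, hinj⟩ := exists_embedding_euclidean_of_compact (I := 𝓡 2) (M := S)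
  obtain ⟨L, hLs, hL, hLu⟩ := exists_pairEquiv g hσ hσ'
  have hp := contMDiff_circleBundle_proj (S := S)
  have hu := contMDiff_rayUnitVector g
  let h : ∀ c : TangentCircleBundle S, EuclideanSpace ℝ (Fin 2) := fun c => (L c).symm (0, 1)
  have hh : ContMDiff modelC (𝓡 2).tangent ∞ (fun c : TangentCircleBundle S =>
      (⟨c.1, h c⟩ : TangentBundle (𝓡 2) S)) :=
    (IsSmoothFamily.symm hp hLs).comp (contMDiff_id.prodMk contMDiff_const)
  have hLh : ∀ c, L c (h c) = (0, 1) := fun c => (L c).apply_symm_apply _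
  let F : TangentCircleBundle S → EuclideanSpace ℝ (Fin n) := fun c =>
    vectorDeriv (𝓡 2) ι c.1 (rayUnitVector g c)
  have hF : ContMDiff modelC 𝓘(ℝ, EuclideanSpace ℝ (Fin n)) ∞ F :=
    (contMDiff_vectorDeriv hι).comp hu
  let Y : TangentCircleBundle S → EuclideanSpace ℝ (Fin n) := fun c =>
    vectorDeriv (𝓡 2) ι c.1 (h c)
  have hY : ContMDiff modelC 𝓘(ℝ, EuclideanSpace ℝ (Fin n)) ∞ Y :=
    (contMDiff_vectorDeriv hι).comp hh
  have hYpos : ∀ c, 0 < inner ℝ (Y c) (Y c) := by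
    intro c
    refine real_inner_self_pos.mpr fun h0 => ?_
    have h1 : h c = 0 := hinj c.1 (h0.trans (map_zero (vectorDeriv (𝓡 2) ι c.1)).symm)
    have h2 := hLh c
    rw [h1] at h2
    have h3 := h2.symm.trans (map_zero (L c))
    simp at h3
  let L' : ∀ c : TangentCircleBundle S, EuclideanSpace ℝ (Fin 2) →L[ℝ] ℝ × ℝ :=
    fun c => (L c : TangentSpace (𝓡 2) c.1 →L[ℝ] ℝ × ℝ)
  let Λ : ∀ c : TangentCircleBundle S,
      EuclideanSpace ℝ (Fin 2) × EuclideanSpace ℝ (Fin 1) →L[ℝ] (ℝ × ℝ) × ℝ := fun c =>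
    ((L' c).comp
      (ContinuousLinearMap.fst ℝ (EuclideanSpace ℝ (Fin 2)) (EuclideanSpace ℝ (Fin 1)))).prod
      ((innerSL ℝ (Y c)).comp (vectorDeriv modelC F c))
  -- vertical vectors
  have hvert : ∀ c (η : EuclideanSpace ℝ (Fin 1)), ∃ m : ℝ,
      fibreVelocity g c.1 c.2 η = m • h c ∧
      Λ c ((0 : EuclideanSpace ℝ (Fin 2)), η) = (0, m * inner ℝ (Y c) (Y c)) := by
    intro c η
    let q := fibreVelocity g c.1 c.2 η
    have hq : q = (L c q).2 • h c := by
      refine (L c).injective ?_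
      have h1 : (L c q).1 = 0 := (hL c q).trans (metricAt_fibreUnit_fibreVelocity g c.1 c.2 η)
      have h2 : L c ((L c q).2 • h c) = (L c q).2 • ((0 : ℝ), (1 : ℝ)) :=
        (map_smul (L c) _ _).trans (congrArg _ (hLh c))
      refine Eq.trans ?_ h2.symm
      refine Prod.ext ?_ ?_
      · simpa using h1
      · simp
    refine ⟨(L c q).2, hq, Prod.ext (map_zero (L c)) ?_⟩
    have h3 := mfderiv_rayUnitVector_vertical g (ι := ι) (c := c)
      (hF.mdifferentiableAt (by simp)) η
    have h4 : vectorDeriv modelC F c ((0 : EuclideanSpace ℝ (Fin 2)), η) =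
        (L c q).2 • Y c := by
      refine h3.trans ?_
      change vectorDeriv (𝓡 2) ι c.1 q = _
      rw [← map_smul, ← hq]
    change inner ℝ (Y c) (vectorDeriv modelC F c ((0 : EuclideanSpace ℝ (Fin 2)), η)) = _
    rw [h4, real_inner_smul_right]
  have hΛinj : ∀ c w, Λ c w = 0 → w = 0 := by
    rintro c ⟨v, η⟩ hw
    have hv : v = 0 := by
      have h1 : L c v = 0 := congrArg Prod.fst hw
      exact (map_eq_zero_iff (L c) (L c).injective).mp h1
    subst hv
    obtain ⟨m, hm, hm'⟩ := hvert c η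
    rw [hm'] at hw
    have hm0 : m = 0 := (mul_eq_zero.mp (congrArg Prod.snd hw)).resolve_right (hYpos c).ne'
    rw [hm0, zero_smul] at hm
    rw [fibreVelocity_injective g c.1 c.2 hm]
    rfl
  have hex : ∀ c, ∃ Φ : (EuclideanSpace ℝ (Fin 2) × EuclideanSpace ℝ (Fin 1)) ≃L[ℝ] (ℝ × ℝ) × ℝ,
      (Φ : EuclideanSpace ℝ (Fin 2) × EuclideanSpace ℝ (Fin 1) →L[ℝ] (ℝ × ℝ) × ℝ) = Λ c :=
    fun c => exists_continuousLinearEquiv_of_injective (Λ c) (hΛinj c) (by simp)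
  choose Φ hΦ using hex
  have hΦ' : ∀ c w, Φ c w = Λ c w := fun c w => congrArg (fun T :
    EuclideanSpace ℝ (Fin 2) × EuclideanSpace ℝ (Fin 1) →L[ℝ] (ℝ × ℝ) × ℝ => T w) (hΦ c)
  let A := ContinuousLinearEquiv.prodAssoc ℝ ℝ ℝ ℝ
  let Ψ : ∀ c : TangentCircleBundle S, TangentSpace modelC c ≃L[ℝ] ℝ × ℝ × ℝ :=
    fun c => (Φ c).trans A
  have hΨ : ∀ c (w : EuclideanSpace ℝ (Fin 2) × EuclideanSpace ℝ (Fin 1)),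
      Ψ c w = A (Λ c w) := fun c w => congrArg A (hΦ' c w)
  refine ⟨Ψ, ?_, fun c w => ?_, fun c => ?_⟩
  · have h1 : ContMDiff modelC.tangent 𝓘(ℝ, ℝ × ℝ) ∞
        (fun v : TangentBundle modelC (TangentCircleBundle S) =>
          L v.1 (mfderiv modelC (𝓡 2) (fun c : TangentCircleBundle S => c.1) v.1 v.2)) :=
      (hLs.comp (contMDiff_proj (n := ∞) (IB := modelC)
        (TangentSpace modelC (M := TangentCircleBundle S)))).apply
        (hp.contMDiff_tangentMap (m := ∞) (by simp))
    have h2 : ContMDiff modelC.tangent 𝓘(ℝ, ℝ) ∞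
        (fun v : TangentBundle modelC (TangentCircleBundle S) =>
          inner ℝ (Y v.1) (vectorDeriv modelC F v.1 v.2)) :=
      (contDiff_inner (𝕜 := ℝ)).contMDiff.comp
        ((hY.comp (contMDiff_proj (n := ∞) (IB := modelC)
          (TangentSpace modelC (M := TangentCircleBundle S)))).prodMk_space
            (contMDiff_vectorDeriv hF))
    refine (A.contDiff.contMDiff.comp (h1.prodMk_space h2)).congr fun v => ?_
    refine (hΨ v.1 v.2).trans (congrArg A (Prod.ext ?_ rfl))
    exact congrArg (fun T : EuclideanSpace ℝ (Fin 2) × EuclideanSpace ℝ (Fin 1) →L[ℝ]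
      EuclideanSpace ℝ (Fin 2) => L v.1 (T v.2)) (hasMFDerivAt_circleBundle_proj v.1).mfderiv.symm
  · exact (congrArg (fun z : ℝ × ℝ × ℝ => z.1) (hΨ c w)).trans (hL c w.1)
  · let w₀ : EuclideanSpace ℝ (Fin 2) × EuclideanSpace ℝ (Fin 1) := (Ψ c).symm (0, 0, 1)
    have hw₀ : Λ c w₀ = ((0, 0), 1) := by
      refine A.injective ((hΨ c w₀).symm.trans ?_)
      exact (Ψ c).apply_symm_apply _
    have hv : w₀.1 = 0 := by
      have h1 : L c w₀.1 = 0 := congrArg Prod.fst hw₀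
      exact (map_eq_zero_iff (L c) (L c).injective).mp h1
    have hw : w₀ = ((0 : EuclideanSpace ℝ (Fin 2)), w₀.2) := Prod.ext hv rfl
    obtain ⟨m, hm, hm'⟩ := hvert c w₀.2
    rw [← hw, hw₀] at hm'
    have hm1 : 1 = m * inner ℝ (Y c) (Y c) := congrArg Prod.snd hm'
    have hmpos : 0 < m := by
      by_contra hle
      have := mul_nonpos_of_nonpos_of_nonneg (not_lt.mp hle) (hYpos c).le
      linarith
    have hne : h c ≠ 0 := by
      intro h0
      have h2 := hLh c
      rw [h0] at h2
      have h3 := h2.symm.trans (map_zero (L c))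
      simp at h3
    refine ⟨w₀.2, hw, m * metricAt g c.1 (h c) (h c),
      mul_pos hmpos (metricAt_pos g c.1 hne), fun w => ?_⟩
    have hgu : metricAt g c.1 (h c) (fibreUnit g c.1 c.2) = 0 := by
      rw [metricAt_symm, ← hL, hLh]
    have hdec : w.1 = (L c w.1).1 • fibreUnit g c.1 c.2 + (L c w.1).2 • h c := by
      refine (L c).injective ?_
      have h2 : ∀ (a b : ℝ), L c (a • fibreUnit g c.1 c.2 + b • h c) =
          a • ((1 : ℝ), (0 : ℝ)) + b • ((0 : ℝ), (1 : ℝ)) := fun a b =>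
        ((map_add (L c) _ _).trans (congrArg₂ _ (map_smul (L c) _ _) (map_smul (L c) _ _))).trans
          (by rw [hLh, hLu])
      refine Eq.trans ?_ (h2 _ _).symm
      refine Prod.ext ?_ ?_ <;> simp
    have hβ : (Ψ c w).2.1 = (L c w.1).2 := congrArg (fun z : ℝ × ℝ × ℝ => z.2.1) (hΨ c w)
    rw [hβ, hm, map_smul]
    conv_lhs => rw [hdec]
    rw [map_add, map_smul, map_smul, smul_apply, smul_apply, hgu]
    simp only [smul_eq_mul]
    ring

end Coframe

/-! ### Pulling back under diffeomorphisms -/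

section Pullback

variable {E : Type*} [NormedAddCommGroup E] [NormedSpace ℝ E]
  {H : Type*} [TopologicalSpace H] {I : ModelWithCorners ℝ E H}
  {M : Type*} [TopologicalSpace M] [ChartedSpace H M]
  {E' : Type*} [NormedAddCommGroup E'] [NormedSpace ℝ E']
  {H' : Type*} [TopologicalSpace H'] {I' : ModelWithCorners ℝ E' H'}
  {M' : Type*} [TopologicalSpace M'] [ChartedSpace H' M']
  (φ : M ≃ₘ^∞⟮I, I'⟯ M')

lemma mfderiv_symm_mfderiv (x : M) (v : TangentSpace I x) :
    (mfderiv I' I φ.symm (φ x) (mfderiv I I' φ x v) : E) = v := by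
  have h1 : HasMFDerivAt I' I φ.symm (φ x) (mfderiv I' I φ.symm (φ x)) :=
    (φ.symm.contMDiff.mdifferentiableAt (by simp)).hasMFDerivAt
  have h2 : HasMFDerivAt I I' φ x (mfderiv I I' φ x) :=
    (φ.contMDiff.mdifferentiableAt (by simp)).hasMFDerivAt
  have h3 := h1.comp x h2
  have h4 : φ.symm ∘ φ = (id : M → M) := funext fun y => φ.symm_apply_apply y
  rw [h4] at h3
  exact congrArg (fun T : E →L[ℝ] E => T v) (hasMFDerivAt_unique h3 (hasMFDerivAt_id x))

variable [IsManifold I ∞ M] [IsManifold I' ∞ M']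

lemma mfderiv_pullbackEnd (J : EndField I' M') (x : M) (v : TangentSpace I x) :
    mfderiv I I' φ x (pullbackEnd φ J x v) = J (φ x) (mfderiv I I' φ x v) :=
  (φ.mfderivToContinuousLinearEquiv (by simp) x).apply_symm_apply _

lemma pullbackEnd_apply (J : EndField I' M') (x : M) (v : TangentSpace I x) :
    (pullbackEnd φ J x v : E) = mfderiv I' I φ.symm (φ x) (J (φ x) (mfderiv I I' φ x v)) := by
  rw [← mfderiv_pullbackEnd]
  exact (mfderiv_symm_mfderiv φ x _).symm

lemma IsAlmostComplex.pullbackEnd {J : EndField I' M'} (hJ : IsAlmostComplex J) :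
    IsAlmostComplex (pullbackEnd φ J) := by
  refine ⟨fun x v => ?_, ?_⟩
  · refine (φ.mfderivToContinuousLinearEquiv (by simp) x).injective ?_
    refine (mfderiv_pullbackEnd φ J x _).trans ?_
    rw [mfderiv_pullbackEnd, hJ.1]
    exact (map_neg (mfderiv I I' φ x) v).symm
  · have h1 : ContMDiff I.tangent I'.tangent ∞ (tangentMap I I' φ) :=
      φ.contMDiff.contMDiff_tangentMap (by simp)
    have h2 : ContMDiff I'.tangent I.tangent ∞ (tangentMap I' I φ.symm) :=
      φ.symm.contMDiff.contMDiff_tangentMap (by simp)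
    refine (h2.comp (hJ.2.comp h1)).congr fun v => ?_
    have key : ∀ (a b : M) (v w : E), a = b → v = w →
        (⟨a, v⟩ : TangentBundle I M) = ⟨b, w⟩ := by
      rintro a _ v _ rfl rfl
      rfl
    exact key _ _ _ _ (φ.symm_apply_apply v.1).symm (pullbackEnd_apply φ J v.1 v.2)

lemma IsCompatible.pullbackEnd_pos {J : EndField I' M'} {Ω : BilinForm I' M'}
    (hJ : IsCompatible J Ω) (x : M) {v : TangentSpace I x} (hv : v ≠ 0) :
    0 < pullbackBilin φ Ω x v (_root_.pullbackEnd φ J x v) := by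
  have h1 : mfderiv I I' φ x v ≠ 0 := fun h0 =>
    hv ((map_eq_zero_iff _ (φ.mfderivToContinuousLinearEquiv (by simp) x).injective).mp h0)
  have h2 := hJ.2 (φ x) _ h1
  rw [← mfderiv_pullbackEnd] at h2
  exact h2

/-- The image of a frame under a diffeomorphism. -/
lemma IsSmoothFrame.exists_of_diffeomorph (φ : M ≃ₘ^∞⟮I, I'⟯ M') {F : Type*} [NormedAddCommGroup F] [NormedSpace ℝ F]
    {Ψ : ∀ x : M, TangentSpace I x ≃L[ℝ] F} (hΨ : IsSmoothFrame Ψ) :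
    ∃ Ψ' : ∀ y : M', TangentSpace I' y ≃L[ℝ] F, IsSmoothFrame Ψ' := by
  refine ⟨fun y => (φ.symm.mfderivToContinuousLinearEquiv (by simp) y).trans (Ψ (φ.symm y)), ?_⟩
  exact ContMDiff.comp (I' := I.tangent) (g := fun v : TangentBundle I M => Ψ v.1 v.2) hΨ
    (φ.symm.contMDiff.contMDiff_tangentMap (m := ∞) (by simp))

end Pullback

/-! ### The cotangent bundle of a parallelizable 3-manifold -/

section Parallelizable

/-- The coordinates of the plane. -/
noncomputable def planeCoord : EuclideanSpace ℝ (Fin 2) ≃L[ℝ] ℝ × ℝ :=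
  (EuclideanSpace.equiv (Fin 2) ℝ).trans (ContinuousLinearEquiv.finTwoArrow ℝ ℝ)

/-- The linear form with given coefficients. -/
noncomputable def dualForm : ℝ × ℝ × ℝ →L[ℝ] ℝ × ℝ × ℝ →L[ℝ] ℝ :=
  LinearMap.toContinuousLinearMap
    { toFun := fun s => s.1 • ContinuousLinearMap.fst ℝ ℝ (ℝ × ℝ) +
        (s.2.1 • (ContinuousLinearMap.fst ℝ ℝ ℝ).comp (ContinuousLinearMap.snd ℝ ℝ (ℝ × ℝ)) +
          s.2.2 • (ContinuousLinearMap.snd ℝ ℝ ℝ).comp (ContinuousLinearMap.snd ℝ ℝ (ℝ × ℝ)))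
      map_add' := fun s t => by
        ext <;> simp
      map_smul' := fun a s => by
        ext <;> simp }

lemma dualForm_apply (s a : ℝ × ℝ × ℝ) :
    dualForm s a = s.1 * a.1 + (s.2.1 * a.2.1 + s.2.2 * a.2.2) := rfl

variable {E : Type*} [NormedAddCommGroup E] [NormedSpace ℝ E]
  {H : Type*} [TopologicalSpace H] {I : ModelWithCorners ℝ E H}
  {Q : Type*} [TopologicalSpace Q] [ChartedSpace H Q] [IsManifold I ∞ Q]
  {Φ : ∀ x : Q, TangentSpace I x ≃L[ℝ] ℝ × ℝ × ℝ}

/-- The diffeomorphism `(Q × ℝ) × ℝ² ≅ T^*Q` given by a frame. -/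
noncomputable def IsSmoothFrame.cotangentDiffeomorph [FiniteDimensional ℝ E] (hΦ : IsSmoothFrame Φ) :
    ((Q × ℝ) × EuclideanSpace ℝ (Fin 2))
      ≃ₘ^∞⟮(I.prod 𝓘(ℝ, ℝ)).prod (𝓡 2), I.prod 𝓘(ℝ, E →L[ℝ] ℝ)⟯ CotangentBundle I Q where
  toFun p := ⟨p.1.1, (dualForm (p.1.2, planeCoord p.2)).comp
    (Φ p.1.1 : TangentSpace I p.1.1 →L[ℝ] ℝ × ℝ × ℝ)⟩
  invFun q := ((q.1, q.2 ((Φ q.1).symm (1, 0, 0))), planeCoord.symm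
    (q.2 ((Φ q.1).symm (0, 1, 0)), q.2 ((Φ q.1).symm (0, 0, 1))))
  left_inv p := by
    simp [dualForm_apply]
  right_inv q := by
    refine congrArg (TotalSpace.mk q.1) ?_
    ext v
    simp only [ContinuousLinearMap.comp_apply, ContinuousLinearEquiv.coe_coe,
      ContinuousLinearEquiv.apply_symm_apply, dualForm_apply]
    have h1 : Φ q.1 v = (Φ q.1 v).1 • ((1 : ℝ), (0 : ℝ), (0 : ℝ)) +
        ((Φ q.1 v).2.1 • ((0 : ℝ), (1 : ℝ), (0 : ℝ)) +
          (Φ q.1 v).2.2 • ((0 : ℝ), (0 : ℝ), (1 : ℝ))) := by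
      ext <;> simp
    have h2 := congrArg (fun a => q.2 ((Φ q.1).symm a)) h1
    simp only [ContinuousLinearEquiv.symm_apply_apply, map_add, map_smul, smul_eq_mul] at h2
    rw [h2]
    ring
  contMDiff_toFun := by
    have hp : ContMDiff ((I.prod 𝓘(ℝ, ℝ)).prod (𝓡 2)) I ∞
        (fun p : (Q × ℝ) × EuclideanSpace ℝ (Fin 2) => p.1.1) :=
      contMDiff_fst.comp contMDiff_fst
    refine (isSmoothFamily_iff_hom hp).mp fun p₀ => ?_
    have h1 := ((isSmoothFamily_of_tangentBundle (I := I)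
      (L := fun x => (Φ x : TangentSpace I x →L[ℝ] ℝ × ℝ × ℝ)) hΦ).comp hp) p₀
    have h2 : ContMDiff ((I.prod 𝓘(ℝ, ℝ)).prod (𝓡 2)) 𝓘(ℝ, ℝ × ℝ × ℝ →L[ℝ] ℝ) ∞
        (fun p : (Q × ℝ) × EuclideanSpace ℝ (Fin 2) => dualForm (p.1.2, planeCoord p.2)) :=
      dualForm.contDiff.contMDiff.comp ((contMDiff_snd.comp contMDiff_fst).prodMk_space
        (planeCoord.contDiff.contMDiff.comp contMDiff_snd))
    exact h2.contMDiffAt.clm_comp h1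
  contMDiff_invFun := by
    have hp := contMDiff_proj (n := ∞) (IB := I) (F := E →L[ℝ] ℝ)
      (fun x : Q => TangentSpace I x →L[ℝ] ℝ)
    have h1 : IsSmoothFamily (I.prod 𝓘(ℝ, E →L[ℝ] ℝ)) (fun q : CotangentBundle I Q => q.1)
        (fun q => q.2) := (isSmoothFamily_iff_hom hp).mpr contMDiff_id
    have h2 : ∀ a : ℝ × ℝ × ℝ, ContMDiff (I.prod 𝓘(ℝ, E →L[ℝ] ℝ)) 𝓘(ℝ, ℝ) ∞
        (fun q : CotangentBundle I Q => q.2 ((Φ q.1).symm a)) := fun a =>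
      h1.apply ((hΦ.contMDiff_symm_const a).comp hp)
    exact (hp.prodMk (h2 _)).prodMk (planeCoord.symm.contDiff.contMDiff.comp
      ((h2 _).prodMk_space (h2 _)))

/-- The frame of `(Q × ℝ) × ℝ²` induced by a frame of `Q`. -/
noncomputable def productFrame (Φ : ∀ x : Q, TangentSpace I x ≃L[ℝ] ℝ × ℝ × ℝ)
    (p : (Q × ℝ) × EuclideanSpace ℝ (Fin 2)) :
    TangentSpace ((I.prod 𝓘(ℝ, ℝ)).prod (𝓡 2)) p ≃L[ℝ] (ℝ × ℝ × ℝ) × (ℝ × ℝ × ℝ) :=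
  let A : E ≃L[ℝ] ℝ × ℝ × ℝ := Φ p.1.1
  (ContinuousLinearEquiv.prodAssoc ℝ E ℝ (EuclideanSpace ℝ (Fin 2))).trans
    (A.prodCongr ((ContinuousLinearEquiv.refl ℝ ℝ).prodCongr planeCoord))

lemma isSmoothFrame_productFrame (hΦ : IsSmoothFrame Φ) : IsSmoothFrame (productFrame Φ) := by
  have hp : ContMDiff ((I.prod 𝓘(ℝ, ℝ)).prod (𝓡 2)) I ∞
      (fun p : (Q × ℝ) × EuclideanSpace ℝ (Fin 2) => p.1.1) :=
    contMDiff_fst.comp contMDiff_fst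
  have hr : ContMDiff ((I.prod 𝓘(ℝ, ℝ)).prod (𝓡 2)) 𝓘(ℝ, ℝ) ∞
      (fun p : (Q × ℝ) × EuclideanSpace ℝ (Fin 2) => p.1.2) :=
    contMDiff_snd.comp contMDiff_fst
  have hs : ContMDiff ((I.prod 𝓘(ℝ, ℝ)).prod (𝓡 2)) 𝓘(ℝ, ℝ × ℝ) ∞
      (fun p : (Q × ℝ) × EuclideanSpace ℝ (Fin 2) => planeCoord p.2) :=
    planeCoord.contDiff.contMDiff.comp contMDiff_snd
  have h1 := ContMDiff.comp (I' := I.tangent) (g := fun v : TangentBundle I Q => Φ v.1 v.2) hΦ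
    (hp.contMDiff_tangentMap (m := ∞) (by simp))
  refine (h1.prodMk_space ((contMDiff_vectorDeriv hr).prodMk_space
    (contMDiff_vectorDeriv hs))).congr fun v => ?_
  have h2 : HasMFDerivAt ((I.prod 𝓘(ℝ, ℝ)).prod (𝓡 2)) I
      (fun p : (Q × ℝ) × EuclideanSpace ℝ (Fin 2) => p.1.1) v.1
      ((ContinuousLinearMap.fst ℝ E ℝ).comp
        (ContinuousLinearMap.fst ℝ (E × ℝ) (EuclideanSpace ℝ (Fin 2)))) :=
    (hasMFDerivAt_fst v.1.1).comp v.1 (hasMFDerivAt_fst v.1)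
  have h3 : HasMFDerivAt ((I.prod 𝓘(ℝ, ℝ)).prod (𝓡 2)) 𝓘(ℝ, ℝ)
      (fun p : (Q × ℝ) × EuclideanSpace ℝ (Fin 2) => p.1.2) v.1
      ((ContinuousLinearMap.snd ℝ E ℝ).comp
        (ContinuousLinearMap.fst ℝ (E × ℝ) (EuclideanSpace ℝ (Fin 2)))) :=
    (hasMFDerivAt_snd v.1.1).comp v.1 (hasMFDerivAt_fst v.1)
  have h4 : HasMFDerivAt ((I.prod 𝓘(ℝ, ℝ)).prod (𝓡 2)) 𝓘(ℝ, ℝ × ℝ)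
      (fun p : (Q × ℝ) × EuclideanSpace ℝ (Fin 2) => planeCoord p.2) v.1
      ((planeCoord : EuclideanSpace ℝ (Fin 2) →L[ℝ] ℝ × ℝ).comp
        (ContinuousLinearMap.snd ℝ (E × ℝ) (EuclideanSpace ℝ (Fin 2)))) :=
    planeCoord.hasFDerivAt.hasMFDerivAt.comp v.1 (hasMFDerivAt_snd v.1)
  refine Prod.ext ?_ (Prod.ext ?_ ?_)
  · exact congrArg (fun T : (E × ℝ) × EuclideanSpace ℝ (Fin 2) →L[ℝ] E => Φ v.1.1.1 (T v.2))
      h2.mfderiv.symm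
  · exact congrArg (fun T : (E × ℝ) × EuclideanSpace ℝ (Fin 2) →L[ℝ] ℝ => T v.2)
      h3.mfderiv.symm
  · exact congrArg (fun T : (E × ℝ) × EuclideanSpace ℝ (Fin 2) →L[ℝ] ℝ × ℝ => T v.2)
      h4.mfderiv.symm

/-- The derivative of the diffeomorphism at the zero section. -/
lemma IsSmoothFrame.mfderiv_cotangentDiffeomorph [FiniteDimensional ℝ E] [I.Boundaryless]
    (hΦ : IsSmoothFrame Φ) (x : Q)
    (v : (E × ℝ) × EuclideanSpace ℝ (Fin 2)) :
    (mfderiv ((I.prod 𝓘(ℝ, ℝ)).prod (𝓡 2)) (I.prod 𝓘(ℝ, E →L[ℝ] ℝ)) hΦ.cotangentDiffeomorph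
      ((x, 0), 0) v : E × (E →L[ℝ] ℝ)) =
      (v.1.1, (dualForm (v.1.2, planeCoord v.2)).comp
        (Φ x : TangentSpace I x →L[ℝ] ℝ × ℝ × ℝ)) := by
  let φ := hΦ.cotangentDiffeomorph
  let A : E →L[ℝ] ℝ × ℝ × ℝ := (Φ x : TangentSpace I x →L[ℝ] ℝ × ℝ × ℝ)
  let D : (E × ℝ) × EuclideanSpace ℝ (Fin 2) →L[ℝ] E × (E →L[ℝ] ℝ) :=
    mfderiv ((I.prod 𝓘(ℝ, ℝ)).prod (𝓡 2)) (I.prod 𝓘(ℝ, E →L[ℝ] ℝ)) φ ((x, 0), 0)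
  have hφ : HasMFDerivAt ((I.prod 𝓘(ℝ, ℝ)).prod (𝓡 2)) (I.prod 𝓘(ℝ, E →L[ℝ] ℝ)) φ
      ((x, 0), 0) D := (φ.contMDiff.mdifferentiableAt (by simp)).hasMFDerivAt
  have h1 : ∀ w : E, D ((w, 0), 0) = (w, 0) := by
    intro w
    have h2 := hφ.comp (x := x) (f := fun z : Q => ((z, (0 : ℝ)),
      (0 : EuclideanSpace ℝ (Fin 2)))) (((hasMFDerivAt_id x).prodMk
        (hasMFDerivAt_const (0 : ℝ) x)).prodMk
          (hasMFDerivAt_const (0 : EuclideanSpace ℝ (Fin 2)) x))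
    have h3 : (φ ∘ fun z : Q => ((z, (0 : ℝ)), (0 : EuclideanSpace ℝ (Fin 2)))) =
        fun z : Q => (⟨z, 0⟩ : CotangentBundle I Q) := by
      funext z
      refine congrArg (TotalSpace.mk z) ?_
      ext u
      simp [dualForm_apply]
    rw [h3] at h2
    exact congrArg (fun T : E →L[ℝ] E × (E →L[ℝ] ℝ) => T w)
      (hasMFDerivAt_unique h2 (hasMFDerivAt_cotangent_zeroSection x))
  have h4 : ∀ (r : ℝ) (y : EuclideanSpace ℝ (Fin 2)),
      D ((0, r), y) = (0, (dualForm (r, planeCoord y)).comp A) := by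
    intro r y
    let B : ℝ × EuclideanSpace ℝ (Fin 2) →L[ℝ] (E →L[ℝ] ℝ) :=
      ((ContinuousLinearMap.compL ℝ E (ℝ × ℝ × ℝ) ℝ).flip A).comp (dualForm.comp
        (((ContinuousLinearEquiv.refl ℝ ℝ).prodCongr planeCoord :
          (ℝ × EuclideanSpace ℝ (Fin 2)) ≃L[ℝ] ℝ × ℝ × ℝ) :
            ℝ × EuclideanSpace ℝ (Fin 2) →L[ℝ] ℝ × ℝ × ℝ))
    have h2 := hφ.comp (I := 𝓘(ℝ, ℝ × EuclideanSpace ℝ (Fin 2)))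
      (x := ((0 : ℝ), (0 : EuclideanSpace ℝ (Fin 2))))
      (f := fun z : ℝ × EuclideanSpace ℝ (Fin 2) => ((x, z.1), z.2))
      (((hasMFDerivAt_const x _).prodMk
        (ContinuousLinearMap.fst ℝ ℝ (EuclideanSpace ℝ (Fin 2))).hasFDerivAt.hasMFDerivAt).prodMk
        (ContinuousLinearMap.snd ℝ ℝ (EuclideanSpace ℝ (Fin 2))).hasFDerivAt.hasMFDerivAt)
    have h3 := (hasMFDerivAt_cotangent_fibre (I := I) x (B 0)).comp
      (x := (0 : ℝ × EuclideanSpace ℝ (Fin 2))) B.hasFDerivAt.hasMFDerivAt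
    exact congrArg (fun T : ℝ × EuclideanSpace ℝ (Fin 2) →L[ℝ] E × (E →L[ℝ] ℝ) => T (r, y))
      (hasMFDerivAt_unique h2 h3)
  have h5 : v = ((v.1.1, 0), 0) + ((0, v.1.2), v.2) := by ext <;> simp
  change D v = (v.1.1, (dualForm (v.1.2, planeCoord v.2)).comp A)
  conv_lhs => rw [h5]
  rw [map_add, h1, h4]
  simp

/-- The pullback of the standard form at the zero section, in the frame. -/
lemma IsSmoothFrame.pullbackBilin_cotangentDiffeomorph [FiniteDimensional ℝ E] [I.Boundaryless]
    (hΦ : IsSmoothFrame Φ) (x : Q) (v w : (E × ℝ) × EuclideanSpace ℝ (Fin 2)) :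
    pullbackBilin (I := (I.prod 𝓘(ℝ, ℝ)).prod (𝓡 2)) hΦ.cotangentDiffeomorph
      (cotangentForm I Q) ((x, 0), 0) v w =
      dualForm (v.1.2, planeCoord v.2) (Φ x w.1.1) -
        dualForm (w.1.2, planeCoord w.2) (Φ x v.1.1) := by
  refine (cotangentForm_apply (hΦ.cotangentDiffeomorph ((x, 0), 0)) _ _).trans ?_
  have key : ∀ a b : E × (E →L[ℝ] ℝ),
      a = (v.1.1, (dualForm (v.1.2, planeCoord v.2)).comp
        (Φ x : TangentSpace I x →L[ℝ] ℝ × ℝ × ℝ)) →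
      b = (w.1.1, (dualForm (w.1.2, planeCoord w.2)).comp
        (Φ x : TangentSpace I x →L[ℝ] ℝ × ℝ × ℝ)) →
      a.2 b.1 - b.2 a.1 = dualForm (v.1.2, planeCoord v.2) (Φ x w.1.1) -
        dualForm (w.1.2, planeCoord w.2) (Φ x v.1.1) := by
    rintro _ _ rfl rfl
    rfl
  exact key _ _ (hΦ.mfderiv_cotangentDiffeomorph x v) (hΦ.mfderiv_cotangentDiffeomorph x w)

end Parallelizable

/-! ### Smoothness of forms along maps -/

section FormsAlongMaps

variable {E : Type*} [NormedAddCommGroup E] [NormedSpace ℝ E] [FiniteDimensional ℝ E]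
  {H : Type*} [TopologicalSpace H] {I : ModelWithCorners ℝ E H}
  {M : Type*} [TopologicalSpace M] [ChartedSpace H M] [IsManifold I ∞ M]
  {F : Type*} [NormedAddCommGroup F] [NormedSpace ℝ F] [FiniteDimensional ℝ F]

lemma IsSmoothOnFields.contMDiff_along {Ω : BilinForm I M} (hΩ : IsSmoothOnFields Ω)
    {Ψ : ∀ x : M, TangentSpace I x ≃L[ℝ] F} (hΨ : IsSmoothFrame Ψ)
    {E' : Type*} [NormedAddCommGroup E'] [NormedSpace ℝ E']
    {H' : Type*} [TopologicalSpace H'] {J : ModelWithCorners ℝ E' H'}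
    {N : Type*} [TopologicalSpace N] [ChartedSpace H' N] {q : N → M}
    {X Y : ∀ n, TangentSpace I (q n)}
    (hX : ContMDiff J I.tangent ∞ (fun n => (⟨q n, X n⟩ : TangentBundle I M)))
    (hY : ContMDiff J I.tangent ∞ (fun n => (⟨q n, Y n⟩ : TangentBundle I M))) :
    ContMDiff J 𝓘(ℝ, ℝ) ∞ (fun n => Ω (q n) (X n) (Y n)) := by
  have hq : ContMDiff J I ∞ q := (contMDiff_proj (TangentSpace I)).comp hX
  let T : M → F →L[ℝ] F →L[ℝ] ℝ := fun x =>
    let B : E →L[ℝ] E →L[ℝ] ℝ := Ω x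
    let A : F →L[ℝ] E := ((Ψ x).symm : F →L[ℝ] TangentSpace I x)
    B.bilinearComp A A
  have hT : ContMDiff I 𝓘(ℝ, F →L[ℝ] F →L[ℝ] ℝ) ∞ T :=
    contMDiff_clm_of_apply fun v => contMDiff_clm_of_apply fun w =>
      hΩ _ _ (hΨ.contMDiff_symm_const v) (hΨ.contMDiff_symm_const w)
  have h1 : ∀ {Z : ∀ n, TangentSpace I (q n)},
      ContMDiff J I.tangent ∞ (fun n => (⟨q n, Z n⟩ : TangentBundle I M)) →
      ContMDiff J 𝓘(ℝ, F) ∞ (fun n => Ψ (q n) (Z n)) := fun hZ =>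
    ContMDiff.comp (I' := I.tangent) (g := fun v : TangentBundle I M => Ψ v.1 v.2) hΨ hZ
  refine (((hT.comp hq).clm_apply (h1 hX)).clm_apply (h1 hY)).congr fun n => ?_
  change _ = Ω (q n) ((Ψ (q n)).symm (Ψ (q n) (X n))) ((Ψ (q n)).symm (Ψ (q n) (Y n)))
  rw [ContinuousLinearEquiv.symm_apply_apply, ContinuousLinearEquiv.symm_apply_apply]

end FormsAlongMaps

section LineFrame

variable {E : Type*} [NormedAddCommGroup E] [NormedSpace ℝ E]
  {H : Type*} [TopologicalSpace H] {I : ModelWithCorners ℝ E H}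
  {Q : Type*} [TopologicalSpace Q] [ChartedSpace H Q] [IsManifold I ∞ Q]
  {F : Type*} [NormedAddCommGroup F] [NormedSpace ℝ F]
  {Φ : ∀ x : Q, TangentSpace I x ≃L[ℝ] F}

lemma IsSmoothFrame.exists_line (hΦ : IsSmoothFrame Φ) :
    ∃ Ψ : ∀ p : Q × ℝ, TangentSpace (I.prod 𝓘(ℝ, ℝ)) p ≃L[ℝ] F × ℝ, IsSmoothFrame Ψ := by
  let A : ∀ p : Q × ℝ, E ≃L[ℝ] F := fun p => Φ p.1
  refine ⟨fun p => (A p).prodCongr (ContinuousLinearEquiv.refl ℝ ℝ), ?_⟩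
  have h1 := ContMDiff.comp (I' := I.tangent) (g := fun v : TangentBundle I Q => Φ v.1 v.2) hΦ
    ((contMDiff_fst (I := I) (J := 𝓘(ℝ, ℝ)) (M := Q) (N := ℝ)
      (n := ∞)).contMDiff_tangentMap (m := ∞) (by simp))
  have h2 := contMDiff_vectorDeriv (contMDiff_snd (I := I) (J := 𝓘(ℝ, ℝ)) (M := Q) (N := ℝ)
    (n := ∞))
  refine (h1.prodMk_space h2).congr fun v => Prod.ext ?_ ?_
  · exact congrArg (fun T : E × ℝ →L[ℝ] E => Φ v.1.1 (T v.2))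
      (hasMFDerivAt_fst (I := I) (I' := 𝓘(ℝ, ℝ)) v.1).mfderiv.symm
  · exact congrArg (fun T : E × ℝ →L[ℝ] ℝ => T v.2)
      (hasMFDerivAt_snd (I := I) (I' := 𝓘(ℝ, ℝ)) v.1).mfderiv.symm

end LineFrame

/-! ### The product form -/

section ProductForm

variable {S : Type*} [TopologicalSpace S] [ChartedSpace (EuclideanSpace ℝ (Fin 2)) S]
  [IsManifold (𝓡 2) ∞ S]

lemma productForm_apply (Ω : BilinForm modelCR (TangentCircleBundle S × ℝ))
    (p : (TangentCircleBundle S × ℝ) × EuclideanSpace ℝ (Fin 2))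
    (v w : ((EuclideanSpace ℝ (Fin 2) × EuclideanSpace ℝ (Fin 1)) × ℝ) ×
      EuclideanSpace ℝ (Fin 2)) :
    productForm Ω p v w = Ω p.1 v.1 w.1 +
      ((planeCoord v.2).1 * (planeCoord w.2).2 - (planeCoord v.2).2 * (planeCoord w.2).1) := by
  have h1 : pullbackBilin (I := modelCRR) Prod.fst Ω p v w = Ω p.1 v.1 w.1 := by
    unfold pullbackBilin
    rw [mfderiv_fst]
    rfl
  have h2 : pullbackBilin (I := modelCRR) Prod.snd planeForm p v w =
      (planeCoord v.2).1 * (planeCoord w.2).2 - (planeCoord v.2).2 * (planeCoord w.2).1 := by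
    unfold pullbackBilin
    rw [mfderiv_snd]
    rfl
  change pullbackBilin (I := modelCRR) Prod.fst Ω p v w +
    pullbackBilin (I := modelCRR) Prod.snd planeForm p v w = _
  rw [h1, h2]

lemma productForm_self {Ω : BilinForm modelCR (TangentCircleBundle S × ℝ)}
    (hΩ : ∀ x v, Ω x v v = 0)
    (p : (TangentCircleBundle S × ℝ) × EuclideanSpace ℝ (Fin 2)) (v : TangentSpace modelCRR p) :
    productForm Ω p v v = 0 := by
  refine (productForm_apply Ω p v v).trans ?_
  have h := hΩ p.1 v.1
  have key : ∀ a b c : ℝ, a = 0 → a + (b * c - c * b) = 0 := fun a b c ha => by rw [ha]; ring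
  exact key _ _ _ h

lemma isNondegenerateBilin_productForm {Ω : BilinForm modelCR (TangentCircleBundle S × ℝ)}
    (hΩ : IsNondegenerateBilin Ω) : IsNondegenerateBilin (productForm Ω) := by
  intro p u hu
  have h : ∀ w : ((EuclideanSpace ℝ (Fin 2) × EuclideanSpace ℝ (Fin 1)) × ℝ) ×
      EuclideanSpace ℝ (Fin 2), Ω p.1 u.1 w.1 +
      ((planeCoord u.2).1 * (planeCoord w.2).2 - (planeCoord u.2).2 * (planeCoord w.2).1) = 0 :=
    fun w => (productForm_apply Ω p u w).symm.trans (hu w)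
  have h1 : u.1 = 0 := hΩ p.1 u.1 fun w => by
    have := h (w, 0)
    simpa using this
  have h2 : ∀ z : ℝ × ℝ, (planeCoord u.2).1 * z.2 - (planeCoord u.2).2 * z.1 = 0 := fun z => by
    have h3 := h ((0 : (EuclideanSpace ℝ (Fin 2) × EuclideanSpace ℝ (Fin 1)) × ℝ),
      planeCoord.symm z)
    have h4 : Ω p.1 u.1 (0 : (EuclideanSpace ℝ (Fin 2) × EuclideanSpace ℝ (Fin 1)) × ℝ) = 0 :=
      map_zero (Ω p.1 u.1)
    rw [h4, zero_add, ContinuousLinearEquiv.apply_symm_apply] at h3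
    exact h3
  have h3 := h2 (0, 1)
  have h4 := h2 (1, 0)
  simp only [mul_one, mul_zero, sub_zero, zero_sub, neg_eq_zero] at h3 h4
  have h5 : u.2 = 0 := (map_eq_zero_iff planeCoord planeCoord.injective).mp (Prod.ext h3 h4)
  exact Prod.ext h1 h5

lemma isSmoothOnFields_productForm {Ω : BilinForm modelCR (TangentCircleBundle S × ℝ)}
    (hΩ : IsSmoothOnFields Ω)
    {Φ : ∀ c : TangentCircleBundle S, TangentSpace modelC c ≃L[ℝ] ℝ × ℝ × ℝ}
    (hΦ : IsSmoothFrame Φ) : IsSmoothOnFields (productForm Ω) := by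
  intro X Y hX hY
  obtain ⟨Ψ, hΨ⟩ := hΦ.exists_line
  have hd : ∀ {Z : ∀ p : (TangentCircleBundle S × ℝ) × EuclideanSpace ℝ (Fin 2),
      TangentSpace modelCRR p},
      ContMDiff modelCRR modelCRR.tangent ∞ (fun p => (⟨p, Z p⟩ : TangentBundle modelCRR
        ((TangentCircleBundle S × ℝ) × EuclideanSpace ℝ (Fin 2)))) →
      ContMDiff modelCRR modelCR.tangent ∞ (fun p => (⟨p.1, mfderiv modelCRR modelCR Prod.fst p
        (Z p)⟩ : TangentBundle modelCR (TangentCircleBundle S × ℝ))) := fun hZ =>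
    ((contMDiff_fst (I := modelCR) (J := 𝓡 2) (M := TangentCircleBundle S × ℝ)
      (N := EuclideanSpace ℝ (Fin 2)) (n := ∞)).contMDiff_tangentMap (m := ∞) (by simp)).comp hZ
  have h1 := hΩ.contMDiff_along hΨ (hd hX) (hd hY)
  have h2 : ∀ {Z : ∀ p : (TangentCircleBundle S × ℝ) × EuclideanSpace ℝ (Fin 2),
      TangentSpace modelCRR p},
      ContMDiff modelCRR modelCRR.tangent ∞ (fun p => (⟨p, Z p⟩ : TangentBundle modelCRR
        ((TangentCircleBundle S × ℝ) × EuclideanSpace ℝ (Fin 2)))) →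
      ContMDiff modelCRR 𝓘(ℝ, ℝ × ℝ) ∞ (fun p => planeCoord (vectorDeriv modelCRR
        (Prod.snd : (TangentCircleBundle S × ℝ) × EuclideanSpace ℝ (Fin 2) →
          EuclideanSpace ℝ (Fin 2)) p (Z p))) := fun hZ =>
    planeCoord.contDiff.contMDiff.comp ((contMDiff_vectorDeriv contMDiff_snd).comp hZ)
  have hf : ContDiff ℝ ∞ fun z : (ℝ × ℝ) × (ℝ × ℝ) => z.1.1 * z.2.2 - z.1.2 * z.2.1 := by
    fun_prop
  refine (h1.add (hf.contMDiff.comp ((h2 hX).prodMk_space (h2 hY)))).congr fun p => ?_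
  rfl

end ProductForm

/-! ### Model complex structures in dimension six -/

section ModelStructures

lemma quadratic_pos {p q m x y : ℝ} (hp : 0 < p) (hm : m ^ 2 < 4 * p * q)
    (hxy : ¬(x = 0 ∧ y = 0)) : 0 < p * x ^ 2 + m * (x * y) + q * y ^ 2 := by
  have key : 4 * p * (p * x ^ 2 + m * (x * y) + q * y ^ 2) =
      (2 * p * x + m * y) ^ 2 + (4 * p * q - m ^ 2) * y ^ 2 := by ring
  have h : 0 < (2 * p * x + m * y) ^ 2 + (4 * p * q - m ^ 2) * y ^ 2 := by
    by_cases hy : y = 0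
    · have hx : x ≠ 0 := fun hx => hxy ⟨hx, hy⟩
      rw [hy]
      have : 2 * p * x ≠ 0 := by positivity
      simp only [mul_zero, add_zero, ne_eq, OfNat.ofNat_ne_zero, not_false_eq_true, zero_pow]
      positivity
    · have h1 : 0 < (4 * p * q - m ^ 2) * y ^ 2 := mul_pos (by linarith) (by positivity)
      positivity
  rw [← key] at h
  exact pos_of_mul_pos_right h (by positivity)

lemma quadratic_nonneg {p q m : ℝ} (hp : 0 < p) (hm : m ^ 2 < 4 * p * q) (x y : ℝ) :
    0 ≤ p * x ^ 2 + m * (x * y) + q * y ^ 2 := by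
  by_cases h : x = 0 ∧ y = 0
  · rw [h.1, h.2]; simp
  · exact (quadratic_pos hp hm h).le

/-- The complex structure pairing the first two coordinates of the base with the line and with
each other. -/
noncomputable def splitStructure (κ : ℝ) :
    (ℝ × ℝ × ℝ) × (ℝ × ℝ × ℝ) →L[ℝ] (ℝ × ℝ × ℝ) × (ℝ × ℝ × ℝ) :=
  LinearMap.toContinuousLinearMap
    { toFun := fun v => ((κ * v.2.1, κ * v.1.2.2, -(κ⁻¹ * v.1.2.1)),
        (-(κ⁻¹ * v.1.1), -v.2.2.2, v.2.2.1))
      map_add' := fun v w => by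
        simp only [Prod.fst_add, Prod.snd_add, Prod.mk_add_mk, mul_add, neg_add]
      map_smul' := fun a v => by
        simp only [Prod.smul_fst, Prod.smul_snd, Prod.smul_mk, smul_eq_mul, RingHom.id_apply,
          mul_left_comm _ a, mul_neg] }

lemma splitStructure_apply (κ : ℝ) (v : (ℝ × ℝ × ℝ) × (ℝ × ℝ × ℝ)) :
    splitStructure κ v = ((κ * v.2.1, κ * v.1.2.2, -(κ⁻¹ * v.1.2.1)),
        (-(κ⁻¹ * v.1.1), -v.2.2.2, v.2.2.1)) := rfl

/-- The complex structure pairing the base with the fibre of the cotangent bundle. -/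
noncomputable def cotangentStructure :
    (ℝ × ℝ × ℝ) × (ℝ × ℝ × ℝ) →L[ℝ] (ℝ × ℝ × ℝ) × (ℝ × ℝ × ℝ) :=
  (ContinuousLinearMap.snd ℝ (ℝ × ℝ × ℝ) (ℝ × ℝ × ℝ)).prod
    (-ContinuousLinearMap.fst ℝ (ℝ × ℝ × ℝ) (ℝ × ℝ × ℝ))

lemma cotangentStructure_apply (v : (ℝ × ℝ × ℝ) × (ℝ × ℝ × ℝ)) :
    cotangentStructure v = (v.2, -v.1) := rfl

variable {M : Type*} [TopologicalSpace M]

/-- A family of split complex structures. -/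
noncomputable def splitFamily (κ : C(M, ℝ)) (hκ : ∀ x, 0 < κ x) :
    C(M, LinearComplexStructure ((ℝ × ℝ × ℝ) × (ℝ × ℝ × ℝ))) where
  toFun x := ⟨splitStructure (κ x), by
    refine ContinuousLinearMap.ext fun v => ?_
    have h := (hκ x).ne'
    change splitStructure (κ x) (splitStructure (κ x) v) = -v
    simp only [splitStructure_apply]
    ext <;> simp [h]⟩
  continuous_toFun := by
    refine Continuous.subtype_mk (continuous_clm_apply.mpr fun v => ?_) _
    have h1 := κ.continuous
    have h2 : Continuous fun x => (κ x)⁻¹ := h1.inv₀ fun x => (hκ x).ne'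
    simp only [splitStructure_apply]
    fun_prop

/-- The constant family of cotangent complex structures. -/
noncomputable def cotangentFamily (M : Type*) [TopologicalSpace M] :
    C(M, LinearComplexStructure ((ℝ × ℝ × ℝ) × (ℝ × ℝ × ℝ))) :=
  ContinuousMap.const M ⟨cotangentStructure, ContinuousLinearMap.ext fun _ => rfl⟩

/-- The split form with parameters. -/
def splitForm (e μ k : ℝ) (v w : (ℝ × ℝ × ℝ) × (ℝ × ℝ × ℝ)) : ℝ :=
  e * (v.2.1 * w.1.1 - w.2.1 * v.1.1) + μ * (v.1.2.2 * w.1.2.1 - w.1.2.2 * v.1.2.1) +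
    k * (v.1.1 * w.1.2.1 - v.1.2.1 * w.1.1) + (v.2.2.1 * w.2.2.2 - v.2.2.2 * w.2.2.1)

lemma splitForm_pos {e μ k κ : ℝ} (he : 0 < e) (hμ : 0 < μ) (hκ : 0 < κ)
    (h : (k * κ) ^ 2 < 4 * (e * μ)) {v : (ℝ × ℝ × ℝ) × (ℝ × ℝ × ℝ)} (hv : v ≠ 0) :
    0 < splitForm e μ k v (splitStructure κ v) := by
  obtain ⟨⟨a₀, a₁, a₂⟩, r, y₀, y₁⟩ := v
  have h1 : (k * κ) ^ 2 < 4 * (e * κ⁻¹) * (μ * κ) := by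
    have : 4 * (e * κ⁻¹) * (μ * κ) = 4 * (e * μ) := by field_simp
    rwa [this]
  have h2 : (-(k * κ)) ^ 2 < 4 * (e * κ) * (μ * κ⁻¹) := by
    have : 4 * (e * κ) * (μ * κ⁻¹) = 4 * (e * μ) := by field_simp
    rwa [this, neg_sq]
  have heq : splitForm e μ k ((a₀, a₁, a₂), r, y₀, y₁)
      (splitStructure κ ((a₀, a₁, a₂), r, y₀, y₁)) =
      (e * κ⁻¹ * a₀ ^ 2 + k * κ * (a₀ * a₂) + μ * κ * a₂ ^ 2) +
      (e * κ * r ^ 2 + -(k * κ) * (r * a₁) + μ * κ⁻¹ * a₁ ^ 2) + (y₀ ^ 2 + y₁ ^ 2) := by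
    simp only [splitStructure_apply, splitForm]
    ring
  rw [heq]
  have p1 : 0 < e * κ⁻¹ := by positivity
  have p2 : 0 < e * κ := by positivity
  have n1 := quadratic_nonneg p1 h1 a₀ a₂
  have n2 := quadratic_nonneg p2 h2 r a₁
  by_cases c1 : a₀ = 0 ∧ a₂ = 0
  · by_cases c2 : r = 0 ∧ a₁ = 0
    · have hy : 0 < y₀ ^ 2 + y₁ ^ 2 := by
        by_contra hle
        have : y₀ = 0 ∧ y₁ = 0 := by constructor <;> nlinarith [sq_nonneg y₀, sq_nonneg y₁]
        exact hv (by rw [c1.1, c1.2, c2.1, c2.2, this.1, this.2]; rfl)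
      linarith
    · have := quadratic_pos p2 h2 c2
      positivity
  · have := quadratic_pos p1 h1 c1
    positivity

lemma splitForm_add (e μ k : ℝ) (u v w : (ℝ × ℝ × ℝ) × (ℝ × ℝ × ℝ)) :
    splitForm e μ k u (v + w) = splitForm e μ k u v + splitForm e μ k u w := by
  simp only [splitForm, Prod.fst_add, Prod.snd_add]
  ring

lemma splitForm_smul (e μ k : ℝ) (u : (ℝ × ℝ × ℝ) × (ℝ × ℝ × ℝ)) (a : ℝ)
    (v : (ℝ × ℝ × ℝ) × (ℝ × ℝ × ℝ)) :
    splitForm e μ k u (a • v) = a * splitForm e μ k u v := by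
  simp only [splitForm, Prod.smul_fst, Prod.smul_snd, smul_eq_mul]
  ring

lemma splitFamily_homotopic_cotangentFamily (κ : C(M, ℝ)) (hκ : ∀ x, 0 < κ x) :
    (splitFamily κ hκ).Homotopic (cotangentFamily M) := by
  have h1 : (splitFamily κ hκ).Homotopic (splitFamily (ContinuousMap.const M 1)
      fun _ => one_pos) :=
    LinearComplexStructure.homotopic_of_tame (fun _ => splitForm 1 1 0)
      (fun _ => splitForm_add 1 1 0) (fun _ => splitForm_smul 1 1 0)
      (fun x v hv => splitForm_pos one_pos one_pos (hκ x) (by norm_num) hv)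
      (fun x v hv => splitForm_pos one_pos one_pos one_pos (by norm_num) hv)
  refine h1.trans (LinearComplexStructure.homotopic fun x a b ha hb hab v hv => ?_)
  have h2 : a • splitStructure 1 v + b • cotangentStructure v = 0 := hv
  obtain ⟨⟨a₀, a₁, a₂⟩, r, y₀, y₁⟩ := v
  simp only [splitStructure_apply, cotangentStructure_apply, Prod.smul_mk, Prod.mk_add_mk,
    Prod.neg_mk, Prod.mk_eq_zero, smul_eq_mul, inv_one, one_mul, mul_neg] at h2
  obtain ⟨⟨e1, e2, e3⟩, e4, e5, e6⟩ := h2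
  have hs : 0 < a ^ 2 + b ^ 2 := by
    by_contra hle
    have : a = 0 ∧ b = 0 := by constructor <;> nlinarith [sq_nonneg a, sq_nonneg b]
    linarith [this.1, this.2]
  have key : ∀ z : ℝ, (a ^ 2 + b ^ 2) * z = 0 → z = 0 := fun z hz =>
    (mul_eq_zero.mp hz).resolve_left hs.ne'
  have key' : ∀ z : ℝ, (a + b) * z = 0 → z = 0 := fun z hz =>
    (mul_eq_zero.mp hz).resolve_left hab.ne'
  rw [key' r (by linarith), key' a₀ (by linarith), key a₁ (by linear_combination (-a) * e3 - b * e5),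
    key a₂ (by linear_combination a * e2 - b * e6), key y₀ (by linear_combination b * e2 + a * e6),
    key y₁ (by linear_combination b * e3 - a * e5)]
  rfl

/-- The pairing form with the fibre of the cotangent bundle. -/
noncomputable def pairingForm (v w : (ℝ × ℝ × ℝ) × (ℝ × ℝ × ℝ)) : ℝ :=
  dualForm v.2 w.1 - dualForm w.2 v.1

lemma pairingForm_pos {v : (ℝ × ℝ × ℝ) × (ℝ × ℝ × ℝ)} (hv : v ≠ 0) :
    0 < pairingForm v (cotangentStructure v) := by
  obtain ⟨⟨a₀, a₁, a₂⟩, r, y₀, y₁⟩ := v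
  have heq : pairingForm ((a₀, a₁, a₂), r, y₀, y₁)
      (cotangentStructure ((a₀, a₁, a₂), r, y₀, y₁)) =
      a₀ ^ 2 + a₁ ^ 2 + a₂ ^ 2 + r ^ 2 + y₀ ^ 2 + y₁ ^ 2 := by
    simp only [pairingForm, cotangentStructure_apply, dualForm_apply, Prod.neg_mk]
    ring
  rw [heq]
  by_contra hle
  have : a₀ = 0 ∧ a₁ = 0 ∧ a₂ = 0 ∧ r = 0 ∧ y₀ = 0 ∧ y₁ = 0 := by
    refine ⟨?_, ?_, ?_, ?_, ?_, ?_⟩ <;>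
      nlinarith [sq_nonneg a₀, sq_nonneg a₁, sq_nonneg a₂, sq_nonneg r, sq_nonneg y₀,
        sq_nonneg y₁]
  obtain ⟨rfl, rfl, rfl, rfl, rfl, rfl⟩ := this
  exact hv rfl

lemma pairingForm_add (u v w : (ℝ × ℝ × ℝ) × (ℝ × ℝ × ℝ)) :
    pairingForm u (v + w) = pairingForm u v + pairingForm u w := by
  simp only [pairingForm, Prod.fst_add, Prod.snd_add, map_add, add_apply]
  ring

lemma pairingForm_smul (u : (ℝ × ℝ × ℝ) × (ℝ × ℝ × ℝ)) (a : ℝ)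
    (v : (ℝ × ℝ × ℝ) × (ℝ × ℝ × ℝ)) : pairingForm u (a • v) = a * pairingForm u v := by
  simp only [pairingForm, Prod.smul_fst, Prod.smul_snd, map_smul, smul_apply, smul_eq_mul]
  ring

/-- The retraction of `(Q × ℝ) × ℝ²` to a slice. -/
def sliceRetraction (Q : Type*) [TopologicalSpace Q] (t : ℝ) :
    C((Q × ℝ) × EuclideanSpace ℝ (Fin 2), (Q × ℝ) × EuclideanSpace ℝ (Fin 2)) where
  toFun p := ((p.1.1, t), 0)

lemma homotopic_comp_sliceRetraction {Q Y : Type*} [TopologicalSpace Q] [TopologicalSpace Y]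
    (t : ℝ) (f : C((Q × ℝ) × EuclideanSpace ℝ (Fin 2), Y)) :
    f.Homotopic (f.comp (sliceRetraction Q t)) := by
  refine ⟨⟨⟨fun p => f ((p.2.1.1, (1 - (p.1 : ℝ)) * p.2.1.2 + (p.1 : ℝ) * t),
    (1 - (p.1 : ℝ)) • p.2.2), by fun_prop⟩, fun p => ?_, fun p => ?_⟩⟩
  · simp
  · simp [sliceRetraction]

end ModelStructures

/-! ### The symplectic forms in the frame -/

section FormsInFrame

lemma splitForm_of_frame {E : Type*} [NormedAddCommGroup E] [NormedSpace ℝ E]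
    {B : E × ℝ →L[ℝ] E × ℝ →L[ℝ] ℝ} (hB : ∀ v, B v v = 0) (A : E ≃L[ℝ] ℝ × ℝ × ℝ) {e μ : ℝ}
    (hR : ∀ w, B (0, 1) w = e * (A w.1).1)
    (hV : ∀ w, B (A.symm (0, 0, 1), 0) w = μ * (A w.1).2.1) (v w : E × ℝ) :
    B v w = e * (v.2 * (A w.1).1 - w.2 * (A v.1).1) +
      μ * ((A v.1).2.2 * (A w.1).2.1 - (A w.1).2.2 * (A v.1).2.1) +
      B (A.symm (1, 0, 0), 0) (A.symm (0, 1, 0), 0) *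
        ((A v.1).1 * (A w.1).2.1 - (A v.1).2.1 * (A w.1).1) := by
  have hskew : ∀ u z, B u z = -B z u := by
    intro u z
    have := hB (u + z)
    simp only [map_add, add_apply, hB] at this
    linarith
  have hdec : ∀ u : E × ℝ, u = u.2 • ((0 : E), (1 : ℝ)) +
      ((A u.1).1 • (A.symm (1, 0, 0), (0 : ℝ)) + ((A u.1).2.1 • (A.symm (0, 1, 0), (0 : ℝ)) +
        (A u.1).2.2 • (A.symm (0, 0, 1), (0 : ℝ)))) := by
    intro u
    have h1 : A u.1 = (A u.1).1 • ((1 : ℝ), (0 : ℝ), (0 : ℝ)) +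
        ((A u.1).2.1 • ((0 : ℝ), (1 : ℝ), (0 : ℝ)) +
          (A u.1).2.2 • ((0 : ℝ), (0 : ℝ), (1 : ℝ))) := by
      ext <;> simp
    have h2 := congrArg A.symm h1
    rw [ContinuousLinearEquiv.symm_apply_apply, map_add, map_add, map_smul, map_smul,
      map_smul] at h2
    refine Prod.ext ?_ (by simp)
    simpa using h2
  have hexp : ∀ u z, B u z = u.2 * B (0, 1) z + ((A u.1).1 * B (A.symm (1, 0, 0), 0) z +
      ((A u.1).2.1 * B (A.symm (0, 1, 0), 0) z +
        (A u.1).2.2 * B (A.symm (0, 0, 1), 0) z)) := by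
    intro u z
    conv_lhs => rw [hdec u]
    simp only [map_add, map_smul, add_apply, smul_apply, smul_eq_mul]
  have hX : B (A.symm (1, 0, 0), 0) w = -(w.2 * e) +
      B (A.symm (1, 0, 0), 0) (A.symm (0, 1, 0), 0) * (A w.1).2.1 := by
    rw [hskew, hexp w, hR, hV, hB, hskew (A.symm (0, 1, 0), 0)]
    simp only [ContinuousLinearEquiv.apply_symm_apply]
    ring
  have hH : B (A.symm (0, 1, 0), 0) w = -((A w.1).2.2 * μ) -
      B (A.symm (1, 0, 0), 0) (A.symm (0, 1, 0), 0) * (A w.1).1 := by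
    rw [hskew, hexp w, hR, hV, hB]
    simp only [ContinuousLinearEquiv.apply_symm_apply]
    ring
  rw [hexp v w, hR, hV, hX, hH]
  ring

variable {S : Type*} [TopologicalSpace S] [ChartedSpace (EuclideanSpace ℝ (Fin 2)) S]
  [IsManifold (𝓡 2) ∞ S]

lemma exists_productForm_eq_splitForm
    (g : ContMDiffRiemannianMetric (𝓡 2) ∞ (EuclideanSpace ℝ (Fin 2))
      (fun x : S => TangentSpace (𝓡 2) x)) {τ : BilinForm (𝓡 2) S}
    {Φ : ∀ c : TangentCircleBundle S, TangentSpace modelC c ≃L[ℝ] ℝ × ℝ × ℝ}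
    (hΦ₁ : ∀ c (w : EuclideanSpace ℝ (Fin 2) × EuclideanSpace ℝ (Fin 1)),
        (Φ c w).1 = metricAt g c.1 (fibreUnit g c.1 c.2) w.1)
    (hΦ₂ : ∀ c, ∃ η : EuclideanSpace ℝ (Fin 1),
        (Φ c).symm (0, 0, 1) = ((0 : EuclideanSpace ℝ (Fin 2)), η) ∧
        ∃ μ : ℝ, 0 < μ ∧ ∀ w : EuclideanSpace ℝ (Fin 2) × EuclideanSpace ℝ (Fin 1),
          metricAt g c.1 (fibreVelocity g c.1 c.2 η) w.1 = μ * (Φ c w).2.1)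
    {Ω : BilinForm modelCR (TangentCircleBundle S × ℝ)} (hΩ : ∀ x v, Ω x v v = 0)
    (c : TangentCircleBundle S) (t : ℝ) (h : Ω (c, t) = magneticForm g τ (c, t)) :
    ∃ μ k : ℝ, 0 < μ ∧ ∀ v w : (ℝ × ℝ × ℝ) × (ℝ × ℝ × ℝ),
      productForm Ω ((c, t), 0) ((productFrame Φ ((c, t), 0)).symm v)
        ((productFrame Φ ((c, t), 0)).symm w) = splitForm (Real.exp t) μ k v w := by
  obtain ⟨η, hη, μ, hμ, hμ'⟩ := hΦ₂ c
  let A : (EuclideanSpace ℝ (Fin 2) × EuclideanSpace ℝ (Fin 1)) ≃L[ℝ] ℝ × ℝ × ℝ := Φ c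
  let B : (EuclideanSpace ℝ (Fin 2) × EuclideanSpace ℝ (Fin 1)) × ℝ →L[ℝ]
    (EuclideanSpace ℝ (Fin 2) × EuclideanSpace ℝ (Fin 1)) × ℝ →L[ℝ] ℝ := Ω (c, t)
  have hA : A.symm (0, 0, 1) = ((0 : EuclideanSpace ℝ (Fin 2)), η) := hη
  have hBm : ∀ u w, B u w = magneticForm g τ (c, t) u w := fun u w =>
    congrArg (fun T : (EuclideanSpace ℝ (Fin 2) × EuclideanSpace ℝ (Fin 1)) × ℝ →L[ℝ]
      (EuclideanSpace ℝ (Fin 2) × EuclideanSpace ℝ (Fin 1)) × ℝ →L[ℝ] ℝ => T u w) h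
  have hR : ∀ w, B (0, 1) w = Real.exp t * (A w.1).1 := by
    intro w
    rw [hBm]
    refine (magneticForm_of_vertical g τ (c, t) rfl (mfderiv_polarMap_radial g c t) w).trans ?_
    rw [map_smul]
    exact congrArg (Real.exp t * ·) (hΦ₁ c w.1).symm
  have hV : ∀ w, B (A.symm (0, 0, 1), 0) w = (Real.exp t * μ) * (A w.1).2.1 := by
    intro w
    rw [hA, hBm]
    refine (magneticForm_of_vertical g τ (c, t) rfl
      (mfderiv_polarMap_vertical g c t η) w).trans ?_
    rw [map_smul, mul_assoc]
    exact congrArg (Real.exp t * ·) (hμ' w.1)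
  refine ⟨Real.exp t * μ, B (A.symm (1, 0, 0), 0) (A.symm (0, 1, 0), 0), by positivity,
    fun v w => ?_⟩
  refine (productForm_apply Ω ((c, t), 0) _ _).trans ?_
  have key := splitForm_of_frame (hΩ (c, t)) A hR hV (A.symm v.1, v.2.1) (A.symm w.1, w.2.1)
  simp only [ContinuousLinearEquiv.apply_symm_apply] at key
  have hy : ∀ z : ℝ × ℝ, planeCoord (planeCoord.symm z) = z := planeCoord.apply_symm_apply
  change B (A.symm v.1, v.2.1) (A.symm w.1, w.2.1) +
    ((planeCoord (planeCoord.symm v.2.2)).1 * (planeCoord (planeCoord.symm w.2.2)).2 -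
      (planeCoord (planeCoord.symm v.2.2)).2 * (planeCoord (planeCoord.symm w.2.2)).1) = _
  rw [hy, hy, key]
  rfl

lemma IsSmoothFrame.pullbackBilin_eq_pairingForm {E : Type*} [NormedAddCommGroup E]
    [NormedSpace ℝ E] [FiniteDimensional ℝ E] {H : Type*} [TopologicalSpace H]
    {I : ModelWithCorners ℝ E H} [I.Boundaryless]
    {Q : Type*} [TopologicalSpace Q] [ChartedSpace H Q] [IsManifold I ∞ Q]
    {Φ : ∀ x : Q, TangentSpace I x ≃L[ℝ] ℝ × ℝ × ℝ} (hΦ : IsSmoothFrame Φ) (x : Q)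
    (v w : (ℝ × ℝ × ℝ) × (ℝ × ℝ × ℝ)) :
    pullbackBilin (I := (I.prod 𝓘(ℝ, ℝ)).prod (𝓡 2)) hΦ.cotangentDiffeomorph
      (cotangentForm I Q) ((x, 0), 0) ((productFrame Φ ((x, 0), 0)).symm v)
        ((productFrame Φ ((x, 0), 0)).symm w) = pairingForm v w := by
  refine (hΦ.pullbackBilin_cotangentDiffeomorph x _ _).trans ?_
  have hy : ∀ z : ℝ × ℝ, planeCoord (planeCoord.symm z) = z := planeCoord.apply_symm_apply
  have hA : ∀ a, Φ x ((Φ x).symm a) = a := (Φ x).apply_symm_apply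
  change dualForm (v.2.1, planeCoord (planeCoord.symm v.2.2)) (Φ x ((Φ x).symm w.1)) -
    dualForm (w.2.1, planeCoord (planeCoord.symm w.2.2)) (Φ x ((Φ x).symm v.1)) = _
  rw [hy, hy, hA, hA]
  rfl

/-- Almost complex structures which are tamed by forms of the model types along slices are
homotopic. -/
lemma IsSmoothFrame.almostComplexHomotopic_of_tame {E : Type*} [NormedAddCommGroup E]
    [NormedSpace ℝ E] [FiniteDimensional ℝ E] {H : Type*} [TopologicalSpace H]
    {I : ModelWithCorners ℝ E H}
    {Q : Type*} [TopologicalSpace Q] [ChartedSpace H Q] [IsManifold I ∞ Q]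
    {Φ : ∀ x : Q, TangentSpace I x ≃L[ℝ] ℝ × ℝ × ℝ} (hΦ : IsSmoothFrame Φ)
    {J₁ J₂ : EndField ((I.prod 𝓘(ℝ, ℝ)).prod (𝓡 2)) ((Q × ℝ) × EuclideanSpace ℝ (Fin 2))}
    (hJ₁ : IsAlmostComplex J₁) (hJ₂ : IsAlmostComplex J₂)
    {Ω₁ Ω₂ : BilinForm ((I.prod 𝓘(ℝ, ℝ)).prod (𝓡 2)) ((Q × ℝ) × EuclideanSpace ℝ (Fin 2))}
    (hs₁ : IsSmoothOnFields Ω₁)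
    (h₁ : ∀ p (v : TangentSpace ((I.prod 𝓘(ℝ, ℝ)).prod (𝓡 2)) p), v ≠ 0 → 0 < Ω₁ p v (J₁ p v))
    (h₂ : ∀ p (v : TangentSpace ((I.prod 𝓘(ℝ, ℝ)).prod (𝓡 2)) p), v ≠ 0 → 0 < Ω₂ p v (J₂ p v))
    {t e : ℝ} (he : 0 < e)
    (hΩ₁ : ∀ c : Q, ∃ μ k : ℝ, 0 < μ ∧ ∀ v w : (ℝ × ℝ × ℝ) × (ℝ × ℝ × ℝ),
      Ω₁ ((c, t), 0) ((productFrame Φ ((c, t), 0)).symm v)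
        ((productFrame Φ ((c, t), 0)).symm w) = splitForm e μ k v w)
    (hΩ₂ : ∀ (c : Q) (v w : (ℝ × ℝ × ℝ) × (ℝ × ℝ × ℝ)),
      Ω₂ ((c, 0), 0) ((productFrame Φ ((c, 0), 0)).symm v)
        ((productFrame Φ ((c, 0), 0)).symm w) = pairingForm v w) :
    AlmostComplexHomotopic J₁ J₂ := by
  have hΨ := isSmoothFrame_productFrame hΦ
  have hcoef : ∀ v w : (ℝ × ℝ × ℝ) × (ℝ × ℝ × ℝ),
      Continuous fun p : (Q × ℝ) × EuclideanSpace ℝ (Fin 2) =>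
        Ω₁ ((p.1.1, t), 0) ((productFrame Φ ((p.1.1, t), 0)).symm v)
          ((productFrame Φ ((p.1.1, t), 0)).symm w) := fun v w =>
    (hs₁ _ _ (hΨ.contMDiff_symm_const v) (hΨ.contMDiff_symm_const w)).continuous.comp
      (sliceRetraction Q t).continuous
  choose μ k hμ hμk using hΩ₁
  have hμc : Continuous fun p : (Q × ℝ) × EuclideanSpace ℝ (Fin 2) => μ p.1.1 :=
    (hcoef ((0, 0, 1), 0) ((0, 1, 0), 0)).congr fun p => by
      rw [hμk]
      simp [splitForm]
  have hkc : Continuous fun p : (Q × ℝ) × EuclideanSpace ℝ (Fin 2) => k p.1.1 :=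
    (hcoef ((1, 0, 0), 0) ((0, 1, 0), 0)).congr fun p => by
      rw [hμk]
      simp [splitForm]
  let κ : C((Q × ℝ) × EuclideanSpace ℝ (Fin 2), ℝ) :=
    ⟨fun p => √(e * μ p.1.1 / (1 + k p.1.1 ^ 2)),
      ((hμc.const_mul e).div (continuous_const.add (hkc.pow 2)) fun p =>
        (by positivity : 0 < 1 + k p.1.1 ^ 2).ne').sqrt⟩
  have hpos : ∀ p : (Q × ℝ) × EuclideanSpace ℝ (Fin 2),
      0 < e * μ p.1.1 / (1 + k p.1.1 ^ 2) := fun p =>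
    div_pos (mul_pos he (hμ _)) (by positivity)
  have hκ : ∀ p, 0 < κ p := fun p => Real.sqrt_pos.mpr (hpos p)
  have hκ' : ∀ p : (Q × ℝ) × EuclideanSpace ℝ (Fin 2),
      (k p.1.1 * κ p) ^ 2 < 4 * (e * μ p.1.1) := by
    intro p
    have h3 : κ p ^ 2 = e * μ p.1.1 / (1 + k p.1.1 ^ 2) := Real.sq_sqrt (hpos p).le
    have h4 : e * μ p.1.1 / (1 + k p.1.1 ^ 2) * (1 + k p.1.1 ^ 2) = e * μ p.1.1 :=
      div_mul_cancel₀ _ (by positivity)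
    have h5 := mul_pos he (hμ p.1.1)
    rw [mul_pow, h3]
    nlinarith [hpos p]
  let f₁ : C((Q × ℝ) × EuclideanSpace ℝ (Fin 2), _) :=
    ⟨frameStructure (productFrame Φ) hJ₁, hΨ.continuous_frameStructure hJ₁⟩
  let f₂ : C((Q × ℝ) × EuclideanSpace ℝ (Fin 2), _) :=
    ⟨frameStructure (productFrame Φ) hJ₂, hΨ.continuous_frameStructure hJ₂⟩
  have key : ∀ {J : EndField ((I.prod 𝓘(ℝ, ℝ)).prod (𝓡 2)) ((Q × ℝ) × EuclideanSpace ℝ (Fin 2))}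
      (hJ : IsAlmostComplex J)
      (p : (Q × ℝ) × EuclideanSpace ℝ (Fin 2)) (v : (ℝ × ℝ × ℝ) × (ℝ × ℝ × ℝ)),
      (productFrame Φ p).symm ((frameStructure (productFrame Φ) hJ p).1 v) =
        J p ((productFrame Φ p).symm v) := fun hJ p v =>
    (productFrame Φ p).symm_apply_apply _
  refine hΨ.almostComplexHomotopic hJ₁ hJ₂ ?_
  have c1 := homotopic_comp_sliceRetraction t f₁
  have c2 : (f₁.comp (sliceRetraction Q t)).Homotopic (splitFamily κ hκ) :=
    LinearComplexStructure.homotopic_of_tame (fun p => splitForm e (μ p.1.1) (k p.1.1))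
      (fun p => splitForm_add _ _ _) (fun p => splitForm_smul _ _ _)
      (fun p v hv => by
        have h3 := h₁ ((p.1.1, t), 0) ((productFrame Φ ((p.1.1, t), 0)).symm v)
          (by simpa using hv)
        rw [← key hJ₁, hμk] at h3
        exact h3)
      (fun p v hv => splitForm_pos he (hμ _) (hκ p) (hκ' p) hv)
  have c3 := splitFamily_homotopic_cotangentFamily κ hκ
  have c4 : (cotangentFamily ((Q × ℝ) × EuclideanSpace ℝ (Fin 2))).Homotopic
      (f₂.comp (sliceRetraction Q 0)) :=
    LinearComplexStructure.homotopic_of_tame (fun _ => pairingForm)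
      (fun _ => pairingForm_add) (fun _ => pairingForm_smul)
      (fun _ v hv => pairingForm_pos hv)
      (fun p v hv => by
        have h3 := h₂ ((p.1.1, 0), 0) ((productFrame Φ ((p.1.1, 0), 0)).symm v)
          (by simpa using hv)
        rw [← key hJ₂, hΩ₂] at h3
        exact h3)
  exact c1.trans (c2.trans (c3.trans (c4.trans (homotopic_comp_sliceRetraction 0 f₂).symm)))

end FormsInFrame

theorem mainTheorem7
    {S : Type*} [TopologicalSpace S] [T2Space S] [CompactSpace S] [ConnectedSpace S]
    [ChartedSpace (EuclideanSpace ℝ (Fin 2)) S] [IsManifold (𝓡 2) ∞ S]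
    -- a nowhere vanishing 2-form, which orients `S`
    (σ : BilinForm (𝓡 2) S) (hσ : IsSmoothTwoForm σ) (hσ' : IsNondegenerateBilin σ) :
    Nonempty (((TangentCircleBundle S × ℝ) × EuclideanSpace ℝ (Fin 2))
      ≃ₘ^∞⟮modelCRR, modelCotangentC⟯ CotangentBundle modelC (TangentCircleBundle S)) ∧
    ∀ (g : ContMDiffRiemannianMetric (𝓡 2) ∞ (EuclideanSpace ℝ (Fin 2))
        (fun x : S => TangentSpace (𝓡 2) x))
      -- a 2-form `τ` on `S` (the magnetic term; for instance an area form)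
      (τ : BilinForm (𝓡 2) S) (_ : IsSmoothTwoForm τ)
      -- an exact symplectic form `dθ` on `C × ℝ = T^*S ∖ S` which coincides with the magnetic form
      -- `dλ + π^*τ` on some shell `C × (a, b)`
      (θ : OneForm modelCR (TangentCircleBundle S × ℝ)) (_ : IsSmoothOneForm θ)
      (_ : IsNondegenerateBilin (extDerivOneForm θ))
      (a b : ℝ) (_ : a < b)
      (_ : ∀ (c : TangentCircleBundle S) (t : ℝ), a < t → t < b →
        extDerivOneForm θ (c, t) = magneticForm g τ (c, t)),
      (∃ J₁, IsAlmostComplex J₁ ∧ IsCompatible J₁ (productForm (extDerivOneForm θ))) ∧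
      (∃ J₂, IsAlmostComplex J₂ ∧
        IsCompatible J₂ (cotangentForm modelC (TangentCircleBundle S))) ∧
      ∃ φ : ((TangentCircleBundle S × ℝ) × EuclideanSpace ℝ (Fin 2))
          ≃ₘ^∞⟮modelCRR, modelCotangentC⟯ CotangentBundle modelC (TangentCircleBundle S),
        ∀ J₁ J₂, IsAlmostComplex J₁ → IsCompatible J₁ (productForm (extDerivOneForm θ)) →
          IsAlmostComplex J₂ →
          IsCompatible J₂ (cotangentForm modelC (TangentCircleBundle S)) →
          AlmostComplexHomotopic J₁ (pullbackEnd φ J₂) := by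
  refine ⟨?_, fun g τ _ θ hθ hθ' a b hab hab' => ?_⟩
  · obtain ⟨n, ι, hι, -, hinj⟩ := exists_embedding_euclidean_of_compact (I := 𝓡 2) (M := S)
    obtain ⟨Φ, hΦ, -⟩ := exists_circleFrame (inducedMetric hι hinj) hσ hσ'
    exact ⟨hΦ.cotangentDiffeomorph⟩
  · obtain ⟨Φ, hΦ, hΦ₁, hΦ₂⟩ := exists_circleFrame g hσ hσ'
    have hΨ := isSmoothFrame_productFrame hΦ
    obtain ⟨Ψ', hΨ'⟩ := hΨ.exists_of_diffeomorph hΦ.cotangentDiffeomorph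
    have hs : IsSmoothOnFields (productForm (extDerivOneForm θ)) :=
      isSmoothOnFields_productForm (isSmoothOnFields_extDerivOneForm hθ) hΦ
    refine ⟨hΨ.exists_compatible (productForm_self (extDerivOneForm_self θ))
        (isNondegenerateBilin_productForm hθ') hs,
      hΨ'.exists_compatible (extDerivOneForm_self canonicalOneForm)
        isNondegenerateBilin_cotangentForm
        (isSmoothOnFields_extDerivOneForm isSmoothOneForm_canonicalOneForm),
      hΦ.cotangentDiffeomorph, fun J₁ J₂ hJ₁ hc₁ hJ₂ hc₂ => ?_⟩
    exact hΦ.almostComplexHomotopic_of_tame hJ₁ (hJ₂.pullbackEnd _) hs hc₁.2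
      (fun p v hv => hc₂.pullbackEnd_pos _ p hv) (t := (a + b) / 2) (Real.exp_pos _)
      (fun c => exists_productForm_eq_splitForm g hΦ₁ hΦ₂ (extDerivOneForm_self θ) c _
        (hab' c _ (by linarith) (by linarith)))
      hΦ.pullbackBilin_eq_pairingForm
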